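/- **Setting.** Let $m_1,m_2,m_3>0$ and $\alpha>0$, let $E=\mathbb{R}^3$, $\mathcal{X}=\{x\in E^3: \sum_i m_ix_i=0\}$, $\mathbb{T}=\mathbb{R}/2\pi\mathbb{Z}$ and $\Lambda=H^1(\mathbb{T},\mathcal{X})$. A *symmetry group* is a subgroup $G\subset O(\mathbb{T})\times O(3)\times\Sigma_3$ with $O(\mathbb{T})=O(2)$, with projections $\tau,\rho,\sigma$, such that $m_{\sigma(g)i}=m_i$ for all $g\in G$. We assume that the problem is genuinely spatial: no $g\in G$ with $\tau(g)=1$ and $\sigma(g)=()$ has $\rho(g)$ equal to the reflection in a plane (such an element confines all bodies to a fixed plane). Let $\Lambda^G$ be the set of $G$-equivariant loops, $x_{\sigma(g)i}(\tau(g)t)=\rho(g)x_i(t)$. For $\underline\omega\in E$ let $\Omega=\begin{pmatrix}0&\omega_3&-\omega_2\\-\omega_3&0&\omega_1\\ \omega_2&-\omega_1&0\end{pmatrix}$ and $$\mathcal{A}_{\underline\omega}(x)=\int_{\mathbb{T}}\Big(\tfrac12\sum_i m_i|\dot x_i+\Omega x_i|^2+\sum_{i<j}\frac{m_im_j}{|x_i-x_j|^\alpha}\Big)dt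 .$$ A *possible rotation vector* of $G$ is a vector $\underline\omega$ with $\rho(g)\underline\omega=\det\tau(g)\det\rho(g)\,\underline\omega$ for all $g\in G$ (that is, $\underline\omega=0$ or $\underline\omega$ is a rotation axis of $G$). The group $G$ is *bound to collisions* if every $x\in\Lambda^G$ has $x_i(t)=x_j(t)$ for some $t$ and some $i\ne j$; *fully uncoercive* if for every possible rotation vector $\underline\omega$ the functional $\mathcal{A}_{\underline\omega}|_{\Lambda^G}$ is not coercive (it does not tend to $+\infty$ with the $H^1$ norm); *homographic* if every $x\in\Lambda^G$ is constant up to rescaling and orthogonal motions. Its *core* is $\ker\tau\subset G$. It is of *vertical isosceles type* if its core is generated by an element $k$ such that $\rho(k)$ is the rotation of angle $\pi$ around an axis and $\sigma(k)$ is a transposition. A *change of rotating frame* of $G$, with possible rotation vector $\underline\omega$ and factor $c>0$, passes from $x(t)$ to $e^{t\Omega}x(t)$ and then multiplies the unit of time by $c$: it replaces each element $(t\mapsto\pm t+b,\;A,\;s)$, where $b\in\mathbb{R}$ and time motions are taken on the line $\mathbb{R}$ (each element of $G$ has several lifts, with $b$ determined modulo $2\pi$, and all are used), by $(t\mapsto\pm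 t+cb,\;e^{b\Omega}A,\;s)$; it is allowed when the resulting elements are again all the lifts to the line of the elements of a symmetry group $G'$ on $\mathbb{R}/2\pi\mathbb{Z}$. Write $G\sim H$ if a change of rotating frame of $G$ yields a group $G'$ conjugate to $H$ in $O(\mathbb{T})\times O(3)\times\Sigma_3$. **Theorem A.** Let $G$ be a symmetry group as above that is not bound to collisions, not fully uncoercive and not homographic. 1. If the core of $G$ is trivial, then $G\sim H$ for one of the following three-dimensional extensions $H$ of planar groups: $$C_1^-,\ L_2^{+,-},\ L_2^{-,+},\ H_2^{+,-},\ H_2^{-,+},\ H_4^{+,-},\ H_4^{-,+},\ C_3^+,\ C_3^-,\ L_6^{+,+},\ L_6^{+,-},\ L_6^{-,+},\ D_6^{+,-},\ D_6^{-,+},\ D_{12}^{-,+}.$$ 2. If the core of $G$ is non-trivial, then $G$ is of vertical isosceles type. Here $X^{\epsilon_1,\epsilon_2}$ is generated by $r$ and $h$, and $X^{\epsilon_1}$ by $r$ alone, where $\rho(r)=\rho_2(r)\oplus\epsilon_1$ and $\rho(h)=\rho_2(h)\oplus\epsilon_2$ on $\mathbb{R}^2\oplus\mathbb{R}$; $\tau(h)$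 is $t\mapsto-t$ and $\tau(r)$ is $t\mapsto t+2\pi/N$, with $N$ the order of $(\rho(r),\sigma(r))$; and, with $l=\mathrm{diag}(1,-1)$, | group | $\rho_2(r),\ \sigma(r)$ | $\rho_2(h),\ \sigma(h)$ | |---|---|---| | $C_1$ | $1,\ ()$ | | | $L_2$ | $1,\ ()$ | $l,\ ()$ | | $H_2$ | $1,\ ()$ | $l,\ (1,2)$ | | $H_4$ | $1,\ (1,2)$ | $l,\ (1,2)$ | | $C_3$ | $1,\ (1,2,3)$ | | | $L_6$ | $1,\ (1,2,3)$ | $l,\ (1,2)$ | | $D_6$ | $1,\ (1,2,3)$ | $-1,\ (1,2)$ | | $D_{12}$ | $l,\ (1,2,3)$ | $-l,\ (1,2)$ | -/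

import Mathlib

open MeasureTheory Matrix

noncomputable section

namespace ThreeBody

/-- The space `E = ℝ³` with its Euclidean norm. -/
abbrev E := EuclideanSpace ℝ (Fin 3)

/-- The orthogonal group `O(n)`. -/
abbrev O (n : ℕ) := Matrix.orthogonalGroup (Fin n) ℝ

/-- The group `O(𝕋) × O(3) × Σ₃`. Here `O(𝕋) = O(2)` acts on the time circle `ℝ/2πℤ`, seen as the
unit circle of the plane; the bodies `1, 2, 3` are indexed by `0, 1, 2`. -/
abbrev Sym := O 2 × O 3 × Equiv.Perm (Fin 3)

/-- The three projections of the group `O(𝕋) × O(3) × Σ₃`. -/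
abbrev tau (g : Sym) : O 2 := g.1
abbrev rho (g : Sym) : O 3 := g.2.1
abbrev sigma (g : Sym) : Equiv.Perm (Fin 3) := g.2.2

/-- Action of a `3 × 3` matrix on the space `E`. -/
def act (A : Matrix (Fin 3) (Fin 3) ℝ) (x : E) : E := WithLp.toLp 2 (A *ᵥ x.ofLp)

/-- The point of the time circle at the time `t`. -/
def clock (t : ℝ) : Fin 2 → ℝ := ![Real.cos t, Real.sin t]

/-- The symmetry moves the time `t` to the time `s` (modulo `2π`). -/
def MovesTime (g : Sym) (t s : ℝ) : Prop := (tau g).1 *ᵥ clock t = clock s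

/-! ### Loops and the action functional -/

/-- The elements of `Λ = H¹(𝕋, 𝒳)`: `2π`-periodic paths of centred configurations that are the
primitive of a square-integrable velocity. -/
structure Loop (m : Fin 3 → ℝ) where
  pos : ℝ → Fin 3 → E
  vel : ℝ → Fin 3 → E
  periodic : ∀ t, pos (t + 2 * Real.pi) = pos t
  centered : ∀ t, ∑ i, m i • pos t i = 0
  vel_memLp : ∀ i, MemLp (fun t => vel t i) 2 (volume.restrict (Set.Ioc 0 (2 * Real.pi)))
  pos_eq : ∀ t ∈ Set.Icc 0 (2 * Real.pi), ∀ i, pos t i = pos 0 i + ∫ s in (0 : ℝ)..t, vel s i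

/-- The loop belongs to `Λ^G`, that is, `x_{gi}(gt) = g x_i(t)` for all `g`, `t`, `i`. -/
def Loop.Equivariant {m : Fin 3 → ℝ} (x : Loop m) (G : Subgroup Sym) : Prop :=
  ∀ g ∈ G, ∀ t s : ℝ, MovesTime g t s → ∀ i, x.pos s (sigma g i) = act (rho g).1 (x.pos t i)

/-- The square of the `H¹` norm. -/
def Loop.normSq {m : Fin 3 → ℝ} (x : Loop m) : ENNReal :=
  ∫⁻ t in Set.Ioc 0 (2 * Real.pi),
    ENNReal.ofReal (∑ i, (‖x.pos t i‖ ^ 2 + ‖x.vel t i‖ ^ 2))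

/-- The matrix `Ω` of the rotation vector `ω`. -/
def Omega (ω : E) : Matrix (Fin 3) (Fin 3) ℝ :=
  !![0, ω 2, -ω 1; -ω 2, 0, ω 0; ω 1, -ω 0, 0]

/-- The kinetic energy in the frame rotating around `ω` with angular speed `|ω|`. -/
def kinetic (m : Fin 3 → ℝ) (ω : E) (x v : Fin 3 → E) : ℝ :=
  (∑ i, m i * ‖v i + act (Omega ω) (x i)‖ ^ 2) / 2

/-- The term of the potential given by one pair of bodies; it is infinite at a collision. -/
def pairPotential (m : Fin 3 → ℝ) (α : ℝ) (x : Fin 3 → E) (i j : Fin 3) : ENNReal :=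
  ENNReal.ofReal (m i * m j) / ENNReal.ofReal (‖x i - x j‖ ^ α)

/-- The `α`-homogeneous potential. -/
def potential (m : Fin 3 → ℝ) (α : ℝ) (x : Fin 3 → E) : ENNReal :=
  pairPotential m α x 0 1 + pairPotential m α x 0 2 + pairPotential m α x 1 2

/-- The action functional in the frame rotating around `ω`. -/
def action {m : Fin 3 → ℝ} (α : ℝ) (ω : E) (x : Loop m) : ENNReal :=
  ∫⁻ t in Set.Ioc 0 (2 * Real.pi),
    (ENNReal.ofReal (kinetic m ω (x.pos t) (x.vel t)) + potential m α (x.pos t))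

/-! ### Properties of symmetry groups -/

/-- Every equivariant loop has a collision. -/
def BoundToCollisions (m : Fin 3 → ℝ) (G : Subgroup Sym) : Prop :=
  ∀ x : Loop m, x.Equivariant G → ∃ t, ∃ i j : Fin 3, i ≠ j ∧ x.pos t i = x.pos t j

/-- Every equivariant loop is constant up to rescaling and orthogonal motions. -/
def Homographic (m : Fin 3 → ℝ) (G : Subgroup Sym) : Prop :=
  ∀ x : Loop m, x.Equivariant G → ∃ q : Fin 3 → E, ∀ t, ∃ (c : ℝ) (R : O 3),
    ∀ i, x.pos t i = c • act R.1 (q i)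

/-- `ω` is a possible rotation vector for `G`: either `ω = 0`, or `ω` is a rotation axis, that is,
it spans a `G`-invariant line on which `G` acts through the character `det τ · det ρ`. -/
def IsRotationVector (G : Subgroup Sym) (ω : E) : Prop :=
  ∀ g ∈ G, act (rho g).1 ω = ((tau g).1.det * (rho g).1.det) • ω

/-- The action functional restricted to the equivariant loops is coercive: it tends to infinity
with the `H¹` norm, so that its sublevels are bounded. -/
def Coercive (m : Fin 3 → ℝ) (α : ℝ) (G : Subgroup Sym) (ω : E) : Prop :=
  ∀ C : NNReal, ∃ R : NNReal, ∀ x : Loop m, x.Equivariant G →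
    action α ω x ≤ C → x.normSq ≤ R

/-- The action functional is not coercive for any possible rotation vector. -/
def FullyUncoercive (m : Fin 3 → ℝ) (α : ℝ) (G : Subgroup Sym) : Prop :=
  ∀ ω : E, IsRotationVector G ω → ¬ Coercive m α G ω

/-- The core `ker τ` of a symmetry group. -/
def core (G : Subgroup Sym) : Subgroup Sym := G ⊓ (MonoidHom.fst (O 2) _).ker

/-- The rotation of angle `π` around an axis. -/
def IsHalfTurn (A : O 3) : Prop :=
  ∃ u : E, ‖u‖ = 1 ∧ ∀ x, act A.1 x = (2 * inner ℝ u x) • u - x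

/-- The reflection in a plane. -/
def IsPlaneReflection (A : O 3) : Prop :=
  ∃ u : E, ‖u‖ = 1 ∧ ∀ x, act A.1 x = x - (2 * inner ℝ u x) • u

/-- Vertical isosceles type: the core is generated by an element acting as a rotation of angle `π`
in space and as a transposition on the indices. -/
def VerticalIsosceles (G : Subgroup Sym) : Prop :=
  ∃ k : Sym, core G = Subgroup.zpowers k ∧ IsHalfTurn (rho k) ∧
    IsConj (sigma k) (Equiv.swap 0 1)

/-! ### Explicit elements -/

/-- The diagonal matrix with the given signs. -/
def signs {n : ℕ} (ε : Fin n → ℤˣ) : O n :=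
  ⟨Matrix.diagonal fun i => ((ε i : ℤ) : ℝ), by
    rw [Matrix.mem_orthogonalGroup_iff, Matrix.diagonal_transpose,
      Matrix.diagonal_mul_diagonal, ← Matrix.diagonal_one]
    congr 1
    funext i
    rcases Int.units_eq_one_or (ε i) with h | h <;> simp [h]⟩

/-- The rotation of angle `b` in the plane. -/
def rot (b : ℝ) : O 2 :=
  ⟨!![Real.cos b, -Real.sin b; Real.sin b, Real.cos b], by
    rw [Matrix.mem_orthogonalGroup_iff]
    ext i j
    have h := Real.sin_sq_add_cos_sq b
    fin_cases i <;> fin_cases j <;>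
      simp [Matrix.mul_apply, Fin.sum_univ_two] <;> nlinarith⟩

/-- The motion `t ↦ ε t + b` of the time circle. -/
def timeMotion (ε : ℤˣ) (b : ℝ) : O 2 := rot b * signs ![1, ε]

/-! ### Change of rotating frame -/

/-- `G'` is `G` written in another rotating frame: the new coordinates of a path `x` are
`y(t) = exp(tΩ) x(t)`, and the unit of time is changed by the factor `c`, so that the new paths
have period `2π` again. If `x_{s i}(ε t + b) = A x_i(t)` and `ω` is a rotation vector, then
`y_{s i}(ε t + b) = exp(bΩ) A y_i(t)`; elements are followed on the time line, where the
translation part `b` is a real number. -/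
def FrameChange (ω : E) (c : ℝ) (G G' : Subgroup Sym) : Prop :=
  ∀ (ε : ℤˣ) (b : ℝ) (A A' : O 3) (s : Equiv.Perm (Fin 3)),
    A'.1 = NormedSpace.exp (b • Omega ω) * A.1 →
      ((timeMotion ε b, A, s) ∈ G ↔ (timeMotion ε (c * b), A', s) ∈ G')

/-- Conjugacy of symmetry groups in `O(𝕋) × O(3) × Σ₃`. -/
def Conjugate (G H : Subgroup Sym) : Prop :=
  ∃ g : Sym, G.map (MulAut.conj g).toMonoidHom = H

/-- A change of rotating frame writes `G` as a group conjugate to `H`. -/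
def Equivalent (G H : Subgroup Sym) : Prop :=
  ∃ ω : E, IsRotationVector G ω ∧ ∃ c : ℝ, 0 < c ∧ ∃ G' : Subgroup Sym,
    FrameChange ω c G G' ∧ Conjugate G' H

/-! ### Three-dimensional extensions of planar groups -/

/-- The generator `r`: a time shift of `2π / N`, the diagonal planar matrix with entries `a`, `b`
extended by `e` on the vertical axis, and a permutation. In each use below, `N` is the order of
the pair formed by the matrix and the permutation. -/
def genR (N : ℕ) (a b : ℤˣ) (s : Equiv.Perm (Fin 3)) (e : ℤˣ) : Sym :=
  (timeMotion 1 (2 * Real.pi / N), signs ![a, b, e], s)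

/-- The generator `h`: the time reflection `t ↦ -t`, the diagonal planar matrix with entries `a`,
`b` extended by `e` on the vertical axis, and a permutation. -/
def genH (a b : ℤˣ) (s : Equiv.Perm (Fin 3)) (e : ℤˣ) : Sym :=
  (timeMotion (-1) 0, signs ![a, b, e], s)

/-- The transposition of the first two bodies. -/
def swap12 : Equiv.Perm (Fin 3) := Equiv.swap 0 1

/-- The cyclic permutation of the three bodies. -/
def cyc123 : Equiv.Perm (Fin 3) := finRotate 3

/-- The names of the space extensions of planar groups; `p` and `m` stand for the signs of
the generators `r` and `h` (in this order) on the vertical axis. -/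
inductive SpaceExtension
  | C1_m
  | L2_pm | L2_mp
  | H2_pm | H2_mp
  | H4_pm | H4_mp
  | C3_p | C3_m
  | L6_pp | L6_pm | L6_mp
  | D6_pm | D6_mp
  | D12_mp

/-- The symmetry groups named above. -/
def SpaceExtension.group : SpaceExtension → Subgroup Sym
  | .C1_m => Subgroup.closure {genR 2 1 1 1 (-1)}
  | .L2_pm => Subgroup.closure {genR 1 1 1 1 1, genH 1 (-1) 1 (-1)}
  | .L2_mp => Subgroup.closure {genR 2 1 1 1 (-1), genH 1 (-1) 1 1}
  | .H2_pm => Subgroup.closure {genR 1 1 1 1 1, genH 1 (-1) swap12 (-1)}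
  | .H2_mp => Subgroup.closure {genR 2 1 1 1 (-1), genH 1 (-1) swap12 1}
  | .H4_pm => Subgroup.closure {genR 2 1 1 swap12 1, genH 1 (-1) swap12 (-1)}
  | .H4_mp => Subgroup.closure {genR 2 1 1 swap12 (-1), genH 1 (-1) swap12 1}
  | .C3_p => Subgroup.closure {genR 3 1 1 cyc123 1}
  | .C3_m => Subgroup.closure {genR 6 1 1 cyc123 (-1)}
  | .L6_pp => Subgroup.closure {genR 3 1 1 cyc123 1, genH 1 (-1) swap12 1}
  | .L6_pm => Subgroup.closure {genR 3 1 1 cyc123 1, genH 1 (-1) swap12 (-1)}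
  | .L6_mp => Subgroup.closure {genR 6 1 1 cyc123 (-1), genH 1 (-1) swap12 1}
  | .D6_pm => Subgroup.closure {genR 3 1 1 cyc123 1, genH (-1) (-1) swap12 (-1)}
  | .D6_mp => Subgroup.closure {genR 6 1 1 cyc123 (-1), genH (-1) (-1) swap12 1}
  | .D12_mp => Subgroup.closure {genR 6 1 (-1) cyc123 (-1), genH (-1) 1 swap12 1}

end ThreeBody

end

/-!
A classification of the symmetry groups of the spatial three-body problem that may have
minimizers of interest. The three hypotheses on the group are used as follows.

*Coercivity.* Suppose that some loop `y` of `Λ^G` has no collision, and that `G` fixes a nonzero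
constant configuration `q` that is at rest in the rotating frame. The loops `c q + y` belong to
`Λ^G`, and as `c` grows their kinetic energy is that of `y`, while the mutual distances stay away
from zero: the action is bounded and the functional is not coercive (`not_coercive_of_fixed`). A
group with such a `q` for each possible rotation vector is fully uncoercive. The configuration `q`
is either explicit, on a line of eigenvectors of the group (`HasLineConfig`), or the mean of a
component of a loop (`fullyUncoercive_of_line`).

*Homographic groups.* Triples of vectors with equal Gram matrices differ by an orthogonal map
(`exists_act_eq_of_inner_eq`), so a group is homographic as soon as the Gram matrix of its loops is
determined up to scaling (`homographic_of_gram`).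

*Non-trivial core.* An element of the core acts at each time. If it fixes the bodies it is trivial,
since otherwise the bodies stay at the origin, on the axis of a rotation, or in a plane
(`rho_eq_one_of_core`). If it permutes them cyclically, the masses are equal and the bodies form an
equilateral triangle, so that `G` is homographic. Hence the core has order two, and its generator
`k` exchanges two bodies and acts as an involution on space. The identity gives a collision; `-1`
puts the third body at the origin, which is homographic; a plane reflection keeps the two bodies on
opposite sides of its plane, so that the mean of the components orthogonal to this plane is a
nonzero fixed configuration, and `G` is fully uncoercive. A half turn remains.

*Trivial core.* Then `G` is isomorphic to its projection on the motions of time. If the shifts of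
time are dense, the Gram matrix of a loop is constant and `G` is homographic; otherwise `G` is
generated by a shift `r` and possibly a reversal `h` (`isCyclicGroup_or_isDihedralGroup`).

Suppose that `G` has a rotation axis; this is always so in the cyclic case. On the axis, `r` and `h`
act by signs `ε` and `δ`. In a suitable rotating frame `r` is trivial on the orthogonal plane, and
`h` is a reflection of this plane, so that `G` is determined up to equivalence by the permutations
of `r` and `h` and by these signs. Configurations on the axis that are symmetric or antisymmetric in
two bodies exclude some of the signs, and the choice of `r h` instead of `h`, which replaces
`(ε, δ)` by `(ε, ε δ)`, identifies some of the others.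

Suppose that `G` is dihedral without rotation axis. Then the generators are diagonal in a common
orthonormal basis, with the same signs on two of the axes (`exists_eigen_of_no_axis`). At the time
fixed by a reversal acting as `1` on space the bodies that it exchanges collide, and at the time
fixed by a reversal acting as `-1` the bodies that it does not exchange are at the origin. If the
bodies are not permuted cyclically, this determines the signs enough for a fixed configuration on
one of the axes. If they are, the remaining signs are those of `D₆^{+,-}`, `D₆^{-,+}` and
`D₁₂^{-,+}`.
-/

namespace ThreeBody

/-! ### The action of matrices on space -/

@[simp] lemma act_apply (A : Matrix (Fin 3) (Fin 3) ℝ) (x : E) (i : Fin 3) :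
    act A x i = (A *ᵥ x.ofLp) i := rfl

lemma act_eq_toEuclideanCLM (A : Matrix (Fin 3) (Fin 3) ℝ) (x : E) :
    act A x = Matrix.toEuclideanCLM (𝕜 := ℝ) A x := by
  ext i; simp [act]

lemma act_add (A : Matrix (Fin 3) (Fin 3) ℝ) (x y : E) : act A (x + y) = act A x + act A y := by
  simp [act_eq_toEuclideanCLM]

lemma act_sub (A : Matrix (Fin 3) (Fin 3) ℝ) (x y : E) : act A (x - y) = act A x - act A y := by
  simp [act_eq_toEuclideanCLM]

lemma act_neg (A : Matrix (Fin 3) (Fin 3) ℝ) (x : E) : act A (-x) = -act A x := by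
  simp [act_eq_toEuclideanCLM]

lemma act_smul (A : Matrix (Fin 3) (Fin 3) ℝ) (c : ℝ) (x : E) : act A (c • x) = c • act A x := by
  simp [act_eq_toEuclideanCLM]

@[simp] lemma act_zero (A : Matrix (Fin 3) (Fin 3) ℝ) : act A 0 = 0 := by
  simp [act_eq_toEuclideanCLM]

@[simp] lemma act_one (x : E) : act 1 x = x := by
  simp [act]

lemma act_mul (A B : Matrix (Fin 3) (Fin 3) ℝ) (x : E) : act (A * B) x = act A (act B x) := by
  simp [act_eq_toEuclideanCLM]

lemma neg_act (A : Matrix (Fin 3) (Fin 3) ℝ) (x : E) : act (-A) x = -act A x := by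
  ext i; simp [Matrix.neg_mulVec]

lemma act_add_left (A B : Matrix (Fin 3) (Fin 3) ℝ) (x : E) :
    act (A + B) x = act A x + act B x := by
  simp [act_eq_toEuclideanCLM]

lemma act_smul_left (c : ℝ) (A : Matrix (Fin 3) (Fin 3) ℝ) (x : E) :
    act (c • A) x = c • act A x := by
  simp [act_eq_toEuclideanCLM]

lemma act_ext {A B : Matrix (Fin 3) (Fin 3) ℝ} (h : ∀ x, act A x = act B x) : A = B := by
  apply (Matrix.toEuclideanCLM (n := Fin 3) (𝕜 := ℝ)).injective
  exact ContinuousLinearMap.ext fun x => by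
    have := h x
    rwa [act_eq_toEuclideanCLM, act_eq_toEuclideanCLM] at this

lemma continuous_act (A : Matrix (Fin 3) (Fin 3) ℝ) : Continuous (act A) := by
  have : act A = Matrix.toEuclideanCLM (𝕜 := ℝ) A := funext (act_eq_toEuclideanCLM A)
  rw [this]; fun_prop

lemma inner_eq_dotProduct (x y : E) : inner ℝ x y = x.ofLp ⬝ᵥ y.ofLp := by
  simp [PiLp.inner_apply, dotProduct, mul_comm]

lemma inner_act_left (A : Matrix (Fin 3) (Fin 3) ℝ) (x y : E) :
    inner ℝ (act A x) y = inner ℝ x (act Aᵀ y) := by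
  simp only [inner_eq_dotProduct, act]
  rw [Matrix.mulVec_transpose, dotProduct_comm, Matrix.dotProduct_mulVec, dotProduct_comm]

lemma transpose_mul_self (A : O 3) : A.1ᵀ * A.1 = 1 := by
  simpa [star_eq_conjTranspose] using (Matrix.mem_orthogonalGroup_iff' (Fin 3) ℝ).1 A.2

lemma mul_transpose_self (A : O 3) : A.1 * A.1ᵀ = 1 := by
  simpa [star_eq_conjTranspose] using (Matrix.mem_orthogonalGroup_iff (Fin 3) ℝ).1 A.2

lemma inner_act (A : O 3) (x y : E) : inner ℝ (act A.1 x) (act A.1 y) = inner ℝ x y := by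
  rw [inner_act_left, ← act_mul, transpose_mul_self, act_one]

lemma norm_act (A : O 3) (x : E) : ‖act A.1 x‖ = ‖x‖ := by
  rw [← sq_eq_sq₀ (norm_nonneg _) (norm_nonneg _), ← real_inner_self_eq_norm_sq,
    ← real_inner_self_eq_norm_sq, inner_act]

lemma act_inv_act (A : O 3) (x : E) : act (A⁻¹).1 (act A.1 x) = x := by
  rw [← act_mul]
  have : (A⁻¹).1 * A.1 = ((A⁻¹ * A : O 3)).1 := rfl
  rw [this, inv_mul_cancel]; simp

lemma act_coe_mul (A B : O 3) (x : E) : act (A * B : O 3).1 x = act A.1 (act B.1 x) :=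
  act_mul _ _ _

@[simp] lemma act_coe_one (x : E) : act (1 : O 3).1 x = x := act_one x

lemma O_ext {A B : O 3} (h : ∀ x, act A.1 x = act B.1 x) : A = B := Subtype.ext (act_ext h)

lemma det_mul_self (A : O 3) : A.1.det * A.1.det = 1 := by
  have := congrArg Matrix.det (mul_transpose_self A)
  simpa using this

lemma det_eq_one_or (A : O 3) : A.1.det = 1 ∨ A.1.det = -1 :=
  mul_self_eq_one_iff.1 (det_mul_self A)

/-- Every orthogonal map of space has an axis, on which it acts by its determinant. -/
lemma exists_axis (A : O 3) : ∃ u : E, ‖u‖ = 1 ∧ act A.1 u = A.1.det • u := by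
  -- `det (d A - 1) = det (d A) det (1 - (d A)ᵀ) = - det (d A - 1)` with `d = det A`
  have hd := det_mul_self A
  set d := A.1.det with hdd
  have h1 : (d • A.1 - 1) = (d • A.1) * (-(d • A.1 - 1)ᵀ) := by
    rw [Matrix.transpose_sub, Matrix.transpose_smul, neg_sub, mul_sub, Matrix.transpose_one,
      mul_one, Matrix.smul_mul, Matrix.mul_smul, mul_transpose_self, smul_smul, hd, one_smul]
  have h2 : (d • A.1 - 1).det = 0 := by
    have h3 := congrArg Matrix.det h1
    rw [Matrix.det_mul, Matrix.det_neg, Matrix.det_transpose, Matrix.det_smul, ← hdd] at h3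
    simp only [Fintype.card_fin] at h3
    have : d ^ 3 * d = 1 := by linear_combination (d * d + 1) * hd
    rw [this] at h3
    linarith
  obtain ⟨v, hv, hv0⟩ := Matrix.exists_mulVec_eq_zero_iff.2 h2
  set w : E := WithLp.toLp 2 v
  have hw : w ≠ 0 := by
    intro h; apply hv; simpa [w] using h
  have hAw : act A.1 w = d • w := by
    have : d • act A.1 w = w := by
      have h4 : act (d • A.1 - 1) w = 0 := by
        ext i; simp [w, act, hv0]
      rw [sub_eq_add_neg, act_add_left, act_smul_left, neg_act, act_one] at h4
      exact add_neg_eq_zero.1 h4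
    conv_rhs => rw [← this]
    rw [smul_smul, hd, one_smul]
  refine ⟨‖w‖⁻¹ • w,
    by rw [norm_smul, norm_inv, norm_norm, inv_mul_cancel₀ (norm_ne_zero_iff.2 hw)], ?_⟩
  rw [act_smul, hAw, smul_comm]

/-! ### Orthonormal frames -/

/-- The orthogonal matrix of the coordinates in an orthonormal basis. -/
noncomputable def frame (b : OrthonormalBasis (Fin 3) ℝ E) : O 3 :=
  ⟨Matrix.of fun i j => b i j, by
    rw [Matrix.mem_orthogonalGroup_iff]
    ext i j
    have := orthonormal_iff_ite.1 b.orthonormal i j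
    rw [inner_eq_dotProduct] at this
    simpa [Matrix.mul_apply, dotProduct, Matrix.one_apply] using this⟩

lemma act_frame (b : OrthonormalBasis (Fin 3) ℝ E) (x : E) (i : Fin 3) :
    act (frame b).1 x i = inner ℝ (b i) x := by
  rw [inner_eq_dotProduct]; rfl

lemma act_frame_basis (b : OrthonormalBasis (Fin 3) ℝ E) (j : Fin 3) :
    act (frame b).1 (b j) = EuclideanSpace.single j 1 := by
  ext i
  rw [act_frame, orthonormal_iff_ite.1 b.orthonormal i j]
  simp

lemma act_basis_ext {A B : Matrix (Fin 3) (Fin 3) ℝ} (b : OrthonormalBasis (Fin 3) ℝ E)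
    (h : ∀ i, act A (b i) = act B (b i)) : A = B := by
  refine act_ext fun x => ?_
  have := b.toBasis.ext (f₁ := (Matrix.toEuclideanCLM (𝕜 := ℝ) A).toLinearMap)
    (f₂ := (Matrix.toEuclideanCLM (𝕜 := ℝ) B).toLinearMap) (fun i => by
      simpa [← act_eq_toEuclideanCLM] using h i)
  simpa [← act_eq_toEuclideanCLM] using congrArg (fun f : E →ₗ[ℝ] E => f x) this

lemma frame_mul_of_eigen {A : Matrix (Fin 3) (Fin 3) ℝ} (b : OrthonormalBasis (Fin 3) ℝ E)
    {l : Fin 3 → ℝ} (h : ∀ i, act A (b i) = l i • b i) :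
    (frame b).1 * A = Matrix.diagonal l * (frame b).1 := by
  refine act_basis_ext b fun i => ?_
  rw [act_mul, h, act_smul, act_mul, act_frame_basis]
  ext j
  by_cases hij : j = i <;>
  simp [Matrix.mulVec_diagonal, hij]

lemma det_of_eigen {A : Matrix (Fin 3) (Fin 3) ℝ} (b : OrthonormalBasis (Fin 3) ℝ E)
    {l : Fin 3 → ℝ} (h : ∀ i, act A (b i) = l i • b i) : A.det = l 0 * l 1 * l 2 := by
  have h1 := congrArg Matrix.det (frame_mul_of_eigen b h)
  rw [Matrix.det_mul, Matrix.det_mul, Matrix.det_diagonal, Fin.prod_univ_three, mul_comm] at h1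
  have h2 := det_mul_self (frame b)
  exact mul_right_cancel₀ (fun h0 => by rw [h0] at h2; simp at h2) h1

lemma conj_frame_eq_signs {A : O 3} (b : OrthonormalBasis (Fin 3) ℝ E)
    {e : Fin 3 → ℤˣ} (h : ∀ i, act A.1 (b i) = ((e i : ℤ) : ℝ) • b i) :
    frame b * A * (frame b)⁻¹ = signs e := by
  rw [mul_inv_eq_iff_eq_mul]
  exact Subtype.ext (frame_mul_of_eigen b h)

lemma exists_basis_of_pair {u v : E} (hu : ‖u‖ = 1) (hv : ‖v‖ = 1) (huv : inner ℝ u v = 0) :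
    ∃ b : OrthonormalBasis (Fin 3) ℝ E, b 2 = u ∧ b 0 = v := by
  have ho : Orthonormal ℝ (({0, 2} : Set (Fin 3)).domRestrict ![v, 0, u]) := by
    rw [orthonormal_iff_ite]
    rintro ⟨i, hi⟩ ⟨j, hj⟩
    have hvu : inner ℝ v u = 0 := by rw [real_inner_comm, huv]
    simp only [Set.mem_insert_iff, Set.mem_singleton_iff] at hi hj
    rcases hi with rfl | rfl <;> rcases hj with rfl | rfl <;>
      simp [Set.domRestrict_apply, hu, hv, huv, hvu]
  obtain ⟨b, hb⟩ := ho.exists_orthonormalBasis_extension_of_card_eq (by simp)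
  exact ⟨b, by simpa using hb 2 (by simp), by simpa using hb 0 (by simp)⟩

lemma exists_basis_of_unit {u : E} (hu : ‖u‖ = 1) :
    ∃ b : OrthonormalBasis (Fin 3) ℝ E, b 2 = u := by
  have ho : Orthonormal ℝ (({2} : Set (Fin 3)).domRestrict ![0, 0, u]) := by
    rw [orthonormal_iff_ite]
    rintro ⟨i, hi⟩ ⟨j, hj⟩
    simp only [Set.mem_singleton_iff] at hi hj
    subst hi hj
    simp [Set.domRestrict_apply, hu]
  obtain ⟨b, hb⟩ := ho.exists_orthonormalBasis_extension_of_card_eq (by simp)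
  exact ⟨b, by simpa using hb 2 (by simp)⟩

lemma inner_basis (b : OrthonormalBasis (Fin 3) ℝ E) (i j : Fin 3) :
    inner ℝ (b i) (b j) = if i = j then (1 : ℝ) else 0 := orthonormal_iff_ite.1 b.orthonormal i j

/-- An orthogonal map with two eigenvectors in an orthonormal basis has a third one, and the
determinant gives its eigenvalue. -/
lemma act_third (A : O 3) (b : OrthonormalBasis (Fin 3) ℝ E) {s t : ℝ} (hs : s * s = 1)
    (ht : t * t = 1) (h2 : act A.1 (b 2) = s • b 2) (h0 : act A.1 (b 0) = t • b 0) :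
    act A.1 (b 1) = (s * t * A.1.det) • b 1 := by
  set l : ℝ := inner ℝ (b 1) (act A.1 (b 1))
  have key : act A.1 (b 1) = l • b 1 := by
    rw [← b.sum_repr' (act A.1 (b 1)), Fin.sum_univ_three]
    have e0 : inner ℝ (b 0) (act A.1 (b 1)) = 0 := by
      have : b 0 = t • act A.1 (b 0) := by rw [h0, smul_smul, ht, one_smul]
      rw [this, inner_smul_left, inner_act, inner_basis]; simp
    have e2 : inner ℝ (b 2) (act A.1 (b 1)) = 0 := by
      have : b 2 = s • act A.1 (b 2) := by rw [h2, smul_smul, hs, one_smul]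
      rw [this, inner_smul_left, inner_act, inner_basis]; simp
    simp [e0, e2, l]
  have hdet : A.1.det = t * l * s := by
    have := det_of_eigen (A := A.1) (l := ![t, l, s]) b (by
      intro i; fin_cases i
      · exact h0
      · exact key
      · exact h2)
    simpa using this
  rw [key, hdet]
  congr 1
  linear_combination (- l * s * s) * ht - l * hs

/-- An involution of determinant `1` is the identity or a half turn. -/
lemma eq_one_or_isHalfTurn (R : O 3) (hd : R.1.det = 1) (h2 : R * R = 1) :
    R = 1 ∨ IsHalfTurn R := by
  by_cases h : R = 1
  · exact Or.inl h
  right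
  have : ∃ v, act R.1 v ≠ v := by
    by_contra hc
    push Not at hc
    exact h (O_ext fun x => by rw [hc, act_coe_one])
  obtain ⟨v, hv⟩ := this
  set w := v - act R.1 v
  have hw0 : w ≠ 0 := sub_ne_zero.2 (Ne.symm hv)
  have hw : act R.1 w = -w := by
    simp only [w]
    rw [act_sub, ← act_coe_mul, h2, act_coe_one]; abel
  obtain ⟨u, hu, hRu⟩ := exists_axis R
  rw [hd, one_smul] at hRu
  have huw : inner ℝ u w = 0 := by
    have := inner_act R u w
    rw [hRu, hw, inner_neg_right] at this
    linarith
  obtain ⟨b, hb2, hb0⟩ := exists_basis_of_pair (v := ‖w‖⁻¹ • w) hu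
    (by rw [norm_smul, norm_inv, norm_norm, inv_mul_cancel₀ (norm_ne_zero_iff.2 hw0)])
    (by rw [inner_smul_right, huw, mul_zero])
  have e2 : act R.1 (b 2) = (1 : ℝ) • b 2 := by rw [hb2, hRu, one_smul]
  have e0 : act R.1 (b 0) = (-1 : ℝ) • b 0 := by
    rw [hb0, act_smul, hw, smul_neg, neg_one_smul]
  have e1 := act_third R b (by norm_num) (by norm_num) e2 e0
  rw [hd] at e1
  refine ⟨u, hu, fun x => ?_⟩
  conv_lhs => rw [← b.sum_repr' x, Fin.sum_univ_three]
  conv_rhs => rw [← b.sum_repr' x, Fin.sum_univ_three]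
  rw [act_add, act_add, act_smul, act_smul, act_smul, e0, e1, e2, ← hb2]
  simp only [inner_add_right, inner_smul_right, inner_basis]
  simp
  module

/-- Two triples of vectors with the same Gram matrix differ by an orthogonal map. -/
lemma exists_act_eq_of_inner_eq {p q : Fin 3 → E}
    (h : ∀ i j, inner ℝ (p i) (p j) = inner ℝ (q i) (q j)) :
    ∃ R : O 3, ∀ i, p i = act R.1 (q i) := by
  classical
  let P : (Fin 3 → ℝ) →ₗ[ℝ] E := Fintype.linearCombination ℝ p
  let Q : (Fin 3 → ℝ) →ₗ[ℝ] E := Fintype.linearCombination ℝ q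
  have hPQ : ∀ c, ‖P c‖ = ‖Q c‖ := by
    intro c
    rw [← sq_eq_sq₀ (norm_nonneg _) (norm_nonneg _), ← real_inner_self_eq_norm_sq,
      ← real_inner_self_eq_norm_sq]
    simp only [P, Q, Fintype.linearCombination_apply, sum_inner, inner_sum, inner_smul_left,
      inner_smul_right, h]
  obtain ⟨g, hg⟩ := Q.rangeRestrict.exists_rightInverse_of_surjective Q.range_rangeRestrict
  have hQg : ∀ v : LinearMap.range Q, Q (g v) = v := fun v =>
    congrArg Subtype.val (congrArg (fun f => f v) hg)
  -- the map `q i ↦ p i` is a well-defined isometry on the span of `q`, and extends to space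
  let L : LinearMap.range Q →ₗᵢ[ℝ] E :=
    { toLinearMap := P ∘ₗ g
      norm_map' := fun v => by
        change ‖P (g v)‖ = ‖(v : E)‖
        rw [hPQ, hQg] }
  have hL : ∀ i (hi : q i ∈ LinearMap.range Q), L ⟨q i, hi⟩ = p i := by
    intro i hi
    change P (g ⟨q i, hi⟩) = p i
    have hp : P (Pi.single i 1) = p i := by simp [P]
    have hq : Q (Pi.single i 1) = q i := by simp [Q]
    rw [← hp, ← sub_eq_zero, ← map_sub, ← norm_eq_zero, hPQ, map_sub, hQg, hq]
    simp
  let T := L.extend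
  let M : Matrix (Fin 3) (Fin 3) ℝ := (Matrix.toEuclideanCLM (n := Fin 3) (𝕜 := ℝ)).symm
    T.toContinuousLinearMap
  have hM : ∀ x, act M x = T x := by
    intro x; rw [act_eq_toEuclideanCLM]; simp [M]
  have hMO : M ∈ Matrix.orthogonalGroup (Fin 3) ℝ := by
    rw [Matrix.mem_orthogonalGroup_iff']
    refine act_ext fun x => ?_
    refine ext_inner_right ℝ fun y => ?_
    rw [act_one, act_mul,
      inner_act_left, Matrix.transpose_transpose, hM, hM, T.inner_map_map]
  refine ⟨⟨M, hMO⟩, fun i => ?_⟩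
  have hi : q i ∈ LinearMap.range Q := ⟨Pi.single i 1, by simp [Q]⟩
  rw [← hL i hi]
  change _ = act M (q i)
  rw [hM]
  exact (L.extend_apply ⟨q i, hi⟩).symm

/-! ### Rotations around an axis -/

lemma Omega_smul (c : ℝ) (w : E) : Omega (c • w) = c • Omega w := by
  ext i j; fin_cases i <;> fin_cases j <;> simp [Omega]

lemma Omega_transpose (w : E) : (Omega w)ᵀ = -Omega w := by
  ext i j; fin_cases i <;> fin_cases j <;> simp [Omega]

@[simp] lemma Omega_zero : Omega 0 = 0 := by
  ext i j; fin_cases i <;> fin_cases j <;> simp [Omega]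

@[simp] lemma act_Omega_self (w : E) : act (Omega w) w = 0 := by
  ext i; fin_cases i <;> simp [Omega, Matrix.mulVec, dotProduct, Fin.sum_univ_three] <;> ring

/-- The identity `Mᵀ [M w] M = det M [w]`, where `[w]` is the matrix of the vector product by `w`,
up to sign: this is the reason for the factor `det ρ` in the notion of rotation vector. -/
lemma transpose_mul_Omega_mul (M : Matrix (Fin 3) (Fin 3) ℝ) (w : E) :
    Mᵀ * Omega (act M w) * M = M.det • Omega w := by
  ext i j; fin_cases i <;> fin_cases j <;>
    simp [Omega, Matrix.mulVec, dotProduct, Fin.sum_univ_three, Matrix.mul_apply,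
      Matrix.det_fin_three] <;> ring

lemma mul_Omega (A : O 3) (w : E) :
    A.1 * Omega w = A.1.det • (Omega (act A.1 w) * A.1) := by
  have h := congrArg (fun X => A.1.det • (A.1 * X)) (transpose_mul_Omega_mul A.1 w)
  simp only [← mul_assoc, mul_transpose_self, one_mul, Matrix.mul_smul, smul_smul, det_mul_self,
    one_smul] at h
  exact h.symm

lemma commute_Omega {A : O 3} {w : E} (h : act A.1 w = A.1.det • w) : Commute A.1 (Omega w) := by
  change _ * _ = _ * _
  rw [mul_Omega, h, Omega_smul, Matrix.smul_mul, smul_smul, det_mul_self, one_smul]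

lemma anticommute_Omega {B : O 3} {w : E} (h : act B.1 w = (-B.1.det) • w) :
    B.1 * Omega w = -Omega w * B.1 := by
  rw [mul_Omega, h, Omega_smul, Matrix.smul_mul, smul_smul, neg_mul, mul_neg, det_mul_self,
    neg_one_smul]

/-- The rotation `exp (b Ω)` around the vector `w`. -/
noncomputable def expO (w : E) (b : ℝ) : O 3 :=
  ⟨NormedSpace.exp (b • Omega w), by
    rw [Matrix.mem_orthogonalGroup_iff]
    change _ * (NormedSpace.exp (b • Omega w))ᵀ = 1
    rw [← Matrix.exp_transpose, Matrix.transpose_smul, Omega_transpose, smul_neg,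
      ← Matrix.exp_add_of_commute _ _ (Commute.refl (b • Omega w)).neg_right, add_neg_cancel,
      NormedSpace.exp_zero]⟩

lemma expO_add (w : E) (a b : ℝ) : expO w (a + b) = expO w a * expO w b := by
  apply Subtype.ext
  change NormedSpace.exp ((a + b) • Omega w) =
    NormedSpace.exp (a • Omega w) * NormedSpace.exp (b • Omega w)
  rw [add_smul, Matrix.exp_add_of_commute]
  exact ((Commute.refl _).smul_left _).smul_right _

lemma expO_zero (w : E) : expO w 0 = 1 := by
  apply Subtype.ext
  change NormedSpace.exp ((0 : ℝ) • Omega w) = 1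
  rw [zero_smul, NormedSpace.exp_zero]

lemma expO_neg (w : E) (a : ℝ) : expO w (-a) = (expO w a)⁻¹ := by
  rw [eq_inv_iff_mul_eq_one, ← expO_add, neg_add_cancel, expO_zero]

lemma expO_smul (w : E) (c b : ℝ) : expO (c • w) b = expO w (b * c) := by
  apply Subtype.ext
  change NormedSpace.exp _ = NormedSpace.exp _
  rw [Omega_smul, smul_smul]

lemma det_expO (w : E) (b : ℝ) : (expO w b).1.det = 1 := by
  -- a rotation is the square of an orthogonal map
  have : (expO w b).1 = (expO w (b / 2)).1 * (expO w (b / 2)).1 := by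
    rw [← add_halves b, expO_add, add_halves]; rfl
  rw [this, Matrix.det_mul, det_mul_self]

lemma expO_zsmul (w : E) (b : ℝ) (k : ℤ) : expO w (k * b) = expO w b ^ k := by
  induction k using Int.induction_on with
  | zero => simp [expO_zero]
  | succ n ih => push_cast at ih ⊢; rw [add_mul, one_mul, expO_add, ih, _root_.zpow_add_one]
  | pred n ih => push_cast at ih ⊢; rw [sub_mul, one_mul, sub_eq_add_neg, expO_add, ih, expO_neg,
      _root_.zpow_sub_one]

lemma commute_expO {A : O 3} {w : E} (h : act A.1 w = A.1.det • w) (b : ℝ) :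
    Commute A (expO w b) := by
  have hc : Commute A.1 (b • Omega w) := (commute_Omega h).smul_right b
  let _ := Matrix.linftyOpNormedRing (n := Fin 3) (α := ℝ)
  let _ := Matrix.linftyOpNormedAlgebra (n := Fin 3) (R := ℝ) (α := ℝ)
  have h2 : Commute A.1 (NormedSpace.exp (b • Omega w)) := hc.exp_right
  exact Subtype.ext h2

lemma mul_expO {B : O 3} {w : E} (h : act B.1 w = (-B.1.det) • w) (b : ℝ) :
    B * expO w b = expO w (-b) * B := by
  have h1 := anticommute_Omega h
  have hu : IsUnit B.1 := IsUnit.of_mul_eq_one _ (mul_transpose_self B)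
  have h2 := Matrix.exp_conj B.1 (b • Omega w) hu
  have hB : B.1⁻¹ = B.1ᵀ := Matrix.inv_eq_right_inv (mul_transpose_self B)
  have h3 : B.1 * (b • Omega w) * B.1⁻¹ = (-b) • Omega w := by
    rw [Matrix.mul_smul, h1, hB, neg_mul, smul_neg, neg_mul, Matrix.smul_mul, mul_assoc,
      mul_transpose_self, mul_one, neg_smul]
  rw [h3] at h2
  apply Subtype.ext
  change B.1 * NormedSpace.exp (b • Omega w) = NormedSpace.exp ((-b) • Omega w) * B.1
  rw [h2, hB, mul_assoc, transpose_mul_self, mul_one]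

lemma act_Omega_act_Omega (u w : E) :
    act (Omega u) (act (Omega u) w) = (inner ℝ u w : ℝ) • u - (‖u‖ ^ 2) • w := by
  rw [EuclideanSpace.norm_sq_eq, Fin.sum_univ_three, inner_eq_dotProduct]
  ext i; fin_cases i <;>
    simp [Omega, Matrix.mulVec, dotProduct, Fin.sum_univ_three] <;> ring

/-- Rodrigues' formula. -/
lemma exp_smul_Omega {u : E} (hu : ‖u‖ = 1) (t : ℝ) :
    NormedSpace.exp (t • Omega u) =
      1 + Real.sin t • Omega u + (1 - Real.cos t) • (Omega u * Omega u) := by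
  -- both sides solve `F' = Ω F`, `F 0 = 1`, because `Ω³ = -Ω`
  have h3 : Omega u * (Omega u * Omega u) = -Omega u := by
    refine act_ext fun x => ?_
    have h0 : (inner ℝ u (act (Omega u) x) : ℝ) = 0 := by
      rw [real_inner_comm, inner_act_left, Omega_transpose, neg_act, act_Omega_self]; simp
    rw [act_mul, act_mul, act_Omega_act_Omega, h0, hu, neg_act]
    simp
  set W := Omega u with hW
  let _ := Matrix.linftyOpNormedRing (n := Fin 3) (α := ℝ)
  let _ := Matrix.linftyOpNormedAlgebra (n := Fin 3) (R := ℝ) (α := ℝ)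
  let F : ℝ → Matrix (Fin 3) (Fin 3) ℝ := fun t => 1 + Real.sin t • W + (1 - Real.cos t) • (W * W)
  have hF : ∀ t, HasDerivAt F (W * F t) t := by
    intro t
    have := ((hasDerivAt_const t (1 : Matrix (Fin 3) (Fin 3) ℝ)).add
      ((Real.hasDerivAt_sin t).smul_const W)).add
      (((hasDerivAt_const t (1 : ℝ)).sub (Real.hasDerivAt_cos t)).smul_const (W * W))
    refine this.congr_deriv ?_
    simp only [F, mul_add, Matrix.mul_smul, h3, mul_one]
    module
  let G : ℝ → Matrix (Fin 3) (Fin 3) ℝ := fun t => NormedSpace.exp (t • (-W)) * F t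
  have hG : ∀ t, HasDerivAt G 0 t := by
    intro t
    have := (hasDerivAt_exp_smul_const (-W) t).mul (hF t)
    refine this.congr_deriv ?_
    rw [mul_neg, neg_mul, mul_assoc]; simp
  have hconst : G t = G 0 :=
    is_const_of_deriv_eq_zero (fun s => (hG s).differentiableAt) (fun s => (hG s).deriv) t 0
  have hG0 : G 0 = 1 := by simp [G, F]
  have h5 : NormedSpace.exp (t • W) * G t = F t := by
    simp only [G, ← mul_assoc]
    rw [smul_neg, ← Matrix.exp_add_of_commute _ _ (Commute.refl (t • W)).neg_right,
      add_neg_cancel, NormedSpace.exp_zero, one_mul]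
  rw [hconst, hG0, mul_one] at h5
  exact h5

lemma act_expO_self (w : E) (b : ℝ) : act (expO w b).1 w = w := by
  by_cases hw : w = 0
  · simp [hw]
  have hn : ‖w‖ ≠ 0 := norm_ne_zero_iff.2 hw
  have hu : ‖‖w‖⁻¹ • w‖ = 1 := by rw [norm_smul, norm_inv, norm_norm, inv_mul_cancel₀ hn]
  have h1 : expO w b = expO (‖w‖⁻¹ • w) (b * ‖w‖) := by
    rw [expO_smul, mul_assoc, mul_inv_cancel₀ hn, mul_one]
  have h2 : act (Omega (‖w‖⁻¹ • w)) w = 0 := by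
    rw [Omega_smul, act_smul_left, act_Omega_self, smul_zero]
  rw [h1]
  change act (NormedSpace.exp _) w = w
  rw [exp_smul_Omega hu, act_add_left, act_add_left, act_smul_left, act_smul_left, act_mul, h2]
  simp

/-- A unit vector orthogonal to `u` is carried to any other by a rotation around `u`. -/
lemma exists_act_expO_eq {u v w : E} (hu : ‖u‖ = 1) (hv : ‖v‖ = 1) (hw : ‖w‖ = 1)
    (huv : inner ℝ u v = 0) (huw : inner ℝ u w = 0) : ∃ t, act (expO u t).1 w = v := by
  have hu2 : u 0 ^ 2 + u 1 ^ 2 + u 2 ^ 2 = 1 := by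
    have := EuclideanSpace.norm_sq_eq u
    rw [hu, Fin.sum_univ_three] at this
    simpa using this.symm
  have hw2 : w 0 ^ 2 + w 1 ^ 2 + w 2 ^ 2 = 1 := by
    have := EuclideanSpace.norm_sq_eq w
    rw [hw, Fin.sum_univ_three] at this
    simpa using this.symm
  have huw' : u 0 * w 0 + u 1 * w 1 + u 2 * w 2 = 0 := by
    simpa [inner_eq_dotProduct, dotProduct, Fin.sum_univ_three] using huw
  -- `w` and `z` form an orthonormal basis of the plane orthogonal to `u`, where `v` is
  -- `(cos t) w + (sin t) z` for some `t`
  set z := act (Omega u) w with hz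
  have z0 : z 0 = u 2 * w 1 - u 1 * w 2 := by
    simp [hz, Omega, Matrix.mulVec, dotProduct, Fin.sum_univ_three]; ring
  have z1 : z 1 = u 0 * w 2 - u 2 * w 0 := by
    simp [hz, Omega, Matrix.mulVec, dotProduct, Fin.sum_univ_three]; ring
  have z2 : z 2 = u 1 * w 0 - u 0 * w 1 := by
    simp [hz, Omega, Matrix.mulVec, dotProduct, Fin.sum_univ_three]; ring
  have hzz : act (Omega u) z = -w := by
    rw [hz, act_Omega_act_Omega, huw, hu]; simp
  have huz : inner ℝ u z = 0 := by
    simp [inner_eq_dotProduct, dotProduct, Fin.sum_univ_three, z0, z1, z2]; ring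
  have hwz : inner ℝ w z = 0 := by
    simp [inner_eq_dotProduct, dotProduct, Fin.sum_univ_three, z0, z1, z2]; ring
  have hz1 : ‖z‖ = 1 := by
    have : ‖z‖ ^ 2 = 1 := by
      rw [EuclideanSpace.norm_sq_eq, Fin.sum_univ_three]
      simp only [Real.norm_eq_abs, sq_abs, z0, z1, z2]
      linear_combination hu2 * (w 0 ^ 2 + w 1 ^ 2 + w 2 ^ 2) + hw2 -
        (u 0 * w 0 + u 1 * w 1 + u 2 * w 2) * huw'
    nlinarith [norm_nonneg z]
  obtain ⟨b, hb2, hb0⟩ := exists_basis_of_pair hu hw huw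
  have hz1b : z = inner ℝ (b 1) z • b 1 := by
    conv_lhs => rw [← b.sum_repr' z, Fin.sum_univ_three, hb0, hb2, huz, hwz]
    simp
  have hc : (inner ℝ (b 1) z : ℝ) * inner ℝ (b 1) z = 1 := by
    have := real_inner_self_eq_norm_sq z
    rw [hz1] at this
    conv_lhs at this => rw [hz1b]
    rw [inner_smul_left, inner_smul_right, inner_basis] at this
    simpa using this
  have hv' : v = (inner ℝ w v : ℝ) • w + (inner ℝ z v : ℝ) • z := by
    conv_lhs => rw [← b.sum_repr' v, Fin.sum_univ_three, hb0, hb2, huv]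
    rw [hz1b, inner_smul_left, smul_smul]
    simp only [RCLike.conj_to_real]
    rw [mul_right_comm, hc]
    simp
  set c : ℝ := inner ℝ w v
  set d : ℝ := inner ℝ z v
  have hcd : c ^ 2 + d ^ 2 = 1 := by
    have := real_inner_self_eq_norm_sq v
    rw [hv] at this
    have hw' : (inner ℝ w w : ℝ) = 1 := by rw [real_inner_self_eq_norm_sq, hw]; norm_num
    have hz' : (inner ℝ z z : ℝ) = 1 := by rw [real_inner_self_eq_norm_sq, hz1]; norm_num
    have hzw : (inner ℝ z w : ℝ) = 0 := by rw [real_inner_comm, hwz]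
    conv_lhs at this => rw [hv']
    simp only [inner_add_left, inner_add_right, inner_smul_left, inner_smul_right, hw', hz', hwz,
      hzw, RCLike.conj_to_real] at this
    linear_combination this
  have hn : ‖(⟨c, d⟩ : ℂ)‖ = 1 := by
    rw [Complex.norm_def, Complex.normSq_mk, Real.sqrt_eq_one]; linarith
  have h0 : (⟨c, d⟩ : ℂ) ≠ 0 := by
    rw [← norm_ne_zero_iff, hn]; exact one_ne_zero
  refine ⟨Complex.arg ⟨c, d⟩, ?_⟩
  change act (NormedSpace.exp _) w = v
  rw [exp_smul_Omega hu, act_add_left, act_add_left, act_smul_left, act_smul_left, act_mul,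
    Complex.cos_arg h0, Complex.sin_arg, ← hz, hzz, hn, act_one]
  conv_rhs => rw [hv']
  simp only [div_one]
  module

/-- An orthogonal map is reduced to the identity on the plane orthogonal to its axis by a rotation
around this axis. -/
lemma exists_expO_mul_eq {A : O 3} {u : E} (hu : ‖u‖ = 1) (hA : act A.1 u = A.1.det • u) :
    ∃ t, ∀ x, inner ℝ u x = 0 → act (expO u t * A).1 x = x := by
  obtain ⟨b₀, hb₀⟩ := exists_basis_of_unit hu
  set v := b₀ 0
  have huv : inner ℝ u v = 0 := by rw [← hb₀, inner_basis]; simp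
  have hv : ‖v‖ = 1 := b₀.norm_eq_one 0
  have hd := det_mul_self A
  have huw : inner ℝ u (act A.1 v) = 0 := by
    have : u = A.1.det • act A.1 u := by rw [hA, smul_smul, hd, one_smul]
    rw [this, inner_smul_left, inner_act, huv, mul_zero]
  obtain ⟨t, ht⟩ := exists_act_expO_eq hu hv ((norm_act A v).trans hv) huv huw
  obtain ⟨b, hb2, hb0⟩ := exists_basis_of_pair hu hv huv
  have e2 : act (expO u t * A).1 (b 2) = A.1.det • b 2 := by
    rw [act_coe_mul, hb2, hA, act_smul, act_expO_self]
  have e0 : act (expO u t * A).1 (b 0) = (1 : ℝ) • b 0 := by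
    rw [act_coe_mul, hb0, ht, one_smul]
  have e1 := act_third _ b hd (by norm_num) e2 e0
  have hdet : (expO u t * A).1.det = A.1.det := by
    change ((expO u t).1 * A.1).det = _
    rw [Matrix.det_mul, det_expO, one_mul]
  rw [hdet, mul_one, hd, one_smul] at e1
  refine ⟨t, fun x hx => ?_⟩
  rw [← b.sum_repr' x, Fin.sum_univ_three, hb2, hx, zero_smul, add_zero, act_add, act_smul,
    act_smul, e1, e0, one_smul]

/-- An involution `B` with an eigenvector `u` of eigenvalue `-det B` is a reflection of the plane
orthogonal to `u`. -/
lemma exists_basis_of_reflection {B : O 3} {u : E} (hu : ‖u‖ = 1) (hB : B * B = 1)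
    (hBu : act B.1 u = (-B.1.det) • u) :
    ∃ b : OrthonormalBasis (Fin 3) ℝ E, b 2 = u ∧ act B.1 (b 0) = b 0 ∧ act B.1 (b 1) = -b 1 := by
  have hBB : ∀ x, act B.1 (act B.1 x) = x := fun x => by rw [← act_coe_mul, hB, act_coe_one]
  have hd := det_mul_self B
  have main : ∀ v : E, ‖v‖ = 1 → inner ℝ u v = 0 → act B.1 v = v →
      ∃ b : OrthonormalBasis (Fin 3) ℝ E, b 2 = u ∧ act B.1 (b 0) = b 0 ∧
        act B.1 (b 1) = -b 1 := by
    intro v hv huv hBv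
    obtain ⟨b, hb2, hb0⟩ := exists_basis_of_pair hu hv huv
    refine ⟨b, hb2, by rw [hb0, hBv], ?_⟩
    rw [act_third B b (s := -B.1.det) (t := 1) (by linarith) (by norm_num) (by rw [hb2, hBu])
      (by rw [hb0, hBv, one_smul])]
    rw [mul_one, neg_mul, hd, neg_one_smul]
  obtain ⟨b, hb2⟩ := exists_basis_of_unit hu
  have hub : ∀ i : Fin 3, i ≠ 2 → inner ℝ u (b i) = 0 := by
    intro i hi; rw [← hb2, inner_basis, if_neg (Ne.symm hi)]
  by_cases h : b 0 + act B.1 (b 0) = 0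
  · have h0 : act B.1 (b 0) = (-1 : ℝ) • b 0 := by
      rw [neg_one_smul]; exact (neg_eq_of_add_eq_zero_right h).symm
    have h1 := act_third B b (s := -B.1.det) (t := -1) (by linarith) (by norm_num)
      (by rw [hb2, hBu]) h0
    rw [mul_neg_one, neg_neg, hd, one_smul] at h1
    exact main (b 1) (b.norm_eq_one 1) (hub 1 (by decide)) h1
  · set y := b 0 + act B.1 (b 0)
    have hy : act B.1 y = y := by simp only [y]; rw [act_add, hBB, add_comm]
    have huy : inner ℝ u y = 0 := by
      have : u = (-B.1.det) • act B.1 u := by rw [hBu, smul_smul, neg_mul_neg, hd, one_smul]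
      simp only [y]
      rw [inner_add_right, hub 0 (by decide)]
      conv_lhs => rw [this]
      rw [inner_smul_left, inner_act, hub 0 (by decide)]; simp
    refine main (‖y‖⁻¹ • y) ?_ ?_ ?_
    · rw [norm_smul, norm_inv, norm_norm, inv_mul_cancel₀ (norm_ne_zero_iff.2 h)]
    · rw [inner_smul_right, huy, mul_zero]
    · rw [act_smul, hy]

/-! ### Motions of the time circle -/

lemma timeMotion_val (e : ℤˣ) (b : ℝ) : (timeMotion e b).1 =
    !![Real.cos b, -Real.sin b * ((e : ℤ) : ℝ); Real.sin b, Real.cos b * ((e : ℤ) : ℝ)] := by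
  change (rot b).1 * (signs ![1, e]).1 = _
  ext i j; fin_cases i <;> fin_cases j <;> simp [rot, signs, Matrix.mul_apply]

lemma units_cases (e : ℤˣ) : e = 1 ∨ e = -1 := Int.units_eq_one_or e

lemma timeMotion_mul (e e' : ℤˣ) (b b' : ℝ) :
    timeMotion e b * timeMotion e' b' = timeMotion (e * e') (b + ((e : ℤ) : ℝ) * b') := by
  apply Subtype.ext
  change (timeMotion e b).1 * (timeMotion e' b').1 = _
  simp only [timeMotion_val]
  rcases units_cases e with rfl | rfl <;> rcases units_cases e' with rfl | rfl <;>
    ext i j <;> fin_cases i <;> fin_cases j <;>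
    simp [Matrix.mul_apply, Real.cos_add, Real.sin_add] <;> ring

lemma timeMotion_one_zero : timeMotion 1 0 = 1 := by
  apply Subtype.ext
  rw [timeMotion_val]
  ext i j; fin_cases i <;> fin_cases j <;> simp

lemma timeMotion_inv (e : ℤˣ) (b : ℝ) :
    (timeMotion e b)⁻¹ = timeMotion e (-((e : ℤ) : ℝ) * b) := by
  rw [inv_eq_iff_mul_eq_one, timeMotion_mul, ← timeMotion_one_zero]
  rcases units_cases e with rfl | rfl <;> simp

lemma det_timeMotion (e : ℤˣ) (b : ℝ) : (timeMotion e b).1.det = ((e : ℤ) : ℝ) := by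
  rw [timeMotion_val, Matrix.det_fin_two]
  simp
  linear_combination ((e : ℤ) : ℝ) * Real.sin_sq_add_cos_sq b

lemma timeMotion_eq_iff {e e' : ℤˣ} {b b' : ℝ} :
    timeMotion e b = timeMotion e' b' ↔ e = e' ∧ ∃ k : ℤ, b = b' + 2 * Real.pi * k := by
  constructor
  · intro h
    have he : e = e' := by
      have := congrArg (fun M : O 2 => M.1.det) h
      simp only [det_timeMotion] at this
      exact Units.ext (by exact_mod_cast this)
    refine ⟨he, ?_⟩
    have h1 := congrArg (fun M : O 2 => M.1) h
    simp only [timeMotion_val] at h1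
    have hc : Real.cos b = Real.cos b' := by simpa using congrFun (congrFun h1 0) 0
    have hs : Real.sin b = Real.sin b' := by simpa using congrFun (congrFun h1 1) 0
    obtain ⟨k, hk⟩ := Real.Angle.angle_eq_iff_two_pi_dvd_sub.1 (Real.Angle.cos_sin_inj hc hs)
    exact ⟨k, by linarith⟩
  · rintro ⟨rfl, k, rfl⟩
    apply Subtype.ext
    rw [timeMotion_val, timeMotion_val]
    have h1 : Real.cos (b' + 2 * Real.pi * k) = Real.cos b' := by
      rw [mul_comm, Real.cos_add_int_mul_two_pi]
    have h2 : Real.sin (b' + 2 * Real.pi * k) = Real.sin b' := by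
      rw [mul_comm, Real.sin_add_int_mul_two_pi]
    rw [h1, h2]

lemma exists_timeMotion (M : O 2) : ∃ e b, M = timeMotion e b := by
  have h : M.1 * M.1ᵀ = 1 := (Matrix.mem_orthogonalGroup_iff (Fin 2) ℝ).1 M.2
  have h' : M.1ᵀ * M.1 = 1 := (Matrix.mem_orthogonalGroup_iff' (Fin 2) ℝ).1 M.2
  have hcol : M.1 0 0 ^ 2 + M.1 1 0 ^ 2 = 1 := by
    have := congrFun (congrFun h' 0) 0
    simp [Matrix.mul_apply] at this
    linarith
  have hcol2 : M.1 0 1 ^ 2 + M.1 1 1 ^ 2 = 1 := by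
    have := congrFun (congrFun h' 1) 1
    simp [Matrix.mul_apply] at this
    linarith
  have horth : M.1 0 0 * M.1 0 1 + M.1 1 0 * M.1 1 1 = 0 := by
    have := congrFun (congrFun h' 0) 1
    simp [Matrix.mul_apply] at this
    linarith
  set p := M.1 0 0
  set q := M.1 1 0
  set r := M.1 0 1 with hr
  set s := M.1 1 1 with hs
  have hn : ‖(⟨p, q⟩ : ℂ)‖ = 1 := by
    rw [Complex.norm_def, Complex.normSq_mk, Real.sqrt_eq_one]; linarith
  have h0 : (⟨p, q⟩ : ℂ) ≠ 0 := by
    rw [← norm_ne_zero_iff, hn]; exact one_ne_zero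
  have hcos := Complex.cos_arg h0
  have hsin := Complex.sin_arg (⟨p, q⟩ : ℂ)
  rw [hn, div_one] at hcos hsin
  simp only at hcos hsin
  have hdet : (p * s - q * r) ^ 2 = 1 := by
    linear_combination (r ^ 2 + s ^ 2) * hcol + hcol2 - (p * r + q * s) * horth
  -- the second column is `d (-q, p)` with `d` the determinant
  have er : r = -q * (p * s - q * r) := by linear_combination p * horth - r * hcol
  have es : s = p * (p * s - q * r) := by linear_combination q * horth - s * hcol
  rcases sq_eq_one_iff.1 hdet with hd | hd
  · refine ⟨1, Complex.arg ⟨p, q⟩, Subtype.ext ?_⟩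
    rw [timeMotion_val, hcos, hsin]
    rw [hd] at er es
    ext i j; fin_cases i <;> fin_cases j
    · rfl
    · simpa [hr] using er
    · rfl
    · simpa [hs] using es
  · refine ⟨-1, Complex.arg ⟨p, q⟩, Subtype.ext ?_⟩
    rw [timeMotion_val, hcos, hsin]
    rw [hd] at er es
    ext i j; fin_cases i <;> fin_cases j
    · rfl
    · simpa [hr] using er
    · rfl
    · simpa [hs] using es

lemma timeMotion_mulVec_clock (e : ℤˣ) (b t : ℝ) :
    (timeMotion e b).1 *ᵥ clock t = clock (((e : ℤ) : ℝ) * t + b) := by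
  rw [timeMotion_val]
  rcases units_cases e with rfl | rfl <;>
    ext i <;> fin_cases i <;>
    simp [clock, Matrix.mulVec, dotProduct, Real.cos_add, Real.sin_add] <;> ring

/-! ### Loops -/

variable {m : Fin 3 → ℝ}

lemma Loop.integrableOn_vel (x : Loop m) (i : Fin 3) :
    IntegrableOn (fun t => x.vel t i) (Set.Ioc 0 (2 * Real.pi)) :=
  (x.vel_memLp i).integrable (by norm_num)

lemma Loop.continuousOn_pos (x : Loop m) (i : Fin 3) :
    ContinuousOn (fun t => x.pos t i) (Set.Icc 0 (2 * Real.pi)) := by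
  have h : ContinuousOn (fun t => ∫ s in (0 : ℝ)..t, x.vel s i) (Set.Icc 0 (2 * Real.pi)) := by
    have := intervalIntegral.continuousOn_primitive_interval (μ := volume)
      (f := fun s => x.vel s i) (a := 0) (b := 2 * Real.pi)
      (by rw [Set.uIcc_of_le Real.two_pi_pos.le]
          exact (integrableOn_Icc_iff_integrableOn_Ioc (by simp)).2 (x.integrableOn_vel i))
    rwa [Set.uIcc_of_le Real.two_pi_pos.le] at this
  exact (continuousOn_const.add h).congr fun t ht => x.pos_eq t ht i

lemma Loop.periodic_pos (x : Loop m) (i : Fin 3) :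
    Function.Periodic (fun t => x.pos t i) (2 * Real.pi) :=
  fun t => congrFun (x.periodic t) i

lemma Loop.continuous_pos (x : Loop m) (i : Fin 3) : Continuous fun t => x.pos t i := by
  have : Fact (0 < 2 * Real.pi) := ⟨Real.two_pi_pos⟩
  have hp := x.periodic_pos i
  have h1 : Continuous (AddCircle.liftIco (2 * Real.pi) 0 fun t => x.pos t i) :=
    AddCircle.liftIco_continuous (by simpa using (hp 0).symm)
      (by simpa using x.continuousOn_pos i)
  have h2 : (fun t => x.pos t i) =
      fun t : ℝ => AddCircle.liftIco (2 * Real.pi) 0 (fun t => x.pos t i) t := by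
    funext t
    have hper : ((toIcoMod Real.two_pi_pos 0 t : ℝ) : AddCircle (2 * Real.pi)) = t := by
      rw [toIcoMod, AddCircle.coe_sub, AddCircle.coe_zsmul, AddCircle.coe_period]; simp
    rw [← hper, AddCircle.liftIco_coe_apply (toIcoMod_mem_Ico _ _ _)]
    exact (hp.sub_zsmul_eq _).symm
  rw [h2]
  exact h1.comp (AddCircle.continuous_mk' _)

/-- The equivariance of a loop, on the time line. -/
lemma Loop.Equivariant.apply {x : Loop m} {G : Subgroup Sym} (hx : x.Equivariant G) {e : ℤˣ}
    {b : ℝ} {A : O 3} {s : Equiv.Perm (Fin 3)} (hg : (timeMotion e b, A, s) ∈ G) (t : ℝ)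
    (i : Fin 3) : x.pos (((e : ℤ) : ℝ) * t + b) (s i) = act A.1 (x.pos t i) :=
  hx _ hg t _ (timeMotion_mulVec_clock e b t) i

/-- Elements of the core act on the configuration at each time. -/
lemma Loop.Equivariant.apply_core {x : Loop m} {G : Subgroup Sym} (hx : x.Equivariant G)
    {g : Sym} (hg : g ∈ G) (ht : tau g = 1) (t : ℝ) (i : Fin 3) :
    x.pos t (sigma g i) = act (rho g).1 (x.pos t i) :=
  hx g hg t t (by rw [MovesTime, ht]; simp) i

/-- The loop `c q + y`, where `q` is a constant configuration. -/
def Loop.addConst (y : Loop m) (q : Fin 3 → E) (hq : ∑ i, m i • q i = 0) (c : ℝ) : Loop m where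
  pos t i := c • q i + y.pos t i
  vel := y.vel
  periodic t := by funext i; rw [y.periodic]
  centered t := by
    have := y.centered t
    simp only [smul_add, Finset.sum_add_distrib, this, add_zero]
    simp only [smul_comm _ c, ← Finset.smul_sum, hq, smul_zero]
  vel_memLp := y.vel_memLp
  pos_eq t ht i := by rw [y.pos_eq t ht i, add_assoc]

/-! ### Failure of coercivity -/

lemma Loop.exists_norm_pos_le (y : Loop m) :
    ∃ M : ℝ, 0 ≤ M ∧ ∀ t ∈ Set.Icc 0 (2 * Real.pi), ∀ i, ‖y.pos t i‖ ≤ M := by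
  have h : ∀ i, ∃ C, ∀ t ∈ Set.Icc 0 (2 * Real.pi), ‖y.pos t i‖ ≤ C := fun i =>
    isCompact_Icc.exists_bound_of_continuousOn (y.continuous_pos i).continuousOn
  choose C hC using h
  refine ⟨∑ i, |C i|, Finset.sum_nonneg fun i _ => abs_nonneg _, fun t ht i => ?_⟩
  exact ((hC i t ht).trans (le_abs_self _)).trans
    (Finset.single_le_sum (f := fun i => |C i|) (fun i _ => abs_nonneg _) (Finset.mem_univ i))

lemma Loop.lintegral_kinetic_lt_top (y : Loop m) (w : E) :
    ∫⁻ t in Set.Ioc 0 (2 * Real.pi), ENNReal.ofReal (kinetic m w (y.pos t) (y.vel t)) < ⊤ := by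
  apply Integrable.lintegral_lt_top
  unfold kinetic
  refine Integrable.div_const (integrable_finsetSum _ fun i _ => Integrable.const_mul ?_ _) _
  have hc : Continuous fun t => act (Omega w) (y.pos t i) :=
    (continuous_act _).comp (y.continuous_pos i)
  have h2 : MemLp (fun t => act (Omega w) (y.pos t i)) 2
      (volume.restrict (Set.Ioc 0 (2 * Real.pi))) := by
    obtain ⟨C, hC⟩ := isCompact_Icc.exists_bound_of_continuousOn (s := Set.Icc 0 (2 * Real.pi))
      hc.continuousOn
    refine MemLp.of_bound hc.aestronglyMeasurable C ?_
    filter_upwards [ae_restrict_mem measurableSet_Ioc] with t ht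
    exact hC t (Set.Ioc_subset_Icc_self ht)
  exact ((y.vel_memLp i).add h2).integrable_norm_pow (by norm_num)

/-- The bodies of `c q + y` stay apart, uniformly for large `c`. -/
lemma Loop.exists_le_norm_addConst_sub (y : Loop m)
    (hyc : ∀ t i j, i ≠ j → y.pos t i ≠ y.pos t j) {q : Fin 3 → E} (hq : ∑ i, m i • q i = 0)
    {i j : Fin 3} (hij : i ≠ j) :
    ∃ d > 0, ∃ c₀ : ℝ, ∀ c ≥ c₀, ∀ t ∈ Set.Icc 0 (2 * Real.pi),
      d ≤ ‖(y.addConst q hq c).pos t i - (y.addConst q hq c).pos t j‖ := by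
  by_cases h : q i = q j
  · obtain ⟨t₀, -, ht₀⟩ := isCompact_Icc.exists_isMinOn (s := Set.Icc 0 (2 * Real.pi))
      ⟨0, by simp [Real.pi_pos.le]⟩
      (((y.continuous_pos i).sub (y.continuous_pos j)).norm.continuousOn)
    refine ⟨_, norm_pos_iff.2 (sub_ne_zero.2 (hyc t₀ i j hij)), 0, fun c _ t ht => ?_⟩
    simp only [Loop.addConst, h, add_sub_add_left_eq_sub]
    exact ht₀ ht
  · obtain ⟨M, hM0, hM⟩ := y.exists_norm_pos_le
    have hn : 0 < ‖q i - q j‖ := norm_pos_iff.2 (sub_ne_zero.2 h)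
    refine ⟨1, one_pos, (1 + 2 * M) / ‖q i - q j‖, fun c hc t ht => ?_⟩
    have hc0 : 0 ≤ c := le_trans (by positivity) hc
    have e : (y.addConst q hq c).pos t i - (y.addConst q hq c).pos t j =
        c • (q i - q j) - (y.pos t j - y.pos t i) := by
      simp only [Loop.addConst]; module
    rw [e]
    have h1 := norm_sub_norm_le (c • (q i - q j)) (y.pos t j - y.pos t i)
    have h2 := norm_sub_le (y.pos t j) (y.pos t i)
    rw [norm_smul, Real.norm_of_nonneg hc0] at h1
    rw [ge_iff_le, div_le_iff₀ hn] at hc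
    linarith [hM t ht i, hM t ht j]

/-- If some nonzero constant configuration `q`, at rest in the rotating frame, is invariant under
the group, then the functional is not coercive: along `c q + y`, with `y` free of collisions, the
kinetic energy is that of `y`, and the potential stays bounded as `c` tends to infinity. -/
lemma not_coercive_of_fixed {α : ℝ} (hα : 0 < α) {G : Subgroup Sym} {w : E}
    {y : Loop m} (hy : y.Equivariant G) (hyc : ∀ t i j, i ≠ j → y.pos t i ≠ y.pos t j)
    {q : Fin 3 → E} (hq : ∑ i, m i • q i = 0)
    (hqG : ∀ g ∈ G, ∀ i, q (sigma g i) = act (rho g).1 (q i))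
    (hw : ∀ i, act (Omega w) (q i) = 0) {k : Fin 3} (hk : q k ≠ 0) : ¬ Coercive m α G w := by
  intro hco
  have hpair : ∀ i j : Fin 3, i ≠ j → ∃ K : ENNReal, K < ⊤ ∧ ∃ c₀ : ℝ, ∀ c ≥ c₀,
      ∀ t ∈ Set.Icc 0 (2 * Real.pi), pairPotential m α ((y.addConst q hq c).pos t) i j ≤ K := by
    intro i j hij
    obtain ⟨d, hd, c₀, h⟩ := y.exists_le_norm_addConst_sub hyc hq hij
    refine ⟨ENNReal.ofReal (m i * m j) / ENNReal.ofReal (d ^ α), ?_, c₀, fun c hc t ht => ?_⟩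
    · exact ENNReal.div_lt_top ENNReal.ofReal_ne_top
        (ENNReal.ofReal_pos.2 (Real.rpow_pos_of_pos hd α)).ne'
    · unfold pairPotential
      gcongr
      exact h c hc t ht
  obtain ⟨K1, hK1, c1, h1⟩ := hpair 0 1 (by decide)
  obtain ⟨K2, hK2, c2, h2⟩ := hpair 0 2 (by decide)
  obtain ⟨K3, hK3, c3, h3⟩ := hpair 1 2 (by decide)
  set T := ∫⁻ t in Set.Ioc 0 (2 * Real.pi), ENNReal.ofReal (kinetic m w (y.pos t) (y.vel t))
  have hT : T < ⊤ := y.lintegral_kinetic_lt_top w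
  have hvol : volume (Set.Ioc 0 (2 * Real.pi)) = ENNReal.ofReal (2 * Real.pi) := by simp
  set C : ENNReal := T + (K1 + K2 + K3) * volume (Set.Ioc 0 (2 * Real.pi)) with hCdef
  have hC : C < ⊤ := by
    rw [hCdef, hvol]
    exact ENNReal.add_lt_top.2 ⟨hT, ENNReal.mul_lt_top
      (ENNReal.add_lt_top.2 ⟨ENNReal.add_lt_top.2 ⟨hK1, hK2⟩, hK3⟩) ENNReal.ofReal_lt_top⟩
  have hact : ∀ c, c1 ≤ c → c2 ≤ c → c3 ≤ c → action α w (y.addConst q hq c) ≤ C := by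
    intro c hc1 hc2 hc3
    have : C = ∫⁻ t in Set.Ioc 0 (2 * Real.pi),
        (ENNReal.ofReal (kinetic m w (y.pos t) (y.vel t)) + (K1 + K2 + K3)) := by
      rw [lintegral_add_right _ measurable_const, lintegral_const, Measure.restrict_apply_univ]
    rw [this]
    refine setLIntegral_mono' measurableSet_Ioc fun t ht => ?_
    have ht' := Set.Ioc_subset_Icc_self ht
    have hkin : kinetic m w ((y.addConst q hq c).pos t) ((y.addConst q hq c).vel t) =
        kinetic m w (y.pos t) (y.vel t) := by
      simp only [kinetic, Loop.addConst, act_add, act_smul, hw, smul_zero, zero_add]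
    rw [hkin]
    exact add_le_add le_rfl
      (add_le_add (add_le_add (h1 c hc1 t ht') (h2 c hc2 t ht')) (h3 c hc3 t ht'))
  obtain ⟨R, hR⟩ := hco C.toNNReal
  obtain ⟨M, hM0, hM⟩ := y.exists_norm_pos_le
  have hn : 0 < ‖q k‖ := norm_pos_iff.2 hk
  -- for this value of `c` the body `k` stays at distance at least `R + 1` from the origin
  set c : ℝ := max (max c1 c2) (max c3 ((R + 1 + M) / ‖q k‖))
  have hequi : (y.addConst q hq c).Equivariant G := by
    intro g hg t s hts i
    simp only [Loop.addConst, act_add, act_smul]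
    rw [hqG g hg i, hy g hg t s hts i]
  have hle := hR _ hequi (by
    rw [ENNReal.coe_toNNReal hC.ne]
    exact hact c ((le_max_left _ _).trans (le_max_left _ _))
      ((le_max_right _ _).trans (le_max_left _ _)) ((le_max_left _ _).trans (le_max_right _ _)))
  have hc : (R + 1 + M) / ‖q k‖ ≤ c := (le_max_right _ _).trans (le_max_right _ _)
  have hc0 : 0 ≤ c := le_trans (by positivity) hc
  have hlow : ENNReal.ofReal (R + 1) * volume (Set.Ioc 0 (2 * Real.pi)) ≤
      (y.addConst q hq c).normSq := by
    rw [← Measure.restrict_apply_univ, ← lintegral_const]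
    refine setLIntegral_mono' measurableSet_Ioc fun t ht => ENNReal.ofReal_le_ofReal ?_
    have h5 : ‖(y.addConst q hq c).pos t k‖ ^ 2 ≤
        ∑ i, (‖(y.addConst q hq c).pos t i‖ ^ 2 + ‖(y.addConst q hq c).vel t i‖ ^ 2) :=
      (le_add_of_nonneg_right (sq_nonneg _)).trans
        (Finset.single_le_sum (f := fun i => ‖(y.addConst q hq c).pos t i‖ ^ 2 +
          ‖(y.addConst q hq c).vel t i‖ ^ 2) (fun i _ => by positivity) (Finset.mem_univ k))
    refine le_trans ?_ h5
    have h6 : (R : ℝ) + 1 ≤ ‖(y.addConst q hq c).pos t k‖ := by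
      have h7 := norm_sub_norm_le (c • q k) (-(y.pos t k))
      rw [sub_neg_eq_add, norm_neg, norm_smul, Real.norm_of_nonneg hc0] at h7
      rw [div_le_iff₀ hn] at hc
      have h8 := hM t (Set.Ioc_subset_Icc_self ht) k
      change _ ≤ ‖c • q k + y.pos t k‖
      linarith
    have hR0 : (0 : ℝ) ≤ R := R.coe_nonneg
    nlinarith
  have hfin := hlow.trans hle
  rw [hvol, ← ENNReal.ofReal_mul (by positivity), ← ENNReal.ofReal_coe_nnreal] at hfin
  replace hfin := (ENNReal.ofReal_le_ofReal_iff R.coe_nonneg).1 hfin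
  have hR0 : (0 : ℝ) ≤ R := R.coe_nonneg
  have := le_mul_of_one_le_right (a := (R : ℝ) + 1) (by positivity)
    (by linarith [Real.two_le_pi] : 1 ≤ 2 * Real.pi)
  linarith

/-! ### The mean configuration of a loop -/

/-- The integral over a period of the configurations of a loop: the mean configuration, up to the
factor `2π`, which plays no role. -/
noncomputable def Loop.mean (y : Loop m) (i : Fin 3) : E := ∫ t in 0..(2 * Real.pi), y.pos t i

lemma Loop.inner_mean (y : Loop m) (u : E) (i : Fin 3) :
    inner ℝ u (y.mean i) = ∫ t in 0..(2 * Real.pi), (inner ℝ u (y.pos t i) : ℝ) :=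
  ((innerSL ℝ u).intervalIntegral_comp_comm
    ((y.continuous_pos i).intervalIntegrable _ _)).symm

lemma Loop.mean_centered (y : Loop m) : ∑ i, m i • y.mean i = 0 := by
  simp only [Loop.mean, ← intervalIntegral.integral_smul]
  rw [← intervalIntegral.integral_finsetSum (f := fun i t => m i • y.pos t i) fun i _ =>
    ((y.continuous_pos i).const_smul (m i)).intervalIntegrable _ _]
  simp [y.centered]

/-- The integral over a period is invariant under the motions of time. -/
lemma integral_timeMotion {F : Type*} [NormedAddCommGroup F] [NormedSpace ℝ F] {f : ℝ → F}
    (hf : Function.Periodic f (2 * Real.pi)) (e : ℤˣ) (b : ℝ) :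
    ∫ t in 0..(2 * Real.pi), f (((e : ℤ) : ℝ) * t + b) = ∫ t in 0..(2 * Real.pi), f t := by
  have key : ∀ a : ℝ, ∫ t in a..(a + 2 * Real.pi), f t = ∫ t in 0..(2 * Real.pi), f t := by
    intro a
    simpa using hf.intervalIntegral_add_eq a 0
  rcases units_cases e with rfl | rfl
  · simp only [Units.val_one, Int.cast_one, one_mul]
    rw [intervalIntegral.integral_comp_add_right, zero_add, add_comm, key]
  · simp only [Units.val_neg, Units.val_one, Int.reduceNeg, Int.cast_neg, Int.cast_one,
      neg_mul, one_mul, neg_add_eq_sub]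
    rw [intervalIntegral.integral_comp_sub_left, sub_zero]
    have := key (b - 2 * Real.pi)
    rwa [sub_add_cancel] at this

lemma Loop.Equivariant.mean {y : Loop m} {G : Subgroup Sym} (hy : y.Equivariant G) {g : Sym}
    (hg : g ∈ G) (i : Fin 3) : y.mean (sigma g i) = act (rho g).1 (y.mean i) := by
  obtain ⟨M, A, s⟩ := g
  obtain ⟨e, b, rfl⟩ := exists_timeMotion M
  change y.mean (s i) = act A.1 (y.mean i)
  rw [act_eq_toEuclideanCLM, Loop.mean, Loop.mean, ← ContinuousLinearMap.intervalIntegral_comp_comm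
    _ ((y.continuous_pos i).intervalIntegrable _ _),
    ← integral_timeMotion (y.periodic_pos (s i)) e b]
  refine intervalIntegral.integral_congr fun t _ => ?_
  rw [← act_eq_toEuclideanCLM, hy.apply hg]

lemma integral_ne_zero_of_ne_zero {f : ℝ → ℝ} (hf : Continuous f) (h0 : ∀ t, f t ≠ 0) :
    ∫ t in 0..(2 * Real.pi), f t ≠ 0 := by
  by_cases hpos : ∀ t, 0 < f t
  · exact (intervalIntegral.intervalIntegral_pos_of_pos (hf.intervalIntegrable _ _) hpos
      Real.two_pi_pos).ne'
  · push Not at hpos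
    obtain ⟨a, ha⟩ := hpos
    have hneg : ∀ t, 0 < -f t := by
      intro t
      by_contra hc
      obtain ⟨c, hc⟩ := mem_range_of_exists_le_of_exists_ge hf ⟨a, ha⟩ ⟨t, by linarith⟩
      exact h0 c hc
    have := intervalIntegral.intervalIntegral_pos_of_pos (hf.neg.intervalIntegrable _ _) hneg
      Real.two_pi_pos
    intro h
    rw [show (-f) = fun t => -f t from rfl, intervalIntegral.integral_neg, h] at this
    simp at this

/-! ### Criteria for the excluded classes of groups -/

lemma exists_collisionless {G : Subgroup Sym} (hcoll : ¬ BoundToCollisions m G) :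
    ∃ y : Loop m, y.Equivariant G ∧ ∀ t i j, i ≠ j → y.pos t i ≠ y.pos t j := by
  unfold BoundToCollisions at hcoll
  push Not at hcoll
  exact hcoll

/-- A group is fully uncoercive when, for each rotation vector, it fixes a nonzero configuration
at rest in the rotating frame. -/
lemma fullyUncoercive_of_fixed {α : ℝ} (hα : 0 < α) {G : Subgroup Sym}
    (hcoll : ¬ BoundToCollisions m G)
    (h : ∀ w, IsRotationVector G w → ∃ q : Fin 3 → E, ∑ i, m i • q i = 0 ∧
      (∀ g ∈ G, ∀ i, q (sigma g i) = act (rho g).1 (q i)) ∧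
      (∀ i, act (Omega w) (q i) = 0) ∧ ∃ k, q k ≠ 0) : FullyUncoercive m α G := by
  obtain ⟨y, hy, hyc⟩ := exists_collisionless hcoll
  intro w hw
  obtain ⟨q, hq, hqG, hqw, k, hk⟩ := h w hw
  exact not_coercive_of_fixed hα hy hyc hq hqG hqw hk

/-- If the line of `u` is invariant and contains every rotation vector, and the components along `u`
of two bodies of a loop never coincide, then the mean of these components is a nonzero fixed
configuration. -/
lemma fullyUncoercive_of_line {α : ℝ} (hα : 0 < α) {G : Subgroup Sym}
    (hcoll : ¬ BoundToCollisions m G) {y : Loop m} (hy : y.Equivariant G) {u : E} (hu : ‖u‖ = 1)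
    (hGu : ∀ g ∈ G, act (rho g).1 u = u ∨ act (rho g).1 u = -u)
    (hrot : ∀ w, IsRotationVector G w → ∃ c : ℝ, w = c • u)
    {i j : Fin 3} (hij : ∀ t, (inner ℝ u (y.pos t i - y.pos t j) : ℝ) ≠ 0) :
    FullyUncoercive m α G := by
  refine fullyUncoercive_of_fixed hα hcoll fun w hw => ?_
  have hu0 : u ≠ 0 := fun h => by simp [h] at hu
  obtain ⟨c, rfl⟩ := hrot w hw
  refine ⟨fun i => (inner ℝ u (y.mean i) : ℝ) • u, ?_, fun g hg i => ?_, fun i => ?_, ?_⟩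
  · simp only [smul_smul, ← Finset.sum_smul]
    have := congrArg (fun v => (inner ℝ u v : ℝ)) y.mean_centered
    simp only [inner_sum, inner_smul_right, inner_zero_right] at this
    rw [this, zero_smul]
  · have h1 := inner_act (rho g) u (y.mean i)
    simp only [act_smul, hy.mean hg]
    rcases hGu g hg with h | h
    · rw [h] at h1 ⊢
      rw [h1]
    · rw [h, inner_neg_left] at h1
      rw [h, ← h1]
      module
  · rw [act_smul, Omega_smul, act_smul_left, act_Omega_self, smul_zero, smul_zero]
  · by_contra hc
    push Not at hc
    have h0 : ∀ k, (inner ℝ u (y.mean k) : ℝ) = 0 := fun k =>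
      (smul_eq_zero.1 (hc k)).resolve_right hu0
    have hcont : ∀ k, Continuous fun t => (inner ℝ u (y.pos t k) : ℝ) := fun k =>
      continuous_const.inner (y.continuous_pos k)
    refine integral_ne_zero_of_ne_zero ((hcont i).sub (hcont j))
      (fun t => by simpa [inner_sub_right] using hij t) ?_
    change ∫ t in 0..(2 * Real.pi),
      ((inner ℝ u (y.pos t i) : ℝ) - (inner ℝ u (y.pos t j) : ℝ)) = 0
    rw [intervalIntegral.integral_sub ((hcont i).intervalIntegrable _ _)
      ((hcont j).intervalIntegrable _ _), ← y.inner_mean, ← y.inner_mean, h0, h0, sub_zero]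

/-- A group is homographic when the Gram matrix of its loops is determined up to scaling. -/
lemma homographic_of_gram {G : Subgroup Sym}
    (h : ∀ x : Loop m, x.Equivariant G → ∃ M : Fin 3 → Fin 3 → ℝ, ∀ t, ∃ r : ℝ, ∀ i j,
      inner ℝ (x.pos t i) (x.pos t j) = r ^ 2 * M i j) : Homographic m G := by
  intro x hx
  obtain ⟨M, hM⟩ := h x hx
  choose r hr using hM
  by_cases h0 : ∀ t, r t = 0
  · refine ⟨fun _ => 0, fun t => ⟨0, 1, fun i => ?_⟩⟩
    have := hr t i i
    rw [h0, zero_pow two_ne_zero, zero_mul, inner_self_eq_zero] at this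
    rw [this, zero_smul]
  · push Not at h0
    obtain ⟨t₀, ht₀⟩ := h0
    refine ⟨x.pos t₀, fun t => ⟨r t / r t₀, ?_⟩⟩
    obtain ⟨R, hR⟩ := exists_act_eq_of_inner_eq (p := x.pos t)
      (q := fun i => (r t / r t₀) • x.pos t₀ i) (fun i j => by
        rw [inner_smul_left, inner_smul_right, hr, hr]
        simp only [RCLike.conj_to_real]
        field_simp)
    exact ⟨R, fun i => by rw [hR, act_smul]⟩

/-! ### Groups with non-trivial core -/

lemma norm_inv_smul {v : E} (hv : v ≠ 0) : ‖‖v‖⁻¹ • v‖ = 1 := by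
  rw [norm_smul, norm_inv, norm_norm, inv_mul_cancel₀ (norm_ne_zero_iff.2 hv)]

lemma eq_or_eq_neg_of_smul {u v : E} {c : ℝ} (hu : ‖u‖ = 1) (hv : ‖v‖ = 1) (h : v = c • u) :
    v = u ∨ v = -u := by
  rw [h, norm_smul, hu, mul_one, Real.norm_eq_abs] at hv
  rcases eq_or_eq_neg_of_abs_eq hv with h1 | h1
  · left; rw [h, h1, one_smul]
  · right; rw [h, h1, neg_one_smul]

/-- The vectors fixed by a non-trivial rotation are on its axis. -/
lemma eq_smul_of_fixed {A : O 3} (hA : A ≠ 1) (hd : A.1.det = 1) {v : E} (hv : ‖v‖ = 1)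
    (hAv : act A.1 v = v) {x : E} (hx : act A.1 x = x) : x = (inner ℝ v x : ℝ) • v := by
  by_contra hne
  set w := x - (inner ℝ v x : ℝ) • v
  have hw0 : w ≠ 0 := sub_ne_zero.2 hne
  have hvv : (inner ℝ v v : ℝ) = 1 := by rw [real_inner_self_eq_norm_sq, hv]; norm_num
  have hvw : inner ℝ v w = 0 := by
    simp only [w]
    rw [inner_sub_right, inner_smul_right, hvv]; ring
  have hw : act A.1 w = w := by simp only [w]; rw [act_sub, act_smul, hAv, hx]
  obtain ⟨b, hb2, hb0⟩ := exists_basis_of_pair hv (norm_inv_smul hw0)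
    (by rw [inner_smul_right, hvw, mul_zero])
  have e2 : act A.1 (b 2) = (1 : ℝ) • b 2 := by rw [hb2, hAv, one_smul]
  have e0 : act A.1 (b 0) = (1 : ℝ) • b 0 := by rw [hb0, act_smul, hw, one_smul]
  have e1 := act_third A b (by norm_num) (by norm_num) e2 e0
  rw [hd] at e1
  refine hA (Subtype.ext (act_basis_ext b fun i => ?_))
  fin_cases i
  · simpa using e0
  · simpa using e1
  · simpa using e2

lemma isPlaneReflection_of_fixed {A : O 3} (hd : A.1.det = -1) {v : E} (hv : ‖v‖ = 1)
    (hAv : act A.1 v = v) : IsPlaneReflection A := by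
  obtain ⟨u, hu, hAu⟩ := exists_axis A
  rw [hd] at hAu
  have huv : inner ℝ u v = 0 := by
    have := inner_act A u v
    rw [hAu, hAv, inner_smul_left] at this
    simp only [RCLike.conj_to_real] at this
    linarith
  obtain ⟨b, hb2, hb0⟩ := exists_basis_of_pair hu hv huv
  have e2 : act A.1 (b 2) = (-1 : ℝ) • b 2 := by rw [hb2, hAu]
  have e0 : act A.1 (b 0) = (1 : ℝ) • b 0 := by rw [hb0, hAv, one_smul]
  have e1 := act_third A b (by norm_num) (by norm_num) e2 e0
  rw [hd] at e1
  refine ⟨u, hu, fun x => ?_⟩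
  conv_lhs => rw [← b.sum_repr' x, Fin.sum_univ_three]
  conv_rhs => rw [← b.sum_repr' x, Fin.sum_univ_three]
  rw [act_add, act_add, act_smul, act_smul, act_smul, e0, e1, e2, ← hb2]
  simp only [inner_add_right, inner_smul_right, inner_basis]
  simp
  module

lemma ne_zero_of_collisionless {y : Loop m} (hyc : ∀ t i j, i ≠ j → y.pos t i ≠ y.pos t j) (t : ℝ) :
    ∃ i, y.pos t i ≠ 0 := by
  by_contra hc
  push Not at hc
  exact hyc t 0 1 (by decide) (by rw [hc, hc])

/-- An element of the core that fixes the bodies is trivial: otherwise it would confine the bodies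
to a point, a line or a plane, and the group would be bound to collisions, fully uncoercive, or
excluded as planar. -/
lemma rho_eq_one_of_core {α : ℝ} (hα : 0 < α) {G : Subgroup Sym}
    (hspace : ∀ g ∈ G, tau g = 1 → sigma g = 1 → ¬ IsPlaneReflection (rho g))
    (hcoll : ¬ BoundToCollisions m G) (hunc : ¬ FullyUncoercive m α G)
    {g : Sym} (hg : g ∈ G) (ht : tau g = 1) (hs : sigma g = 1) : rho g = 1 := by
  by_contra hA
  obtain ⟨y, hy, hyc⟩ := exists_collisionless hcoll
  have hfix : ∀ t i, act (rho g).1 (y.pos t i) = y.pos t i := by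
    intro t i
    have := hy.apply_core hg ht t i
    rw [hs] at this
    exact this.symm
  obtain ⟨i, hi⟩ := ne_zero_of_collisionless hyc 0
  have hv := norm_inv_smul hi
  have hAv : act (rho g).1 (‖y.pos 0 i‖⁻¹ • y.pos 0 i) = ‖y.pos 0 i‖⁻¹ • y.pos 0 i := by
    rw [act_smul, hfix]
  set v := ‖y.pos 0 i‖⁻¹ • y.pos 0 i with hvdef
  rcases det_eq_one_or (rho g) with hd | hd
  -- a non-trivial rotation: the bodies stay on its axis, where two of them keep their order
  · have hline : ∀ x, act (rho g).1 x = x → x = (inner ℝ v x : ℝ) • v := fun x hx =>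
      eq_smul_of_fixed hA hd hv hAv hx
    refine hunc (fullyUncoercive_of_line hα hcoll hy hv (fun g' hg' => ?_) (fun w hw => ?_)
      (i := 0) (j := 1) (fun t h0 => ?_))
    · obtain ⟨M, B, s⟩ := g'
      obtain ⟨e, b, rfl⟩ := exists_timeMotion M
      have h1 := hy.apply hg' 0 i
      have h2 := hline _ (hfix (((e : ℤ) : ℝ) * 0 + b) (s i))
      rw [h1] at h2
      refine eq_or_eq_neg_of_smul hv ((norm_act B v).trans hv)
        (c := ‖y.pos 0 i‖⁻¹ * (inner ℝ v (act B.1 (y.pos 0 i)) : ℝ)) ?_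
      change act B.1 v = _
      rw [mul_smul, ← h2, hvdef, act_smul]
    · have := hw g hg
      rw [ht, hd] at this
      refine ⟨_, hline w ?_⟩
      simpa using this
    · refine hyc t 0 1 (by decide) (sub_eq_zero.1 ?_)
      rw [hline (y.pos t 0 - y.pos t 1) (by rw [act_sub, hfix, hfix]), h0, zero_smul]
  · exact hspace g hg ht hs (isPlaneReflection_of_fixed hd hv hAv)

lemma perm_fixedPointFree : ∀ s : Equiv.Perm (Fin 3), (∀ i, s i ≠ i) →
    (s 0 = 1 ∧ s 1 = 2) ∨ (s 0 = 2 ∧ s 2 = 1) := by decide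

lemma perm_eq_swap : ∀ s : Equiv.Perm (Fin 3), s ≠ 1 → (∃ i, s i = i) →
    ∃ i j l, i ≠ j ∧ s i = j ∧ s j = i ∧ s l = l ∧ (∀ a, a = i ∨ a = j ∨ a = l) ∧
      s = Equiv.swap i j := by decide

lemma perm_mul_eq_one : ∀ s t : Equiv.Perm (Fin 3), s ≠ 1 → t ≠ 1 → (∃ i, s i = i) →
    (∃ i, t i = i) → (∃ i, (s * t) i = i) → s * t = 1 := by decide

/-- If the core permutes the bodies cyclically, they form an equilateral triangle. -/
lemma homographic_of_cycle (hm : ∀ i, 0 < m i) {G : Subgroup Sym}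
    (hmass : ∀ g ∈ G, ∀ i, m (sigma g i) = m i) {g : Sym} (hg : g ∈ G) (ht : tau g = 1)
    (hs : ∀ i, sigma g i ≠ i) : Homographic m G := by
  refine homographic_of_gram fun x hx => ⟨fun i j => if i = j then 1 else -(1 / 2), fun t =>
    ⟨‖x.pos t 0‖, ?_⟩⟩
  have hn : ∀ i, ‖x.pos t (sigma g i)‖ = ‖x.pos t i‖ := fun i => by
    rw [hx.apply_core hg ht, norm_act]
  have h : (m 1 = m 0 ∧ ‖x.pos t 1‖ = ‖x.pos t 0‖) ∧ (m 2 = m 0 ∧ ‖x.pos t 2‖ = ‖x.pos t 0‖) := by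
    rcases perm_fixedPointFree _ hs with ⟨h0, h1⟩ | ⟨h0, h1⟩
    · have a0 := hmass g hg 0; have a1 := hmass g hg 1
      have b0 := hn 0; have b1 := hn 1
      rw [h0] at a0 b0
      rw [h1] at a1 b1
      exact ⟨⟨a0, b0⟩, a1.trans a0, b1.trans b0⟩
    · have a0 := hmass g hg 0; have a1 := hmass g hg 2
      have b0 := hn 0; have b1 := hn 2
      rw [h0] at a0 b0
      rw [h1] at a1 b1
      exact ⟨⟨a1.trans a0, b1.trans b0⟩, a0, b0⟩
  obtain ⟨⟨m1, n1⟩, m2, n2⟩ := h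
  have hsum : x.pos t 0 + x.pos t 1 + x.pos t 2 = 0 := by
    have := x.centered t
    rw [Fin.sum_univ_three, m1, m2, ← smul_add, ← smul_add] at this
    exact (smul_eq_zero.1 this).resolve_left (hm 0).ne'
  have hin : ∀ i, (inner ℝ (x.pos t i) (x.pos t 0) : ℝ) + inner ℝ (x.pos t i) (x.pos t 1) +
      inner ℝ (x.pos t i) (x.pos t 2) = 0 := fun i => by
    rw [← inner_add_right, ← inner_add_right, hsum, inner_zero_right]
  have q0 := real_inner_self_eq_norm_sq (x.pos t 0)
  have q1 := real_inner_self_eq_norm_sq (x.pos t 1)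
  have q2 := real_inner_self_eq_norm_sq (x.pos t 2)
  rw [n1] at q1
  rw [n2] at q2
  have e0 := hin 0
  have e1 := hin 1
  have e2 := hin 2
  have c1 := real_inner_comm (x.pos t 1) (x.pos t 0)
  have c2 := real_inner_comm (x.pos t 2) (x.pos t 0)
  have c3 := real_inner_comm (x.pos t 2) (x.pos t 1)
  intro i j
  fin_cases i <;> fin_cases j <;> simp <;> linarith

lemma neg_mem_O (A : O 3) : -A.1 ∈ Matrix.orthogonalGroup (Fin 3) ℝ := by
  rw [Matrix.mem_orthogonalGroup_iff]
  have := mul_transpose_self A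
  simpa using this

/-- A symmetry `x ↦ -x` exchanging two bodies puts the third one at the origin. -/
lemma homographic_of_neg {G : Subgroup Sym} {g : Sym} (hg : g ∈ G) (ht : tau g = 1)
    (hr : ∀ x, act (rho g).1 x = -x) {i j l : Fin 3} (hij : i ≠ j) (hi : sigma g i = j)
    (hl : sigma g l = l) (hall : ∀ a, a = i ∨ a = j ∨ a = l) : Homographic m G := by
  have hli : l ≠ i := by rintro rfl; exact hij (hl.symm.trans hi)
  have hlj : l ≠ j := by
    rintro rfl; exact hij ((sigma g).injective (hi.trans hl.symm))
  refine homographic_of_gram fun x hx => ⟨fun a b =>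
    (if a = i then 1 else if a = j then -1 else 0) *
      (if b = i then 1 else if b = j then -1 else 0), fun t => ⟨‖x.pos t i‖, ?_⟩⟩
  have hx' : ∀ a, x.pos t a = (if a = i then (1 : ℝ) else if a = j then -1 else 0) • x.pos t i := by
    intro a
    rcases hall a with rfl | rfl | rfl
    · simp
    · rw [if_neg hij.symm, if_pos rfl, neg_one_smul, ← hr, ← hx.apply_core hg ht, hi]
    · rw [if_neg hli, if_neg hlj, zero_smul]
      have := hx.apply_core hg ht t a
      rw [hl, hr] at this
      have h2 : (2 : ℝ) • x.pos t a = 0 := by rw [two_smul, add_eq_zero_iff_eq_neg]; exact this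
      exact (smul_eq_zero.1 h2).resolve_left two_ne_zero
  intro a b
  rw [hx' a, hx' b, inner_smul_left, inner_smul_right, real_inner_self_eq_norm_sq]
  simp only [RCLike.conj_to_real]
  ring

lemma rotationVector_core {G : Subgroup Sym} {w : E} (hw : IsRotationVector G w) {g : Sym}
    (hg : g ∈ G) (ht : tau g = 1) : act (rho g).1 w = (rho g).1.det • w := by
  have := hw g hg
  rw [ht] at this
  simpa using this

/-- A plane reflection exchanging two bodies keeps them on the two sides of its plane, and
generates a fully uncoercive group when it generates the core. -/
lemma fullyUncoercive_of_reflection {α : ℝ} (hα : 0 < α) {G : Subgroup Sym}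
    (hcoll : ¬ BoundToCollisions m G) {k : Sym} (hk : k ∈ G) (ht : tau k = 1)
    (hcomm : ∀ g ∈ G, g * k * g⁻¹ = k) (hd : (rho k).1.det = -1) (hr : IsPlaneReflection (rho k))
    {i j : Fin 3} (hij : i ≠ j) (hi : sigma k i = j) : FullyUncoercive m α G := by
  obtain ⟨y, hy, hyc⟩ := exists_collisionless hcoll
  obtain ⟨u, hu, hr⟩ := hr
  have hline : ∀ x, act (rho k).1 x = -x → x = (inner ℝ u x : ℝ) • u := by
    intro x hx
    have h1 := hr x
    rw [hx] at h1
    have h2 : (2 : ℝ) • x = (2 * inner ℝ u x : ℝ) • u := by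
      have h3 : x + x = x + -(x - (2 * inner ℝ u x : ℝ) • u) := by rw [← h1, neg_neg]
      rw [two_smul, h3]; abel
    rw [mul_smul] at h2
    exact smul_right_injective E two_ne_zero h2
  have hku : act (rho k).1 u = -u := by
    rw [hr, real_inner_self_eq_norm_sq, hu]; module
  refine fullyUncoercive_of_line hα hcoll hy hu (fun g hg => ?_) (fun w hw => ?_)
    (i := i) (j := j) (fun t h0 => ?_)
  · have hgk : g * k = k * g := mul_inv_eq_iff_eq_mul.1 (hcomm g hg)
    have h2 : rho g * rho k = rho k * rho g := congrArg rho hgk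
    refine eq_or_eq_neg_of_smul hu ((norm_act _ _).trans hu) (hline _ ?_)
    rw [← act_coe_mul, ← h2, act_coe_mul, hku, act_neg]
  · refine ⟨_, hline w ?_⟩
    rw [rotationVector_core hw hk ht, hd, neg_one_smul]
  · have h1 : y.pos t j = y.pos t i - (2 * inner ℝ u (y.pos t i) : ℝ) • u := by
      rw [← hr, ← hi, hy.apply_core hk ht]
    have h2 : (inner ℝ u (y.pos t i) : ℝ) = 0 := by
      rw [h1, sub_sub_cancel, inner_smul_right, real_inner_self_eq_norm_sq, hu] at h0
      linarith
    rw [h2] at h1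
    exact hyc t i j hij (by simpa using h1.symm)

/-- An element of the core is determined by its permutation, which fixes a body. Hence the core has
order two, and its generator is a transposition acting on space as an involution; half turns are
the only involutions that are not excluded. -/
theorem verticalIsosceles_of_core_ne_bot (hm : ∀ i, 0 < m i) {α : ℝ} (hα : 0 < α)
    {G : Subgroup Sym} (hmass : ∀ g ∈ G, ∀ i, m (sigma g i) = m i)
    (hspace : ∀ g ∈ G, tau g = 1 → sigma g = 1 → ¬ IsPlaneReflection (rho g))
    (hcoll : ¬ BoundToCollisions m G) (hunc : ¬ FullyUncoercive m α G)
    (hhom : ¬ Homographic m G) (hcore : core G ≠ ⊥) : VerticalIsosceles G := by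
  have hmem : ∀ g : Sym, g ∈ core G ↔ g ∈ G ∧ tau g = 1 := fun g => Iff.rfl
  have hone : ∀ g ∈ core G, sigma g = 1 → g = 1 := by
    intro g hg hs
    obtain ⟨hgG, ht⟩ := (hmem g).1 hg
    exact Prod.ext ht (Prod.ext (rho_eq_one_of_core hα hspace hcoll hunc hgG ht hs) hs)
  have hfix : ∀ g ∈ core G, ∃ i, sigma g i = i := by
    intro g hg
    by_contra hc
    push Not at hc
    obtain ⟨hgG, ht⟩ := (hmem g).1 hg
    exact hhom (homographic_of_cycle hm hmass hgG ht hc)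
  obtain ⟨⟨k, hk⟩, hk1'⟩ := (Subgroup.ne_bot_iff_exists_ne_one (H := core G)).1 hcore
  have hk1 : k ≠ 1 := fun h => hk1' (Subtype.ext h)
  have hmul : ∀ g ∈ core G, ∀ g' ∈ core G, g ≠ 1 → g' ≠ 1 → g * g' = 1 := by
    intro g hg g' hg' h1 h1'
    have hgg := mul_mem hg hg'
    exact hone _ hgg (perm_mul_eq_one (sigma g) (sigma g') (fun h => h1 (hone g hg h))
      (fun h => h1' (hone g' hg' h)) (hfix g hg) (hfix g' hg') (hfix _ hgg))
  obtain ⟨hkG, ht⟩ := (hmem k).1 hk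
  obtain ⟨i, j, l, hij, hi, hj, hl, hall, hswap⟩ :=
    perm_eq_swap (sigma k) (fun h => hk1 (hone k hk h)) (hfix k hk)
  have hkk : rho k * rho k = 1 := congrArg rho (hmul k hk k hk hk1 hk1)
  have hcomm : ∀ g ∈ G, g * k * g⁻¹ = k := by
    intro g hg
    have h1 : g * k * g⁻¹ ∈ core G := by
      rw [hmem]
      refine ⟨mul_mem (mul_mem hg hkG) (inv_mem hg), ?_⟩
      change tau g * tau k * (tau g)⁻¹ = 1
      rw [ht, mul_one, mul_inv_cancel]
    have h2 : g * k * g⁻¹ ≠ 1 := by rwa [Ne, conj_eq_one_iff]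
    exact mul_right_cancel ((hmul _ h1 k hk h2 hk1).trans (hmul k hk k hk hk1 hk1).symm)
  refine ⟨k, le_antisymm (fun g hg => ?_) ((Subgroup.zpowers_le).2 hk), ?_, ?_⟩
  · by_cases h1 : g = 1
    · rw [h1]; exact one_mem _
    · rw [eq_inv_of_mul_eq_one_left (hmul g hg k hk h1 hk1)]
      exact inv_mem (Subgroup.mem_zpowers k)
  · rcases det_eq_one_or (rho k) with hd | hd
    · refine (eq_one_or_isHalfTurn (rho k) hd hkk).resolve_left fun h1 => ?_
      obtain ⟨y, hy, hyc⟩ := exists_collisionless hcoll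
      have := hy.apply_core hkG ht 0 i
      rw [hi, h1, act_coe_one] at this
      exact hyc 0 i j hij this.symm
    -- the opposite of an involution of determinant `-1` is the identity or a half turn
    · exfalso
      have hneg : ∀ x, act (-(rho k).1) x = -act (rho k).1 x := neg_act _
      rcases eq_one_or_isHalfTurn ⟨-(rho k).1, neg_mem_O (rho k)⟩
        (by rw [Matrix.det_neg, hd]; norm_num) (Subtype.ext (by
          change -(rho k).1 * -(rho k).1 = 1
          rw [neg_mul_neg]; exact congrArg Subtype.val hkk)) with h | ⟨u, hu, h⟩
      · refine hhom (homographic_of_neg hkG ht (fun x => ?_) hij hi hl hall)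
        have h2 := congrArg (fun A : O 3 => act A.1 x) h
        simp only [act_coe_one] at h2
        rw [hneg] at h2
        rw [← h2, neg_neg, h2]
      · refine hunc (fullyUncoercive_of_reflection hα hcoll hkG ht hcomm hd ⟨u, hu, fun x => ?_⟩
          hij hi)
        have h2 := h x
        simp only [hneg] at h2
        rw [neg_eq_iff_eq_neg.1 h2, neg_sub]
  · rw [hswap]
    exact Equiv.Perm.isConj_swap hij (by decide)

/-! ### Cyclic and dihedral symmetry groups -/

/-- The elements of `G` that are shifts of the time are the powers of `(t ↦ t + p, A, s)`, on the
time line. -/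
def ShiftsGeneratedBy (G : Subgroup Sym) (p : ℝ) (A : O 3) (s : Equiv.Perm (Fin 3)) : Prop :=
  ∀ b A' s', (timeMotion 1 b, A', s') ∈ G ↔ ∃ k : ℤ, b = k * p ∧ A' = A ^ k ∧ s' = s ^ k

/-- The elements of `G` that reverse the time are the products of the powers of `(t ↦ t + p, A, s)`
and of `(t ↦ -t + q, B, σ)`, on the time line. -/
def ReversalsGeneratedBy (G : Subgroup Sym) (p : ℝ) (A : O 3) (s : Equiv.Perm (Fin 3)) (q : ℝ)
    (B : O 3) (σ : Equiv.Perm (Fin 3)) : Prop :=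
  ∀ b A' s', (timeMotion (-1) b, A', s') ∈ G ↔
    ∃ k : ℤ, b = k * p + q ∧ A' = A ^ k * B ∧ s' = s ^ k * σ

/-- A symmetry group without reversal of the time, generated by `(t ↦ t + p, A, s)`. -/
structure IsCyclicGroup (G : Subgroup Sym) (p : ℝ) (A : O 3) (s : Equiv.Perm (Fin 3)) : Prop where
  pos : 0 < p
  shifts : ShiftsGeneratedBy G p A s
  reversals : ∀ b A' s', (timeMotion (-1) b, A', s') ∉ G

/-- A symmetry group generated by `(t ↦ t + p, A, s)` and `(t ↦ -t + q, B, σ)`, with the dihedral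
relations. -/
structure IsDihedralGroup (G : Subgroup Sym) (p : ℝ) (A : O 3) (s : Equiv.Perm (Fin 3)) (q : ℝ)
    (B : O 3) (σ : Equiv.Perm (Fin 3)) : Prop where
  pos : 0 < p
  shifts : ShiftsGeneratedBy G p A s
  reversals : ReversalsGeneratedBy G p A s q B σ
  rho_sq : B * B = 1
  sigma_sq : σ * σ = 1
  rho_comm : B * A = A⁻¹ * B
  sigma_comm : σ * s = s⁻¹ * σ

lemma timeMotion_one_zpow (p : ℝ) (k : ℤ) : timeMotion 1 p ^ k = timeMotion 1 (k * p) := by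
  induction k using Int.induction_on with
  | zero => simp [timeMotion_one_zero]
  | succ n ih =>
    rw [_root_.zpow_add_one, ih, timeMotion_mul]; push_cast; congr 1; ring
  | pred n ih =>
    rw [_root_.zpow_sub_one, ih, timeMotion_inv, timeMotion_mul]; push_cast; congr 1; ring

lemma shift_zpow (p : ℝ) (A : O 3) (s : Equiv.Perm (Fin 3)) (k : ℤ) :
    ((timeMotion 1 p, A, s) : Sym) ^ k = (timeMotion 1 (k * p), A ^ k, s ^ k) := by
  rw [← timeMotion_one_zpow]; rfl

lemma reversal_eq (p q : ℝ) (A B : O 3) (s σ : Equiv.Perm (Fin 3)) (k : ℤ) :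
    ((timeMotion 1 p, A, s) : Sym) ^ k * (timeMotion (-1) q, B, σ) =
      (timeMotion (-1) (k * p + q), A ^ k * B, s ^ k * σ) := by
  rw [shift_zpow]
  refine Prod.ext ?_ rfl
  change timeMotion 1 _ * timeMotion (-1) q = timeMotion (-1) _
  rw [timeMotion_mul]; simp

/-- The elements of a group generated by a pair with the dihedral relations. -/
lemma mem_closure_pair_dihedral {Γ : Type*} [Group Γ] {r h : Γ} (hh : h * h = 1)
    (hr : h * r = r⁻¹ * h) {x : Γ} :
    x ∈ Subgroup.closure {r, h} ↔ ∃ k : ℤ, x = r ^ k ∨ x = r ^ k * h := by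
  have hcomm : ∀ k : ℤ, h * r ^ k = r ^ (-k) * h := by
    intro k
    have h1 : SemiconjBy h r r⁻¹ := hr
    have h2 := h1.zpow_right k
    rw [_root_.inv_zpow'] at h2
    exact h2
  have hinv : h⁻¹ = h := inv_eq_of_mul_eq_one_left hh
  constructor
  · intro hx
    induction hx using Subgroup.closure_induction with
    | mem x hx =>
      rcases hx with rfl | rfl
      · exact ⟨1, Or.inl (by simp)⟩
      · exact ⟨0, Or.inr (by simp)⟩
    | one => exact ⟨0, Or.inl (by simp)⟩
    | mul x y _ _ hx hy =>
      obtain ⟨k, rfl | rfl⟩ := hx <;> obtain ⟨l, rfl | rfl⟩ := hy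
      · exact ⟨k + l, Or.inl (_root_.zpow_add r k l).symm⟩
      · exact ⟨k + l, Or.inr (by rw [_root_.zpow_add, mul_assoc])⟩
      · exact ⟨k + -l, Or.inr (by rw [_root_.zpow_add, mul_assoc, hcomm, mul_assoc])⟩
      · refine ⟨k + -l, Or.inl ?_⟩
        rw [_root_.zpow_add, mul_assoc, ← mul_assoc h, hcomm, mul_assoc, hh, mul_one]
    | inv x _ hx =>
      obtain ⟨k, rfl | rfl⟩ := hx
      · exact ⟨-k, Or.inl (zpow_neg r k).symm⟩
      · exact ⟨k, Or.inr (by rw [_root_.mul_inv_rev, hinv, ← _root_.zpow_neg, hcomm, neg_neg])⟩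
  · have h1 : r ∈ Subgroup.closure {r, h} := Subgroup.subset_closure (by simp)
    have h2 : h ∈ Subgroup.closure {r, h} := Subgroup.subset_closure (by simp)
    rintro ⟨k, rfl | rfl⟩
    · exact zpow_mem h1 k
    · exact mul_mem (zpow_mem h1 k) h2

lemma zpow_add_mul_of_pow_eq_one {N : ℕ} {Γ : Type*} [Group Γ] {a : Γ} (ha : a ^ N = 1)
    (k j : ℤ) : a ^ (k + N * j) = a ^ k := by
  rw [_root_.zpow_add, _root_.zpow_mul, zpow_natCast, ha, _root_.one_zpow, mul_one]

lemma isCyclicGroup_closure {N : ℕ} (hN : 0 < N) {A : O 3} {s : Equiv.Perm (Fin 3)}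
    (hA : A ^ N = 1) (hs : s ^ N = 1) :
    IsCyclicGroup (Subgroup.closure {(timeMotion 1 (2 * Real.pi / N), A, s)}) (2 * Real.pi / N)
      A s := by
  have hN' : (N : ℝ) ≠ 0 := by exact_mod_cast hN.ne'
  refine ⟨by positivity, fun b A' s' => ?_, fun b A' s' => ?_⟩
  · rw [Subgroup.mem_closure_singleton]
    constructor
    -- two lifts of a shift differ by a multiple of `2π`, that is, of `N` times the generating shift
    · rintro ⟨k, hk⟩
      rw [shift_zpow] at hk
      simp only [Prod.mk.injEq] at hk
      obtain ⟨h1, rfl, rfl⟩ := hk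
      obtain ⟨-, j, hj⟩ := timeMotion_eq_iff.1 h1.symm
      refine ⟨k + N * j, ?_, (zpow_add_mul_of_pow_eq_one hA k j).symm,
        (zpow_add_mul_of_pow_eq_one hs k j).symm⟩
      rw [hj]; push_cast; field_simp
    · rintro ⟨k, rfl, rfl, rfl⟩
      exact ⟨k, shift_zpow _ _ _ _⟩
  · rw [Subgroup.mem_closure_singleton]
    rintro ⟨k, hk⟩
    rw [shift_zpow] at hk
    simp only [Prod.mk.injEq] at hk
    exact absurd (timeMotion_eq_iff.1 hk.1).1 (by decide)

lemma isDihedralGroup_closure {N : ℕ} (hN : 0 < N) {A B : O 3} {s σ : Equiv.Perm (Fin 3)}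
    (hA : A ^ N = 1) (hs : s ^ N = 1) (hB : B * B = 1) (hσ : σ * σ = 1) (hBA : B * A = A⁻¹ * B)
    (hσs : σ * s = s⁻¹ * σ) :
    IsDihedralGroup (Subgroup.closure {(timeMotion 1 (2 * Real.pi / N), A, s),
      (timeMotion (-1) 0, B, σ)}) (2 * Real.pi / N) A s 0 B σ := by
  have hN' : (N : ℝ) ≠ 0 := by exact_mod_cast hN.ne'
  set r : Sym := (timeMotion 1 (2 * Real.pi / N), A, s) with hr
  set h : Sym := (timeMotion (-1) 0, B, σ) with hh
  have hh1 : h * h = 1 := by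
    refine Prod.ext ?_ (Prod.ext hB hσ)
    change timeMotion (-1) 0 * timeMotion (-1) 0 = 1
    rw [timeMotion_mul, ← timeMotion_one_zero]; simp
  have hhr : h * r = r⁻¹ * h := by
    refine Prod.ext ?_ (Prod.ext hBA hσs)
    change timeMotion (-1) 0 * timeMotion 1 _ = (timeMotion 1 _)⁻¹ * timeMotion (-1) 0
    rw [timeMotion_inv, timeMotion_mul, timeMotion_mul]; simp
  refine ⟨by positivity, fun b A' s' => ?_, fun b A' s' => ?_, hB, hσ, hBA, hσs⟩
  · rw [mem_closure_pair_dihedral hh1 hhr]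
    constructor
    · rintro ⟨k, hk | hk⟩
      · rw [hr, shift_zpow] at hk
        simp only [Prod.mk.injEq] at hk
        obtain ⟨h1, rfl, rfl⟩ := hk
        obtain ⟨-, j, hj⟩ := timeMotion_eq_iff.1 h1
        refine ⟨k + N * j, ?_, (zpow_add_mul_of_pow_eq_one hA k j).symm,
          (zpow_add_mul_of_pow_eq_one hs k j).symm⟩
        rw [hj]; push_cast; field_simp
      · rw [hr, hh, reversal_eq] at hk
        simp only [Prod.mk.injEq] at hk
        exact absurd (timeMotion_eq_iff.1 hk.1).1 (by decide)
    · rintro ⟨k, rfl, rfl, rfl⟩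
      exact ⟨k, Or.inl (shift_zpow _ _ _ _).symm⟩
  · rw [mem_closure_pair_dihedral hh1 hhr]
    constructor
    · rintro ⟨k, hk | hk⟩
      · rw [hr, shift_zpow] at hk
        simp only [Prod.mk.injEq] at hk
        exact absurd (timeMotion_eq_iff.1 hk.1).1 (by decide)
      · rw [hr, hh, reversal_eq] at hk
        simp only [Prod.mk.injEq] at hk
        obtain ⟨h1, rfl, rfl⟩ := hk
        obtain ⟨-, j, hj⟩ := timeMotion_eq_iff.1 h1
        refine ⟨k + N * j, ?_, by rw [zpow_add_mul_of_pow_eq_one hA],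
          by rw [zpow_add_mul_of_pow_eq_one hs]⟩
        rw [hj]; push_cast; field_simp; ring
    · rintro ⟨k, rfl, rfl, rfl⟩
      exact ⟨k, Or.inr (reversal_eq _ _ _ _ _ _ _).symm⟩

/-- A dihedral symmetry group has other generators: the reversal may be multiplied by the shift. -/
lemma IsDihedralGroup.mul_reversal {G : Subgroup Sym} {p q : ℝ} {A B : O 3}
    {s σ : Equiv.Perm (Fin 3)} (D : IsDihedralGroup G p A s q B σ) :
    IsDihedralGroup G p A s (p + q) (A * B) (s * σ) := by
  refine ⟨D.pos, D.shifts, fun b A' s' => ?_, ?_, ?_, ?_, ?_⟩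
  · rw [D.reversals]
    constructor
    · rintro ⟨k, rfl, rfl, rfl⟩
      refine ⟨k - 1, by push_cast; ring, ?_, ?_⟩ <;> rw [_root_.zpow_sub_one] <;> group
    · rintro ⟨k, rfl, rfl, rfl⟩
      refine ⟨k + 1, by push_cast; ring, ?_, ?_⟩ <;> rw [_root_.zpow_add_one] <;> group
  · rw [mul_assoc, ← mul_assoc B, D.rho_comm, mul_assoc, D.rho_sq, mul_one, mul_inv_cancel]
  · rw [mul_assoc, ← mul_assoc σ, D.sigma_comm, mul_assoc, D.sigma_sq, mul_one, mul_inv_cancel]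
  · rw [mul_assoc, D.rho_comm]; group
  · rw [mul_assoc, D.sigma_comm]; group

section Generators
variable {G : Subgroup Sym} {p q : ℝ} {A B : O 3} {s σ : Equiv.Perm (Fin 3)}

lemma IsCyclicGroup.shift_mem (C : IsCyclicGroup G p A s) : (timeMotion 1 p, A, s) ∈ G :=
  (C.shifts _ _ _).2 ⟨1, by simp⟩

lemma IsDihedralGroup.shift_mem (D : IsDihedralGroup G p A s q B σ) :
    (timeMotion 1 p, A, s) ∈ G :=
  (D.shifts _ _ _).2 ⟨1, by simp⟩

lemma IsDihedralGroup.reversal_mem (D : IsDihedralGroup G p A s q B σ) :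
    (timeMotion (-1) q, B, σ) ∈ G :=
  (D.reversals _ _ _).2 ⟨0, by simp⟩

lemma IsCyclicGroup.le_of_mem (C : IsCyclicGroup G p A s) {K : Subgroup Sym}
    (h : (timeMotion 1 p, A, s) ∈ K) : G ≤ K := by
  rintro ⟨M, A', s'⟩ hg
  obtain ⟨e, b, rfl⟩ := exists_timeMotion M
  rcases units_cases e with rfl | rfl
  · obtain ⟨k, rfl, rfl, rfl⟩ := (C.shifts _ _ _).1 hg
    rw [← shift_zpow]; exact zpow_mem h k
  · exact absurd hg (C.reversals _ _ _)

lemma IsDihedralGroup.le_of_mem (D : IsDihedralGroup G p A s q B σ) {K : Subgroup Sym}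
    (h : (timeMotion 1 p, A, s) ∈ K) (h' : (timeMotion (-1) q, B, σ) ∈ K) : G ≤ K := by
  rintro ⟨M, A', s'⟩ hg
  obtain ⟨e, b, rfl⟩ := exists_timeMotion M
  rcases units_cases e with rfl | rfl
  · obtain ⟨k, rfl, rfl, rfl⟩ := (D.shifts _ _ _).1 hg
    rw [← shift_zpow]; exact zpow_mem h k
  · obtain ⟨k, rfl, rfl, rfl⟩ := (D.reversals _ _ _).1 hg
    rw [← reversal_eq]; exact mul_mem (zpow_mem h k) h'

/-- The symmetries for which `w` is a rotation vector. -/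
def rotationVectorGroup (w : E) : Subgroup Sym where
  carrier := {g | act (rho g).1 w = ((tau g).1.det * (rho g).1.det) • w}
  one_mem' := by
    change act (1 : O 3).1 w = ((1 : O 2).1.det * (1 : O 3).1.det) • w
    simp
  mul_mem' := by
    intro g h hg hh
    change act (rho g * rho h).1 w = (((tau g).1 * (tau h).1).det * ((rho g).1 * (rho h).1).det) • w
    have hg' : act (rho g).1 w = _ := hg
    have hh' : act (rho h).1 w = _ := hh
    rw [act_coe_mul, hh', act_smul, hg', smul_smul, Matrix.det_mul, Matrix.det_mul]
    congr 1; ring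
  inv_mem' := by
    intro g hg
    have hg' : act (rho g).1 w = _ := hg
    change act ((rho g)⁻¹).1 w = (((tau g)⁻¹).1.det * ((rho g)⁻¹).1.det) • w
    have e1 : ((tau g)⁻¹).1.det = (tau g).1.det := by
      obtain ⟨e, b, h⟩ := exists_timeMotion (tau g)
      rw [h, timeMotion_inv, det_timeMotion, det_timeMotion]
    have e2 : ((rho g)⁻¹).1.det = (rho g).1.det := Matrix.det_transpose (rho g).1
    have e3 : (tau g).1.det * (tau g).1.det = 1 := by
      obtain ⟨e, b, h⟩ := exists_timeMotion (tau g)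
      rw [h, det_timeMotion]
      rcases units_cases e with rfl | rfl <;> simp
    have e4 := det_mul_self (rho g)
    have h1 := act_inv_act (rho g) w
    rw [hg', act_smul] at h1
    rw [e1, e2]
    conv_rhs => rw [← h1]
    rw [smul_smul]
    have : (tau g).1.det * (rho g).1.det * ((tau g).1.det * (rho g).1.det) = 1 := by
      linear_combination (rho g).1.det * (rho g).1.det * e3 + e4
    rw [this, one_smul]

/-- The symmetries that fix a constant configuration. -/
def fixingGroup (x : Fin 3 → E) : Subgroup Sym where
  carrier := {g | ∀ i, x (sigma g i) = act (rho g).1 (x i)}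
  one_mem' := fun i => by
    change x i = act (1 : O 3).1 (x i)
    simp
  mul_mem' := by
    intro g h hg hh i
    change x (sigma g (sigma h i)) = act (rho g * rho h).1 (x i)
    rw [hg, hh, act_coe_mul]
  inv_mem' := by
    intro g hg i
    change x ((sigma g)⁻¹ i) = act ((rho g)⁻¹).1 (x i)
    have := hg ((sigma g)⁻¹ i)
    rw [show sigma g ((sigma g)⁻¹ i) = i from (sigma g).apply_symm_apply i] at this
    rw [this, act_inv_act]

lemma IsCyclicGroup.isRotationVector_iff (C : IsCyclicGroup G p A s) {w : E} :
    IsRotationVector G w ↔ act A.1 w = A.1.det • w := by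
  constructor
  · intro h
    have := h _ C.shift_mem
    rw [det_timeMotion] at this
    simpa using this
  · intro h
    refine fun g hg => C.le_of_mem (K := rotationVectorGroup w) ?_ hg
    change act A.1 w = ((timeMotion 1 p).1.det * A.1.det) • w
    rw [det_timeMotion]; simpa using h

lemma IsDihedralGroup.isRotationVector_iff (D : IsDihedralGroup G p A s q B σ) {w : E} :
    IsRotationVector G w ↔ act A.1 w = A.1.det • w ∧ act B.1 w = (-B.1.det) • w := by
  constructor
  · intro h
    have h1 := h _ D.shift_mem
    have h2 := h _ D.reversal_mem
    rw [det_timeMotion] at h1 h2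
    exact ⟨by simpa using h1, by simpa using h2⟩
  · rintro ⟨h1, h2⟩
    refine fun g hg => D.le_of_mem (K := rotationVectorGroup w) ?_ ?_ hg
    · change act A.1 w = ((timeMotion 1 p).1.det * A.1.det) • w
      rw [det_timeMotion]; simpa using h1
    · change act B.1 w = ((timeMotion (-1) q).1.det * B.1.det) • w
      rw [det_timeMotion]; simpa using h2

end Generators

/-! ### Finite generation of the groups with trivial core -/

/-- The translations of the time line that lift the shifts of the time in `G`. -/
def shiftLattice (G : Subgroup Sym) : AddSubgroup ℝ where
  carrier := {b | ∃ A s, (timeMotion 1 b, A, s) ∈ G}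
  zero_mem' := ⟨1, 1, by rw [timeMotion_one_zero]; exact one_mem G⟩
  add_mem' := by
    rintro a b ⟨A, s, h⟩ ⟨B, t, h'⟩
    refine ⟨A * B, s * t, ?_⟩
    have := mul_mem h h'
    rw [show timeMotion 1 (a + b) = timeMotion 1 a * timeMotion 1 b by rw [timeMotion_mul]; simp]
    exact this
  neg_mem' := by
    rintro a ⟨A, s, h⟩
    refine ⟨A⁻¹, s⁻¹, ?_⟩
    have := inv_mem h
    rw [show timeMotion 1 (-a) = (timeMotion 1 a)⁻¹ by rw [timeMotion_inv]; simp]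
    exact this

/-- If the shifts of the time are dense, the loops move rigidly: their Gram matrix is continuous
and constant on a dense set of times. -/
lemma homographic_of_dense {G : Subgroup Sym} (h : Dense (shiftLattice G : Set ℝ)) :
    Homographic m G := by
  refine homographic_of_gram fun x hx =>
    ⟨fun i j => inner ℝ (x.pos 0 i) (x.pos 0 j), fun t => ⟨1, fun i j => ?_⟩⟩
  -- the sixth power of a symmetry fixes the bodies
  have hs6 : ∀ s : Equiv.Perm (Fin 3), s ^ (6 : ℤ) = 1 := by
    intro s
    have : s ^ Fintype.card (Equiv.Perm (Fin 3)) = 1 := pow_card_eq_one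
    rw [Fintype.card_perm] at this
    exact_mod_cast this
  have hdense : ∀ b ∈ (shiftLattice G : Set ℝ),
      (inner ℝ (x.pos (6 * b) i) (x.pos (6 * b) j) : ℝ) = inner ℝ (x.pos 0 i) (x.pos 0 j) := by
    rintro b ⟨A, s, hg⟩
    have hg6 := zpow_mem hg 6
    rw [shift_zpow, hs6] at hg6
    have h6 : ∀ i, x.pos (6 * b) i = act (A ^ (6 : ℤ)).1 (x.pos 0 i) := by
      intro i
      have := hx.apply hg6 0 i
      simpa using this
    rw [h6, h6, inner_act]
  have hc : Continuous fun b => (inner ℝ (x.pos (6 * b) i) (x.pos (6 * b) j) : ℝ) :=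
    ((x.continuous_pos i).comp (continuous_const.mul continuous_id)).inner
      ((x.continuous_pos j).comp (continuous_const.mul continuous_id))
  have := congrFun (hc.ext_on h continuous_const hdense) (t / 6)
  rw [show 6 * (t / 6) = t by ring] at this
  rw [one_pow, one_mul, this]

/-- A group with trivial core that is not homographic is cyclic or dihedral. -/
lemma isCyclicGroup_or_isDihedralGroup {G : Subgroup Sym} (hhom : ¬ Homographic m G)
    (hcore : core G = ⊥) :
    (∃ p A s, IsCyclicGroup G p A s) ∨ ∃ p A s q B σ, IsDihedralGroup G p A s q B σ := by
  have hone : ∀ g ∈ G, tau g = 1 → g = 1 := by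
    intro g hg ht
    have : g ∈ core G := ⟨hg, ht⟩
    rwa [hcore, Subgroup.mem_bot] at this
  obtain ⟨p, hp, hT⟩ : ∃ p : ℝ, 0 < p ∧ shiftLattice G = AddSubgroup.zmultiples p := by
    rcases AddSubgroup.dense_or_cyclic (shiftLattice G) with h | ⟨a, ha⟩
    · exact absurd (homographic_of_dense h) hhom
    · rw [← AddSubgroup.zmultiples_eq_closure] at ha
      have h2 : 2 * Real.pi ∈ shiftLattice G := by
        refine ⟨1, 1, ?_⟩
        rw [show timeMotion 1 (2 * Real.pi) = 1 by
          rw [← timeMotion_one_zero, timeMotion_eq_iff]; exact ⟨rfl, 1, by simp⟩]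
        exact one_mem G
      have ha0 : a ≠ 0 := by
        rintro rfl
        rw [ha, AddSubgroup.mem_zmultiples_iff] at h2
        obtain ⟨k, hk⟩ := h2
        rw [smul_zero] at hk
        exact Real.two_pi_pos.ne hk
      rcases lt_or_gt_of_ne ha0 with h | h
      · exact ⟨-a, by linarith, by rw [ha, AddSubgroup.zmultiples_neg]⟩
      · exact ⟨a, h, ha⟩
  obtain ⟨A, s, hr⟩ : p ∈ shiftLattice G := by
    rw [hT]; exact AddSubgroup.mem_zmultiples p
  have hshift : ShiftsGeneratedBy G p A s := by
    intro b A' s'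
    constructor
    · intro hg
      have hb : b ∈ shiftLattice G := ⟨A', s', hg⟩
      rw [hT, AddSubgroup.mem_zmultiples_iff] at hb
      obtain ⟨k, rfl⟩ := hb
      have h1 := zpow_mem hr k
      rw [shift_zpow] at h1
      have h2 := hone _ (mul_mem hg (inv_mem h1)) (by
        change timeMotion 1 (k • p) * (timeMotion 1 (k * p))⁻¹ = 1
        rw [zsmul_eq_mul, mul_inv_cancel])
      have h3 := mul_inv_eq_one.1 h2
      simp only [Prod.mk.injEq] at h3
      exact ⟨k, by simp, h3.2⟩
    · rintro ⟨k, rfl, rfl, rfl⟩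
      rw [← shift_zpow]; exact zpow_mem hr k
  by_cases hrev : ∃ q B σ, (timeMotion (-1) q, B, σ) ∈ G
  · right
    obtain ⟨q, B, σ, hh⟩ := hrev
    have hh2 := hone _ (mul_mem hh hh) (by
      change timeMotion (-1) q * timeMotion (-1) q = 1
      rw [timeMotion_mul, ← timeMotion_one_zero]; simp)
    have hcomm := hone _ (mul_mem (mul_mem hh hr) (inv_mem (mul_mem (inv_mem hr) hh))) (by
      change timeMotion (-1) q * timeMotion 1 p * ((timeMotion 1 p)⁻¹ * timeMotion (-1) q)⁻¹ = 1
      rw [mul_inv_eq_one, timeMotion_inv, timeMotion_mul, timeMotion_mul]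
      simp [add_comm])
    have hcomm' := mul_inv_eq_one.1 hcomm
    refine ⟨p, A, s, q, B, σ, hp, hshift, fun b A' s' => ?_, congrArg rho hh2,
      congrArg sigma hh2, congrArg rho hcomm', congrArg sigma hcomm'⟩
    constructor
    · intro hg
      have h1 := mul_mem hg hh
      have h2 : (timeMotion (-1) b, A', s') * (timeMotion (-1) q, B, σ) =
          ((timeMotion 1 (b - q), A' * B, s' * σ) : Sym) := by
        refine Prod.ext ?_ rfl
        change timeMotion (-1) b * timeMotion (-1) q = timeMotion 1 (b - q)
        rw [timeMotion_mul]; simp [sub_eq_add_neg]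
      rw [h2, hshift] at h1
      obtain ⟨k, hk, hA, hs⟩ := h1
      have hB : B * B = 1 := congrArg rho hh2
      have hσ : σ * σ = 1 := congrArg sigma hh2
      refine ⟨k, by linarith, ?_, ?_⟩
      · rw [← hA, mul_assoc, hB, mul_one]
      · rw [← hs, mul_assoc, hσ, mul_one]
    · rintro ⟨k, rfl, rfl, rfl⟩
      rw [← reversal_eq]; exact mul_mem (zpow_mem hr k) hh
  · left
    push Not at hrev
    exact ⟨p, A, s, hp, hshift, hrev⟩

/-! ### Changes of rotating frame between cyclic or dihedral groups -/

lemma mem_map_conj_inv {Γ : Type*} [Group Γ] {H : Subgroup Γ} {g x : Γ} :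
    x ∈ H.map (MulAut.conj g⁻¹).toMonoidHom ↔ g * x * g⁻¹ ∈ H := by
  constructor
  · rintro ⟨y, hy, rfl⟩
    have : g * (MulAut.conj g⁻¹).toMonoidHom y * g⁻¹ = y := by
      simp [mul_assoc]
    rw [this]; exact hy
  · intro h
    exact ⟨_, h, by simp [mul_assoc]⟩

/-- The image of a symmetry group under the inverse of a conjugation in
`O(𝕋) × O(3) × Σ₃`, whose time component is a rotation. -/
noncomputable def conjGroup (H : Subgroup Sym) (f : ℝ) (Q : O 3) (π : Equiv.Perm (Fin 3)) :
    Subgroup Sym :=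
  H.map (MulAut.conj ((timeMotion 1 f, Q, π) : Sym)⁻¹).toMonoidHom

lemma conjugate_conjGroup (H : Subgroup Sym) (f : ℝ) (Q : O 3) (π : Equiv.Perm (Fin 3)) :
    Conjugate (conjGroup H f Q π) H := by
  refine ⟨(timeMotion 1 f, Q, π), ?_⟩
  rw [conjGroup, Subgroup.map_map]
  convert Subgroup.map_id H using 2
  ext1 x
  change _ * (_⁻¹ * x * _⁻¹⁻¹) * _⁻¹ = x
  group

lemma mem_conjGroup {H : Subgroup Sym} {f : ℝ} {Q : O 3} {π : Equiv.Perm (Fin 3)} {e : ℤˣ} {b : ℝ}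
    {A : O 3} {s : Equiv.Perm (Fin 3)} :
    (timeMotion e b, A, s) ∈ conjGroup H f Q π ↔
      (timeMotion e (b + f - ((e : ℤ) : ℝ) * f), Q * A * Q⁻¹, π * s * π⁻¹) ∈ H := by
  have key : ((timeMotion 1 f, Q, π) : Sym) * (timeMotion e b, A, s) * (timeMotion 1 f, Q, π)⁻¹ =
      (timeMotion e (b + f - ((e : ℤ) : ℝ) * f), Q * A * Q⁻¹, π * s * π⁻¹) := by
    refine Prod.ext ?_ rfl
    change timeMotion 1 f * timeMotion e b * (timeMotion 1 f)⁻¹ = _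
    rw [timeMotion_inv, timeMotion_mul, timeMotion_mul]
    congr 1
    · simp
    · simp; ring
  rw [← key]
  exact mem_map_conj_inv

lemma conj_eq_zpow_iff {Γ : Type*} [Group Γ] {Q X A : Γ} {k : ℤ} :
    Q * X * Q⁻¹ = (Q * A * Q⁻¹) ^ k ↔ X = A ^ k := by
  rw [conj_zpow, mul_left_inj, mul_right_inj]

lemma conj_eq_zpow_mul_iff {Γ : Type*} [Group Γ] {Q X A B : Γ} {k : ℤ} :
    Q * X * Q⁻¹ = (Q * A * Q⁻¹) ^ k * (Q * B * Q⁻¹) ↔ X = A ^ k * B := by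
  rw [conj_zpow, show Q * A ^ k * Q⁻¹ * (Q * B * Q⁻¹) = Q * (A ^ k * B) * Q⁻¹ by group,
    mul_left_inj, mul_right_inj]

lemma eq_expO_mul {w : E} {b : ℝ} {A A' : O 3}
    (h : A'.1 = NormedSpace.exp (b • Omega w) * A.1) : A' = expO w b * A :=
  Subtype.ext h

section Criterion
variable {G : Subgroup Sym} {p q : ℝ} {A B : O 3} {s σ : Equiv.Perm (Fin 3)}

/-- The change of rotating frame along `w` that carries the generating shift of `G` to a conjugate
of that of `H` carries all the shifts. The generator `A` commutes with the rotations around `w`, so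
that powers are carried to powers. -/
lemma shift_iff {H : Subgroup Sym} {p' f : ℝ} {w : E} {Q : O 3} {π : Equiv.Perm (Fin 3)}
    (hp : p ≠ 0) (hp' : p' ≠ 0) (hw : act A.1 w = A.1.det • w)
    (hG : ShiftsGeneratedBy G p A s)
    (hH : ShiftsGeneratedBy H p' (Q * (expO w p * A) * Q⁻¹) (π * s * π⁻¹))
    (b : ℝ) (X : O 3) (x : Equiv.Perm (Fin 3)) :
    (timeMotion 1 b, X, x) ∈ G ↔
      (timeMotion 1 (p' / p * b), expO w b * X, x) ∈ conjGroup H f Q π := by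
  rw [hG, mem_conjGroup, hH]
  refine exists_congr fun k => ?_
  have h1 : p' / p * b + f - (((1 : ℤˣ) : ℤ) : ℝ) * f = k * p' ↔ b = k * p := by
    simp only [Units.val_one, Int.cast_one, one_mul, add_sub_cancel_right]
    constructor
    · intro h; field_simp at h; linarith
    · rintro rfl; field_simp
  rw [h1, conj_eq_zpow_iff, conj_eq_zpow_iff]
  refine and_congr_right fun hb => and_congr_left fun _ => ?_
  rw [hb, expO_zsmul, (commute_expO hw p).symm.mul_zpow, mul_right_inj]

/-- Criterion for the equivalence of a cyclic group with a standard one. -/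
lemma IsCyclicGroup.equivalent (C : IsCyclicGroup G p A s) {w : E}
    (hw : act A.1 w = A.1.det • w) {N : ℕ} (hN : 0 < N) {Q A₀ : O 3}
    {π s₀ : Equiv.Perm (Fin 3)} (hA : Q * (expO w p * A) * Q⁻¹ = A₀) (hs : π * s * π⁻¹ = s₀)
    (hA₀ : A₀ ^ N = 1) (hs₀ : s₀ ^ N = 1) :
    Equivalent G (Subgroup.closure {(timeMotion 1 (2 * Real.pi / N), A₀, s₀)}) := by
  have H := isCyclicGroup_closure hN hA₀ hs₀
  subst hA hs
  refine ⟨w, C.isRotationVector_iff.2 hw, _, div_pos H.pos C.pos, conjGroup _ 0 Q π, ?_,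
    conjugate_conjGroup _ _ _ _⟩
  intro e b X X' x hX
  rw [eq_expO_mul hX]
  rcases units_cases e with rfl | rfl
  · exact shift_iff C.pos.ne' H.pos.ne' hw C.shifts H.shifts b X x
  · rw [mem_conjGroup]
    exact iff_of_false (C.reversals _ _ _) (H.reversals _ _ _)

/-- Criterion for the equivalence of a dihedral group with a standard one. -/
lemma IsDihedralGroup.equivalent (D : IsDihedralGroup G p A s q B σ) {w : E}
    (hw : act A.1 w = A.1.det • w) (hw' : act B.1 w = (-B.1.det) • w) {N : ℕ} (hN : 0 < N)
    {Q A₀ B₀ : O 3} {π s₀ σ₀ : Equiv.Perm (Fin 3)}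
    (hA : Q * (expO w p * A) * Q⁻¹ = A₀) (hs : π * s * π⁻¹ = s₀)
    (hB : Q * (expO w q * B) * Q⁻¹ = B₀) (hσ : π * σ * π⁻¹ = σ₀)
    (hA₀ : A₀ ^ N = 1) (hs₀ : s₀ ^ N = 1) (hBB : B₀ * B₀ = 1) (hBA : B₀ * A₀ = A₀⁻¹ * B₀) :
    Equivalent G (Subgroup.closure
      {(timeMotion 1 (2 * Real.pi / N), A₀, s₀), (timeMotion (-1) 0, B₀, σ₀)}) := by
  have hσσ : σ₀ * σ₀ = 1 := by
    rw [← hσ, show π * σ * π⁻¹ * (π * σ * π⁻¹) = π * (σ * σ) * π⁻¹ by group, D.sigma_sq]; group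
  have hσs : σ₀ * s₀ = s₀⁻¹ * σ₀ := by
    rw [← hσ, ← hs, show π * σ * π⁻¹ * (π * s * π⁻¹) = π * (σ * s) * π⁻¹ by group, D.sigma_comm]
    group
  have H := isDihedralGroup_closure hN hA₀ hs₀ hBB hσσ hBA hσs
  subst hA hs hB hσ
  set p' : ℝ := 2 * Real.pi / N with hp'
  -- the time rotation moves the axis of the reversal to `0`
  refine ⟨w, D.isRotationVector_iff.2 ⟨hw, hw'⟩, p' / p, div_pos H.pos D.pos,
    conjGroup _ (-(p' / p * q) / 2) Q π, ?_, conjugate_conjGroup _ _ _ _⟩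
  intro e b X X' x hX
  rw [eq_expO_mul hX]
  rcases units_cases e with rfl | rfl
  · exact shift_iff D.pos.ne' H.pos.ne' hw D.shifts H.shifts b X x
  · have hp := D.pos.ne'
    have hp0 := H.pos.ne'
    rw [D.reversals, mem_conjGroup, H.reversals]
    refine exists_congr fun k => ?_
    have h1 : p' / p * b + -(p' / p * q) / 2 - (((-1 : ℤˣ) : ℤ) : ℝ) * (-(p' / p * q) / 2) =
        k * p' + 0 ↔ b = k * p + q := by
      have e1 : p' / p * b + -(p' / p * q) / 2 - (((-1 : ℤˣ) : ℤ) : ℝ) * (-(p' / p * q) / 2) =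
          p' * ((b - q) / p) := by
        push_cast; field_simp; ring
      rw [e1, add_zero, mul_comm, mul_left_inj' hp0, div_eq_iff hp, sub_eq_iff_eq_add]
    rw [h1, conj_eq_zpow_mul_iff, conj_eq_zpow_mul_iff]
    refine and_congr_right fun hb => and_congr_left fun _ => ?_
    have hc := commute_expO hw p
    have hc' : Commute (A ^ k) (expO w q) := (commute_expO hw q).zpow_left k
    rw [hb, expO_add, expO_zsmul, hc.symm.mul_zpow]
    constructor
    · rintro rfl
      rw [mul_assoc, ← mul_assoc (expO w q), ← hc'.eq]; group
    · intro h
      have h2 : expO w p ^ k * expO w q * X = expO w p ^ k * expO w q * (A ^ k * B) := by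
        rw [h, mul_assoc, mul_assoc, ← mul_assoc (expO w q) (A ^ k), ← hc'.eq, mul_assoc]
      exact mul_left_cancel h2

/-! ### Diagonal frames -/

lemma coe_units_mul_self (e : ℤˣ) : ((e : ℤ) : ℝ) * ((e : ℤ) : ℝ) = 1 := by
  rcases units_cases e with rfl | rfl <;> simp

lemma exists_det_eq (A : O 3) : ∃ e : ℤˣ, A.1.det = ((e : ℤ) : ℝ) := by
  rcases det_eq_one_or A with h | h
  · exact ⟨1, by simp [h]⟩
  · exact ⟨-1, by simp [h]⟩

lemma signs_mul {n : ℕ} (a b : Fin n → ℤˣ) : signs a * signs b = signs (a * b) := by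
  apply Subtype.ext
  change Matrix.diagonal _ * Matrix.diagonal _ = Matrix.diagonal _
  rw [Matrix.diagonal_mul_diagonal]
  congr 1; funext i; simp

lemma signs_one {n : ℕ} : signs (1 : Fin n → ℤˣ) = 1 := by
  apply Subtype.ext
  change Matrix.diagonal _ = 1
  simp

lemma signs_pow {n : ℕ} (a : Fin n → ℤˣ) (N : ℕ) : signs a ^ N = signs (a ^ N) := by
  induction N with
  | zero => rw [pow_zero, pow_zero, signs_one]
  | succ N ih => rw [pow_succ, pow_succ, ih, signs_mul]

lemma units_sq (e : ℤˣ) : e * e = 1 := by rcases units_cases e with rfl | rfl <;> rfl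

lemma signs_mul_self {n : ℕ} (a : Fin n → ℤˣ) : signs a * signs a = 1 := by
  rw [signs_mul, ← signs_one]; congr 1; funext i; exact units_sq (a i)

lemma signs_comm {n : ℕ} (a b : Fin n → ℤˣ) :
    signs b * signs a = (signs a)⁻¹ * signs b := by
  rw [inv_eq_of_mul_eq_one_left (signs_mul_self a), signs_mul, signs_mul, mul_comm]

/-- A dihedral group whose generators are diagonal in an orthonormal basis is equivalent to a
standard one, without rotation of the frame. -/
lemma IsDihedralGroup.equivalent_of_eigen (D : IsDihedralGroup G p A s q B σ) {N : ℕ} (hN : 0 < N)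
    (b : OrthonormalBasis (Fin 3) ℝ E) {a c : Fin 3 → ℤˣ}
    (hA : ∀ i, act A.1 (b i) = ((a i : ℤ) : ℝ) • b i)
    (hB : ∀ i, act B.1 (b i) = ((c i : ℤ) : ℝ) • b i)
    {π s₀ σ₀ : Equiv.Perm (Fin 3)} (hs : π * s * π⁻¹ = s₀) (hσ : π * σ * π⁻¹ = σ₀)
    (ha : a ^ N = 1) (hs₀ : s₀ ^ N = 1) :
    Equivalent G (Subgroup.closure
      {(timeMotion 1 (2 * Real.pi / N), signs a, s₀), (timeMotion (-1) 0, signs c, σ₀)}) := by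
  have h0 : ∀ t, expO 0 t = 1 := fun t => by
    apply Subtype.ext
    change NormedSpace.exp _ = 1
    rw [Omega_zero, smul_zero, NormedSpace.exp_zero]
  refine D.equivalent (w := 0) (by simp) (by simp) hN (Q := frame b) ?_ hs ?_ hσ ?_ hs₀
    (signs_mul_self _) (signs_comm _ _)
  · rw [h0, one_mul]; exact conj_frame_eq_signs b hA
  · rw [h0, one_mul]; exact conj_frame_eq_signs b hB
  · rw [signs_pow, ha, signs_one]

/-- A cyclic group in the rotating frame where its generator acts trivially on the plane
orthogonal to the axis. -/
lemma IsCyclicGroup.equivalent_of_axis (C : IsCyclicGroup G p A s) {u : E} (hu : ‖u‖ = 1)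
    (hAu : act A.1 u = A.1.det • u) {e : ℤˣ} (he : A.1.det = ((e : ℤ) : ℝ)) {N : ℕ} (hN : 0 < N)
    {π s₀ : Equiv.Perm (Fin 3)} (hs : π * s * π⁻¹ = s₀) (heN : e ^ N = 1) (hs₀ : s₀ ^ N = 1) :
    Equivalent G (Subgroup.closure {genR N 1 1 s₀ e}) := by
  obtain ⟨t, ht⟩ := exists_expO_mul_eq hu hAu
  obtain ⟨b, hb⟩ := exists_basis_of_unit hu
  have hw : act A.1 ((t / p) • u) = A.1.det • ((t / p) • u) := by
    rw [act_smul, hAu, smul_comm]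
  have hexp : expO ((t / p) • u) p = expO u t := by
    rw [expO_smul, mul_div_cancel₀ _ C.pos.ne']
  have hb0 : ∀ i : Fin 3, i ≠ 2 → act (expO u t * A).1 (b i) = b i := fun i hi =>
    ht _ (by rw [← hb, inner_basis, if_neg (Ne.symm hi)])
  refine C.equivalent hw hN (Q := frame b) (A₀ := signs ![1, 1, e]) ?_ hs ?_ hs₀
  · rw [hexp]
    refine conj_frame_eq_signs b fun i => ?_
    fin_cases i
    · simpa using hb0 0 (by decide)
    · simpa using hb0 1 (by decide)
    · have : act (expO u t * A).1 (b 2) = ((e : ℤ) : ℝ) • b 2 := by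
        rw [act_coe_mul, hb, hAu, act_smul, act_expO_self, he]
      simpa using this
  · rw [signs_pow, ← signs_one]
    congr 1; funext i; fin_cases i <;> simp [heN]

/-- A dihedral group with a rotation axis, in the rotating frame where the generator of its shifts
acts trivially on the plane orthogonal to the axis. -/
lemma IsDihedralGroup.equivalent_of_axis (D : IsDihedralGroup G p A s q B σ) {u : E} (hu : ‖u‖ = 1)
    (hAu : act A.1 u = A.1.det • u) (hBu : act B.1 u = (-B.1.det) • u) {e d : ℤˣ}
    (he : A.1.det = ((e : ℤ) : ℝ)) (hd : B.1.det = -((d : ℤ) : ℝ)) {N : ℕ} (hN : 0 < N)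
    {π s₀ σ₀ : Equiv.Perm (Fin 3)} (hs : π * s * π⁻¹ = s₀) (hσ : π * σ * π⁻¹ = σ₀)
    (heN : e ^ N = 1) (hs₀ : s₀ ^ N = 1) :
    Equivalent G (Subgroup.closure {genR N 1 1 s₀ e, genH 1 (-1) σ₀ d}) := by
  obtain ⟨t, ht⟩ := exists_expO_mul_eq hu hAu
  set w := (t / p) • u with hwdef
  have hw : act A.1 w = A.1.det • w := by
    rw [hwdef, act_smul, hAu, smul_comm]
  have hw' : act B.1 w = (-B.1.det) • w := by
    rw [hwdef, act_smul, hBu, smul_comm]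
  have hexp : expO w p = expO u t := by
    rw [hwdef, expO_smul, mul_div_cancel₀ _ D.pos.ne']
  have hwu : ∀ b, act (expO w b).1 u = u := fun b => by
    rw [hwdef, expO_smul, act_expO_self]
  have hdet : (expO w q * B).1.det = B.1.det := by
    change ((expO w q).1 * B.1).det = _
    rw [Matrix.det_mul, det_expO, one_mul]
  have hsq : (expO w q * B) * (expO w q * B) = 1 := by
    rw [mul_assoc, ← mul_assoc B, mul_expO hw', expO_neg, mul_assoc, D.rho_sq, mul_one,
      mul_inv_cancel]
  have hB1 : act (expO w q * B).1 u = (-(expO w q * B).1.det) • u := by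
    rw [hdet, act_coe_mul, hBu, act_smul, hwu]
  obtain ⟨b, hb, hb0, hb1⟩ := exists_basis_of_reflection hu hsq hB1
  have hA1 : ∀ i : Fin 3, i ≠ 2 → act (expO u t * A).1 (b i) = b i := fun i hi =>
    ht _ (by rw [← hb, inner_basis, if_neg (Ne.symm hi)])
  refine D.equivalent hw hw' hN (Q := frame b) (A₀ := signs ![1, 1, e]) (B₀ := signs ![1, -1, d])
    ?_ hs ?_ hσ ?_ hs₀ (signs_mul_self _) (signs_comm _ _)
  · rw [hexp]
    refine conj_frame_eq_signs b fun i => ?_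
    fin_cases i
    · simpa using hA1 0 (by decide)
    · simpa using hA1 1 (by decide)
    · have : act (expO u t * A).1 (b 2) = ((e : ℤ) : ℝ) • b 2 := by
        rw [act_coe_mul, hb, hAu, act_smul, act_expO_self, he]
      simpa using this
  · refine conj_frame_eq_signs b fun i => ?_
    fin_cases i
    · simpa using hb0
    · simpa using hb1
    · have : act (expO w q * B).1 (b 2) = ((d : ℤ) : ℝ) • b 2 := by
        rw [hb, hB1, hdet, hd, neg_neg]
      simpa using this
  · rw [signs_pow, ← signs_one]
    congr 1; funext i; fin_cases i <;> simp [heN]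

end Criterion

/-! ### Fixed configurations on a line -/

/-- There is a nonzero centred configuration on a line, which `s` and `σ` multiply by the signs `e`
and `d`. -/
def HasLineConfig (m : Fin 3 → ℝ) (s σ : Equiv.Perm (Fin 3)) (e d : ℤˣ) : Prop :=
  ∃ a : Fin 3 → ℝ, (∃ k, a k ≠ 0) ∧ ∑ i, m i * a i = 0 ∧
    ∀ i, a (s i) = ((e : ℤ) : ℝ) * a i ∧ a (σ i) = ((d : ℤ) : ℝ) * a i

lemma HasLineConfig.of_conj {s σ π : Equiv.Perm (Fin 3)} {e d : ℤˣ}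
    (h : HasLineConfig (fun i => m (π⁻¹ i)) (π * s * π⁻¹) (π * σ * π⁻¹) e d) :
    HasLineConfig m s σ e d := by
  obtain ⟨a, ⟨k, hk⟩, hsum, ha⟩ := h
  refine ⟨fun i => a (π i), ⟨π⁻¹ k, by simpa using hk⟩, ?_, fun i => ?_⟩
  · rw [← hsum, ← Equiv.sum_comp π (fun i => m (π⁻¹ i) * a i)]
    simp
  · simpa using ha (π i)

/-- The first two bodies at the same point, balanced by the third one. -/
lemma hasLineConfig_symmetric (hm : ∀ i, 0 < m i) {s σ : Equiv.Perm (Fin 3)}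
    (hs : s = 1 ∨ s = swap12) (hσ : σ = 1 ∨ σ = swap12) : HasLineConfig m s σ 1 1 := by
  refine ⟨![m 2, m 2, -(m 0 + m 1)], ⟨0, (hm 2).ne'⟩, ?_, fun i => ⟨?_, ?_⟩⟩
  · rw [Fin.sum_univ_three]; simp; ring
  · rcases hs with rfl | rfl <;> fin_cases i <;> simp [swap12, Equiv.swap_apply_def]
  · rcases hσ with rfl | rfl <;> fin_cases i <;> simp [swap12, Equiv.swap_apply_def]

/-- The first two bodies at opposite points and the third one at the origin: the masses of the
exchanged bodies are equal, so that this configuration is centred. -/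
lemma hasLineConfig_antisymmetric {s σ : Equiv.Perm (Fin 3)} (hms : ∀ i, m (s i) = m i)
    (hmσ : ∀ i, m (σ i) = m i) (hne : s ≠ 1 ∨ σ ≠ 1)
    (hs : s = 1 ∨ s = swap12) (hσ : σ = 1 ∨ σ = swap12) :
    HasLineConfig m s σ (Equiv.Perm.sign s) (Equiv.Perm.sign σ) := by
  have h01 : m 1 = m 0 := by
    rcases hs with rfl | rfl
    · rcases hσ with rfl | rfl
      · simp at hne
      · simpa [swap12] using hmσ 0
    · simpa [swap12] using hms 0
  have key : ∀ τ : Equiv.Perm (Fin 3), τ = 1 ∨ τ = swap12 → ∀ i,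
      (![1, -1, 0] : Fin 3 → ℝ) (τ i) =
        ((Equiv.Perm.sign τ : ℤ) : ℝ) * (![1, -1, 0] : Fin 3 → ℝ) i := by
    intro τ hτ i
    rcases hτ with rfl | rfl
    · simp
    · rw [swap12, Equiv.Perm.sign_swap (by decide)]
      fin_cases i <;> simp [Equiv.swap_apply_def]
  refine ⟨![1, -1, 0], ⟨0, by simp⟩, ?_, fun i => ⟨key s hs i, key σ hσ i⟩⟩
  rw [Fin.sum_univ_three]; simp [h01]

section
variable {G : Subgroup Sym} {p q : ℝ} {A B : O 3} {s σ : Equiv.Perm (Fin 3)}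

lemma sum_smul_smul {a : Fin 3 → ℝ} (h : ∑ i, m i * a i = 0) (v : E) :
    ∑ i, m i • a i • v = 0 := by
  simp only [smul_smul, ← Finset.sum_smul, h, zero_smul]

/-- A cyclic group that multiplies some configuration on a line by the determinant of its generator
is fully uncoercive: the configuration is put on the rotation axis. -/
lemma IsCyclicGroup.fullyUncoercive {α : ℝ} (hα : 0 < α) (hcoll : ¬ BoundToCollisions m G)
    (C : IsCyclicGroup G p A s) {e : ℤˣ} (he : A.1.det = ((e : ℤ) : ℝ))
    (h : HasLineConfig m s 1 e 1) : FullyUncoercive m α G := by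
  obtain ⟨a, ⟨k, hk⟩, hsum, ha⟩ := h
  refine fullyUncoercive_of_fixed hα hcoll fun w hw => ?_
  have hw' := C.isRotationVector_iff.1 hw
  obtain ⟨v, hv0, hv, hwv⟩ : ∃ v : E, v ≠ 0 ∧ act A.1 v = A.1.det • v ∧ act (Omega w) v = 0 := by
    by_cases hw0 : w = 0
    · obtain ⟨u, hu, hAu⟩ := exists_axis A
      exact ⟨u, fun h => by simp [h] at hu, hAu, by simp [hw0, act]⟩
    · exact ⟨w, hw0, hw', act_Omega_self w⟩
  refine ⟨fun i => a i • v, sum_smul_smul hsum v, fun g hg => ?_, fun i => by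
    rw [act_smul, hwv, smul_zero], k, smul_ne_zero hk hv0⟩
  refine C.le_of_mem (K := fixingGroup fun i => a i • v) ?_ hg
  intro i
  change a (s i) • v = act A.1 (a i • v)
  rw [act_smul, hv, (ha i).1, he]; module

/-- A dihedral group is fully uncoercive if it fixes some configuration on a line of eigenvectors
that is at rest in the rotating frame. -/
lemma IsDihedralGroup.fullyUncoercive {α : ℝ} (hα : 0 < α) (hcoll : ¬ BoundToCollisions m G)
    (D : IsDihedralGroup G p A s q B σ) {e d : ℤˣ} (h : HasLineConfig m s σ e d)
    (hv : ∀ w, IsRotationVector G w → ∃ v : E, v ≠ 0 ∧ act A.1 v = ((e : ℤ) : ℝ) • v ∧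
      act B.1 v = ((d : ℤ) : ℝ) • v ∧ act (Omega w) v = 0) : FullyUncoercive m α G := by
  obtain ⟨a, ⟨k, hk⟩, hsum, ha⟩ := h
  refine fullyUncoercive_of_fixed hα hcoll fun w hw => ?_
  obtain ⟨v, hv0, hAv, hBv, hwv⟩ := hv w hw
  refine ⟨fun i => a i • v, sum_smul_smul hsum v, fun g hg => ?_, fun i => by
    rw [act_smul, hwv, smul_zero], k, smul_ne_zero hk hv0⟩
  refine D.le_of_mem (K := fixingGroup fun i => a i • v) (fun i => ?_) (fun i => ?_) hg
  · change a (s i) • v = act A.1 (a i • v)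
    rw [act_smul, hAv, (ha i).1]; module
  · change a (σ i) • v = act B.1 (a i • v)
    rw [act_smul, hBv, (ha i).2]; module

/-! ### Collisions at the times fixed by a reversal -/

/-- At the time fixed by the reversal, the configuration is symmetric. -/
lemma IsDihedralGroup.apply_half (D : IsDihedralGroup G p A s q B σ) {x : Loop m}
    (hx : x.Equivariant G) (i : Fin 3) : x.pos (q / 2) (σ i) = act B.1 (x.pos (q / 2) i) := by
  have := hx.apply D.reversal_mem (q / 2) i
  rw [← this]
  congr 1
  push_cast
  ring

/-- A reversal acting trivially on space makes the bodies that it exchanges collide. -/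
lemma IsDihedralGroup.sigma_eq_one_of_rho_eq_one (D : IsDihedralGroup G p A s q B σ)
    (hcoll : ¬ BoundToCollisions m G) (hB : ∀ x, act B.1 x = x) : σ = 1 := by
  by_contra hσ
  obtain ⟨y, hy, hyc⟩ := exists_collisionless hcoll
  obtain ⟨i, hi⟩ : ∃ i, σ i ≠ i := by
    by_contra hc
    push Not at hc
    exact hσ (Equiv.ext hc)
  exact hyc _ _ _ hi (by rw [D.apply_half hy, hB])

/-- A reversal acting as `-1` on space and fixing all the bodies puts them at the origin. -/
lemma IsDihedralGroup.sigma_ne_one_of_rho_eq_neg (D : IsDihedralGroup G p A s q B σ)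
    (hcoll : ¬ BoundToCollisions m G) (hB : ∀ x, act B.1 x = -x) : σ ≠ 1 := by
  rintro rfl
  obtain ⟨y, hy, hyc⟩ := exists_collisionless hcoll
  have h0 : ∀ i, y.pos (q / 2) i = 0 := by
    intro i
    have := D.apply_half hy i
    rw [hB] at this
    have h2 : (2 : ℝ) • y.pos (q / 2) i = 0 := by
      rw [two_smul, add_eq_zero_iff_eq_neg]; exact this
    exact (smul_eq_zero.1 h2).resolve_left two_ne_zero
  exact hyc (q / 2) 0 1 (by decide) (by rw [h0, h0])

/-! ### Permutations up to conjugation -/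

lemma perm_cyclic_cases : ∀ s : Equiv.Perm (Fin 3), ∃ π : Equiv.Perm (Fin 3),
    π * s * π⁻¹ = 1 ∨ π * s * π⁻¹ = swap12 ∨ π * s * π⁻¹ = cyc123 := by decide

/-- A pair of permutations with the dihedral relations is conjugate to a pair in the group generated
by a transposition, or to the standard pair. -/
lemma perm_dihedral_cases : ∀ s σ : Equiv.Perm (Fin 3), σ * σ = 1 → σ * s = s⁻¹ * σ →
    ∃ π : Equiv.Perm (Fin 3), (π * s * π⁻¹ = 1 ∨ π * s * π⁻¹ = swap12) ∧
      (π * σ * π⁻¹ = 1 ∨ π * σ * π⁻¹ = swap12) ∨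
      π * s * π⁻¹ = cyc123 ∧ π * σ * π⁻¹ = swap12 := by decide

lemma conj_mul_conj {Γ : Type*} [Group Γ] (π s σ : Γ) :
    π * (s * σ) * π⁻¹ = π * s * π⁻¹ * (π * σ * π⁻¹) := by group

lemma swap12_mul_self : swap12 * swap12 = 1 := by decide

/-- The reversal of the other class of a dihedral permutation group is also standard, up to
conjugation. -/
lemma exists_conj_cycle {s σ π : Equiv.Perm (Fin 3)} (hs : π * s * π⁻¹ = cyc123)
    (hσ : π * σ * π⁻¹ = swap12) : ∃ π' : Equiv.Perm (Fin 3),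
      π' * s * π'⁻¹ = cyc123 ∧ π' * (s * σ) * π'⁻¹ = swap12 := by
  have key : ∃ k : Equiv.Perm (Fin 3), k * cyc123 * k⁻¹ = cyc123 ∧
      k * (cyc123 * swap12) * k⁻¹ = swap12 := by decide
  obtain ⟨k, h1, h2⟩ := key
  refine ⟨k * π, ?_, ?_⟩
  · rw [← h1, ← hs]; group
  · rw [← h2, ← hs, ← hσ]; group

/-! ### The groups with trivial core -/

lemma mass_conj {π : Equiv.Perm (Fin 3)} (h : ∀ i, m (s i) = m i) (i : Fin 3) :
    m (π⁻¹ ((π * s * π⁻¹) i)) = m (π⁻¹ i) := by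
  simpa using h (π⁻¹ i)

/-- Cyclic groups: the axis of the generator is a rotation axis. -/
lemma IsCyclicGroup.exists_equivalent (hm : ∀ i, 0 < m i) {α : ℝ} (hα : 0 < α)
    (hmass : ∀ g ∈ G, ∀ i, m (sigma g i) = m i) (hcoll : ¬ BoundToCollisions m G)
    (hunc : ¬ FullyUncoercive m α G) (C : IsCyclicGroup G p A s) :
    ∃ H : SpaceExtension, Equivalent G H.group := by
  obtain ⟨e, he⟩ := exists_det_eq A
  obtain ⟨u, hu, hAu⟩ := exists_axis A
  obtain ⟨π, hπ⟩ := perm_cyclic_cases s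
  have hms := hmass _ C.shift_mem
  have hno : ¬ HasLineConfig m s 1 e 1 := fun h => hunc (C.fullyUncoercive hα hcoll he h)
  have hno' : ¬ HasLineConfig (fun i => m (π⁻¹ i)) (π * s * π⁻¹) 1 e 1 := fun h =>
    hno (HasLineConfig.of_conj (π := π) (by simpa using h))
  have sym : π * s * π⁻¹ = 1 ∨ π * s * π⁻¹ = swap12 → e = -1 := fun h => by
    rcases units_cases e with rfl | rfl
    · exact absurd (hasLineConfig_symmetric (fun i => hm _) h (Or.inl rfl)) hno'
    · rfl
  rcases hπ with h | h | h
  · obtain rfl := sym (Or.inl h)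
    exact ⟨.C1_m, C.equivalent_of_axis hu hAu he two_pos h (by decide) (by decide)⟩
  · obtain rfl := sym (Or.inr h)
    refine absurd ?_ hno'
    have := hasLineConfig_antisymmetric (m := fun i => m (π⁻¹ i)) (s := π * s * π⁻¹) (σ := 1)
      (mass_conj hms) (fun _ => rfl) (Or.inl (by rw [h]; decide)) (Or.inr h) (Or.inl rfl)
    rw [Equiv.Perm.sign_one] at this
    convert this
    rw [h]; decide
  · rcases units_cases e with rfl | rfl
    · exact ⟨.C3_p, C.equivalent_of_axis hu hAu he (by norm_num) h (by decide) (by decide)⟩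
    · exact ⟨.C3_m, C.equivalent_of_axis hu hAu he (by norm_num) h (by decide) (by decide)⟩

lemma det_mul_eq {e d : ℤˣ} (he : A.1.det = ((e : ℤ) : ℝ)) (hd : B.1.det = -((d : ℤ) : ℝ)) :
    (A * B).1.det = -(((e * d : ℤˣ) : ℤ) : ℝ) := by
  change (A.1 * B.1).det = _
  rw [Matrix.det_mul, he, hd]; push_cast; ring

/-- Dihedral groups with a rotation axis. The generators act on the axis by the signs `e` and `d`;
the signs for which the group fixes a configuration on the axis are excluded, and the exchange of
the two classes of reversals replaces `(σ, d)` by `(s σ, e d)`. -/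
lemma IsDihedralGroup.exists_equivalent_of_axis (hm : ∀ i, 0 < m i) {α : ℝ} (hα : 0 < α)
    (hmass : ∀ g ∈ G, ∀ i, m (sigma g i) = m i) (hcoll : ¬ BoundToCollisions m G)
    (hunc : ¬ FullyUncoercive m α G) (D : IsDihedralGroup G p A s q B σ) {u : E} (hu : ‖u‖ = 1)
    (hAu : act A.1 u = A.1.det • u) (hBu : act B.1 u = (-B.1.det) • u) :
    ∃ H : SpaceExtension, Equivalent G H.group := by
  obtain ⟨e, he⟩ := exists_det_eq A
  obtain ⟨d, hd⟩ : ∃ d : ℤˣ, B.1.det = -((d : ℤ) : ℝ) := by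
    obtain ⟨d, hd⟩ := exists_det_eq B
    exact ⟨-d, by rw [hd]; simp⟩
  have hms := hmass _ D.shift_mem
  have hmσ := hmass _ D.reversal_mem
  have hno : ¬ HasLineConfig m s σ e d := fun h => hunc <|
    D.fullyUncoercive hα hcoll h fun w hw => by
      rw [← he, show ((d : ℤ) : ℝ) = -B.1.det by rw [hd, neg_neg]]
      by_cases hw0 : w = 0
      · exact ⟨u, fun h => by simp [h] at hu, hAu, hBu, by simp [hw0, act]⟩
      · have := D.isRotationVector_iff.1 hw
        exact ⟨w, hw0, this.1, this.2, act_Omega_self w⟩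
  have D' := D.mul_reversal
  have hd' := det_mul_eq he hd
  have hBu' : act (A * B).1 u = (-(A * B).1.det) • u := by
    rw [act_coe_mul, hBu, act_smul, hAu, hd', he, hd, smul_smul]
    congr 1; push_cast; ring
  obtain ⟨π, ⟨hs, hσ⟩ | ⟨hs, hσ⟩⟩ := perm_dihedral_cases s σ D.sigma_sq D.sigma_comm
  · have hno' : ¬ HasLineConfig (fun i => m (π⁻¹ i)) (π * s * π⁻¹) (π * σ * π⁻¹) e d :=
      fun h => hno h.of_conj
    have sym : ¬ (e = 1 ∧ d = 1) := by
      rintro ⟨rfl, rfl⟩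
      exact hno' (hasLineConfig_symmetric (fun i => hm _) hs hσ)
    have anti : (π * s * π⁻¹ ≠ 1 ∨ π * σ * π⁻¹ ≠ 1) →
        ¬ (e = Equiv.Perm.sign (π * s * π⁻¹) ∧ d = Equiv.Perm.sign (π * σ * π⁻¹)) := by
      rintro hne ⟨rfl, rfl⟩
      exact hno' (hasLineConfig_antisymmetric (mass_conj hms) (mass_conj hmσ) hne hs hσ)
    have hsσ := conj_mul_conj π s σ
    have hsw : swap12 ≠ 1 := by decide
    have hsg : Equiv.Perm.sign swap12 = -1 := by decide
    rcases hs with hs | hs <;> rcases hσ with hσ | hσ <;> rw [hs, hσ] at anti hsσ <;>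
      simp only [Equiv.Perm.sign_one, hsg, ne_eq, hsw, not_true_eq_false, not_false_eq_true,
        or_self, or_true, true_or, forall_const, false_implies] at anti <;>
      simp only [one_mul, mul_one, swap12_mul_self] at hsσ <;>
      rcases units_cases e with rfl | rfl <;> rcases units_cases d with rfl | rfl
    -- `s` and `σ` trivial
    · exact absurd ⟨rfl, rfl⟩ sym
    · exact ⟨.L2_pm, D.equivalent_of_axis hu hAu hBu he hd one_pos hs hσ (by decide) (by decide)⟩
    · exact ⟨.L2_mp, D.equivalent_of_axis hu hAu hBu he hd two_pos hs hσ (by decide) (by decide)⟩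
    · exact ⟨.L2_mp, D'.equivalent_of_axis hu hAu hBu' he hd' two_pos hs hsσ (by decide)
        (by decide)⟩
    -- `s` trivial, `σ` a transposition
    · exact absurd ⟨rfl, rfl⟩ sym
    · exact absurd ⟨rfl, rfl⟩ anti
    · exact ⟨.H2_mp, D.equivalent_of_axis hu hAu hBu he hd two_pos hs hσ (by decide) (by decide)⟩
    · exact ⟨.H2_mp, D'.equivalent_of_axis hu hAu hBu' he hd' two_pos hs hsσ (by decide)
        (by decide)⟩
    -- `s` a transposition, `σ` trivial
    · exact absurd ⟨rfl, rfl⟩ sym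
    · exact ⟨.H4_pm, D'.equivalent_of_axis hu hAu hBu' he hd' two_pos hs hsσ (by decide)
        (by decide)⟩
    · exact absurd ⟨rfl, rfl⟩ anti
    · exact ⟨.H4_mp, D'.equivalent_of_axis hu hAu hBu' he hd' two_pos hs hsσ (by decide)
        (by decide)⟩
    -- `s` and `σ` the same transposition
    · exact absurd ⟨rfl, rfl⟩ sym
    · exact ⟨.H4_pm, D.equivalent_of_axis hu hAu hBu he hd two_pos hs hσ (by decide) (by decide)⟩
    · exact ⟨.H4_mp, D.equivalent_of_axis hu hAu hBu he hd two_pos hs hσ (by decide) (by decide)⟩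
    · exact absurd ⟨rfl, rfl⟩ anti
  · obtain ⟨π', hs', hσ'⟩ := exists_conj_cycle hs hσ
    have h3 : 0 < 3 := by norm_num
    have h6 : 0 < 6 := by norm_num
    rcases units_cases e with rfl | rfl <;> rcases units_cases d with rfl | rfl
    · exact ⟨.L6_pp, D.equivalent_of_axis hu hAu hBu he hd h3 hs hσ (by decide) (by decide)⟩
    · exact ⟨.L6_pm, D.equivalent_of_axis hu hAu hBu he hd h3 hs hσ (by decide) (by decide)⟩
    · exact ⟨.L6_mp, D.equivalent_of_axis hu hAu hBu he hd h6 hs hσ (by decide) (by decide)⟩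
    · exact ⟨.L6_mp, D'.equivalent_of_axis hu hAu hBu' he hd' h6 hs' hσ' (by decide) (by decide)⟩

/-- An involution acts by a sign on the plane orthogonal to its axis. -/
lemma exists_sign_of_involution {M : O 3} (hM : M * M = 1) {u : E} (hu : ‖u‖ = 1)
    (hMu : act M.1 u = M.1.det • u) :
    ∃ c : ℤˣ, ∀ x, inner ℝ u x = 0 → act M.1 x = ((c : ℤ) : ℝ) • x := by
  obtain ⟨e, he⟩ := exists_det_eq M
  -- `det M • M` is a rotation and an involution
  obtain ⟨R, hR⟩ : ∃ R : O 3, R.1 = ((e : ℤ) : ℝ) • M.1 := by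
    rcases units_cases e with rfl | rfl
    · exact ⟨M, by simp⟩
    · exact ⟨⟨-M.1, neg_mem_O M⟩, by simp⟩
  have hact : ∀ x, act R.1 x = ((e : ℤ) : ℝ) • act M.1 x := fun x => by
    rw [hR, act_smul_left]
  have hact' : ∀ x, act M.1 x = ((e : ℤ) : ℝ) • act R.1 x := fun x => by
    rw [hact, smul_smul, coe_units_mul_self, one_smul]
  have hdet : R.1.det = 1 := by
    rw [hR, Matrix.det_smul, he, Fintype.card_fin]
    linear_combination (((e : ℤ) : ℝ) * ((e : ℤ) : ℝ) + 1) * coe_units_mul_self e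
  have hRR : R * R = 1 := by
    refine O_ext fun x => ?_
    rw [act_coe_mul, hact, hact, act_smul, smul_smul, coe_units_mul_self, ← act_coe_mul, hM,
      one_smul]
  rcases eq_one_or_isHalfTurn R hdet hRR with h1 | ⟨v, hv, h⟩
  · exact ⟨e, fun x _ => by rw [hact', h1, act_coe_one]⟩
  · refine ⟨-e, fun x hx => ?_⟩
    have hRu : act R.1 u = u := by rw [hact, hMu, he, smul_smul, coe_units_mul_self, one_smul]
    have hvu : (inner ℝ v u : ℝ) • v = u := by
      have h2 := h u
      rw [hRu, eq_sub_iff_add_eq, ← two_smul ℝ u, mul_smul] at h2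
      exact (smul_right_injective E (two_ne_zero (α := ℝ)) h2).symm
    have hvx : (inner ℝ v x : ℝ) = 0 := by
      rw [← hvu, inner_smul_left] at hx
      refine (mul_eq_zero.1 hx).resolve_left fun h0 => ?_
      simp only [RCLike.conj_to_real] at h0
      rw [h0, zero_smul] at hvu
      simp [← hvu] at hu
    rw [hact', h, hvx]; push_cast; module

/-- The generators of a dihedral group without rotation axis are simultaneously diagonal: each of
them acts by a sign on a vector `u` and by a sign on the plane orthogonal to `u`. When `A` is a
scalar, so is `B`, as it has no eigenvector of eigenvalue `-det B` in this plane. -/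
lemma IsDihedralGroup.exists_eigen_of_no_axis (D : IsDihedralGroup G p A s q B σ)
    (hbad : ∀ w, IsRotationVector G w → w = 0) :
    ∃ (u : E) (a a' b b' : ℤˣ), ‖u‖ = 1 ∧ act A.1 u = ((a : ℤ) : ℝ) • u ∧
      act B.1 u = ((b : ℤ) : ℝ) • u ∧
      (∀ x, inner ℝ u x = 0 → act A.1 x = ((a' : ℤ) : ℝ) • x) ∧
      (∀ x, inner ℝ u x = 0 → act B.1 x = ((b' : ℤ) : ℝ) • x) ∧
      (a' = a → b' = b) := by
  obtain ⟨a, ha⟩ := exists_det_eq A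
  obtain ⟨b, hb⟩ := exists_det_eq B
  have haa := coe_units_mul_self a
  have hbb := coe_units_mul_self b
  have hBB : ∀ x, act B.1 (act B.1 x) = x := fun x => by
    rw [← act_coe_mul, D.rho_sq, act_coe_one]
  -- `B` preserves the eigenspace of `A`, which has no rotation vector
  have hF : ∀ v, act A.1 v = ((a : ℤ) : ℝ) • v → act B.1 v = ((b : ℤ) : ℝ) • v := by
    intro v hv
    have hAinv : act (A⁻¹).1 v = ((a : ℤ) : ℝ) • v := by
      have := act_inv_act A v
      rw [hv, act_smul] at this
      conv_rhs => rw [← this]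
      rw [smul_smul, haa, one_smul]
    have hABv : act A.1 (act B.1 v) = ((a : ℤ) : ℝ) • act B.1 v := by
      have h1 : A * B = B * A⁻¹ := by
        have := D.rho_comm
        calc A * B = A * (B * A) * A⁻¹ := by group
          _ = B * A⁻¹ := by rw [this]; group
      rw [← act_coe_mul, h1, act_coe_mul, hAinv, act_smul]
    have hw := hbad (v - ((b : ℤ) : ℝ) • act B.1 v) (D.isRotationVector_iff.2 ⟨?_, ?_⟩)
    · rw [sub_eq_zero] at hw
      conv_rhs => rw [hw]
      rw [smul_smul, hbb, one_smul]
    · rw [act_sub, act_smul, hv, hABv, ha]; module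
    · rw [act_sub, act_smul, hBB, hb]
      rw [smul_sub, smul_smul, neg_mul, hbb]; module
  obtain ⟨u, hu, hAu⟩ := exists_axis A
  rw [ha] at hAu
  have hBu := hF u hAu
  obtain ⟨b', hb'⟩ := exists_sign_of_involution D.rho_sq hu (by rw [hb, hBu])
  have hperp : ∀ x, inner ℝ u x = 0 → inner ℝ u (act A.1 x) = 0 := by
    intro x hx
    have := inner_act A u x
    rw [hAu, hx, inner_smul_left] at this
    refine (mul_eq_zero.1 this).resolve_left ?_
    rcases units_cases a with rfl | rfl <;> simp
  -- `B` is a sign on the plane orthogonal to `u`, so that the dihedral relation gives `A² = 1`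
  have hAA : A * A = 1 := by
    refine O_ext fun x => ?_
    have hx : x = (inner ℝ u x : ℝ) • u + (x - (inner ℝ u x : ℝ) • u) := by abel
    have hy : inner ℝ u (x - (inner ℝ u x : ℝ) • u) = 0 := by
      rw [inner_sub_right, inner_smul_right, real_inner_self_eq_norm_sq, hu]; ring
    set y := x - (inner ℝ u x : ℝ) • u
    have hAAu : act A.1 (act A.1 u) = u := by
      rw [hAu, act_smul, hAu, smul_smul, haa, one_smul]
    have hAAy : act A.1 (act A.1 y) = y := by
      have h1 : act B.1 (act A.1 y) = act (A⁻¹).1 (act B.1 y) := by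
        rw [← act_coe_mul, ← act_coe_mul, D.rho_comm]
      rw [hb' _ (hperp y hy), hb' y hy, act_smul] at h1
      have h2 : act A.1 y = act (A⁻¹).1 y := by
        have := congrArg (fun z => ((b' : ℤ) : ℝ) • z) h1
        simpa only [smul_smul, coe_units_mul_self, one_smul] using this
      rw [h2, ← act_coe_mul, mul_inv_cancel, act_coe_one]
    rw [act_coe_mul, act_coe_one]
    conv_lhs => rw [hx]
    rw [act_add, act_add, act_smul, act_smul, hAAu, hAAy, ← hx]
  obtain ⟨a', ha'⟩ := exists_sign_of_involution hAA hu (by rw [ha, hAu])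
  refine ⟨u, a, a', b, b', hu, hAu, hBu, ha', hb', fun h => ?_⟩
  obtain ⟨c, hc⟩ := exists_basis_of_unit hu
  have hc0 : inner ℝ u (c 0) = 0 := by rw [← hc, inner_basis]; simp
  have h1 := hb' _ hc0
  rw [hF _ (by rw [ha' _ hc0, h])] at h1
  have hne : c 0 ≠ 0 := c.orthonormal.ne_zero 0
  have h2 := smul_left_injective ℝ hne h1
  exact Units.ext (by exact_mod_cast h2.symm)

/-- The signs left by the absence of collisions at the times fixed by the two classes of reversals,
when the bodies are not permuted cyclically. Here `S` and `T` are the signatures of the permutations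
of the two generators; the conclusion says that the generators act by these signs on `u` or on the
plane orthogonal to `u`, where they therefore fix a configuration. -/
lemma signs_of_no_collision : ∀ a a' b b' S T : ℤˣ, (a' = a → b' = b) → (b' = b → b = T) →
    (a' * b' = a * b → a * b = S * T) → (a = S ∧ b = T) ∨ (a' = S ∧ b' = T) := by decide

/-- Dihedral groups without rotation axis. -/
lemma IsDihedralGroup.exists_equivalent_of_no_axis {α : ℝ} (hα : 0 < α)
    (hmass : ∀ g ∈ G, ∀ i, m (sigma g i) = m i) (hcoll : ¬ BoundToCollisions m G)
    (hm : ∀ i, 0 < m i)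
    (hunc : ¬ FullyUncoercive m α G) (D : IsDihedralGroup G p A s q B σ)
    (hbad : ∀ w, IsRotationVector G w → w = 0) :
    ∃ H : SpaceExtension, Equivalent G H.group := by
  obtain ⟨u, a, a', b, b', hu, hAu, hBu, hA', hB', hab⟩ := D.exists_eigen_of_no_axis hbad
  obtain ⟨f, hf⟩ := exists_basis_of_unit hu
  have hf0 : ∀ i : Fin 3, i ≠ 2 → inner ℝ u (f i) = 0 := fun i hi => by
    rw [← hf, inner_basis, if_neg (Ne.symm hi)]
  have hms := hmass _ D.shift_mem
  have hmσ := hmass _ D.reversal_mem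
  have hu0 : u ≠ 0 := fun h => by simp [h] at hu
  have hno : ¬ HasLineConfig m s σ a b := fun h => hunc <|
    D.fullyUncoercive hα hcoll h fun w hw => ⟨u, hu0, hAu, hBu, by simp [hbad w hw, act]⟩
  have hno' : ¬ HasLineConfig m s σ a' b' := fun h => hunc <|
    D.fullyUncoercive hα hcoll h fun w hw => ⟨f 0, f.orthonormal.ne_zero 0,
      hA' _ (hf0 0 (by decide)), hB' _ (hf0 0 (by decide)), by simp [hbad w hw, act]⟩
  have D' := D.mul_reversal
  have hABu : act (A * B).1 u = (((a * b : ℤˣ) : ℤ) : ℝ) • u := by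
    rw [act_coe_mul, hBu, act_smul, hAu, smul_smul]; congr 1; push_cast; ring
  have hAB' : ∀ x, inner ℝ u x = 0 → act (A * B).1 x = (((a' * b' : ℤˣ) : ℤ) : ℝ) • x := by
    intro x hx
    rw [act_coe_mul, hB' x hx, act_smul, hA' x hx, smul_smul]; congr 1; push_cast; ring
  -- an orthogonal map that is the same sign on the axis and on the plane is this sign
  have hscalar : ∀ (M : O 3) (c : ℤˣ), act M.1 u = ((c : ℤ) : ℝ) • u →
      (∀ x, inner ℝ u x = 0 → act M.1 x = ((c : ℤ) : ℝ) • x) →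
      ∀ x, act M.1 x = ((c : ℤ) : ℝ) • x := by
    intro M c h1 h2 x
    have hx : x = (inner ℝ u x : ℝ) • u + (x - (inner ℝ u x : ℝ) • u) := by abel
    have hy : inner ℝ u (x - (inner ℝ u x : ℝ) • u) = 0 := by
      rw [inner_sub_right, inner_smul_right, real_inner_self_eq_norm_sq, hu]; ring
    conv_lhs => rw [hx]
    rw [act_add, act_smul, h1, h2 _ hy]; module
  obtain ⟨π, ⟨hs, hσ⟩ | ⟨hs, hσ⟩⟩ := perm_dihedral_cases s σ D.sigma_sq D.sigma_comm
  · exfalso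
    -- a reversal acting as a sign on space acts by the signature of its permutation
    have key : ∀ {M : O 3} {t : ℝ} {τ : Equiv.Perm (Fin 3)}, IsDihedralGroup G p A s t M τ →
        (π * τ * π⁻¹ = 1 ∨ π * τ * π⁻¹ = swap12) → ∀ c : ℤˣ,
        (∀ x, act M.1 x = ((c : ℤ) : ℝ) • x) → c = Equiv.Perm.sign (π * τ * π⁻¹) := by
      intro M t τ DM hτ c hc
      rcases units_cases c with rfl | rfl
      · have h1 := DM.sigma_eq_one_of_rho_eq_one hcoll fun x => by simpa using hc x
        rw [h1]; simp
      · have h1 := DM.sigma_ne_one_of_rho_eq_neg hcoll fun x => by simpa using hc x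
        rcases hτ with h | h
        · exact absurd (conj_eq_one_iff.1 h) h1
        · rw [h]; decide
    have hsσ : π * (s * σ) * π⁻¹ = 1 ∨ π * (s * σ) * π⁻¹ = swap12 := by
      rw [conj_mul_conj]
      rcases hs with hs | hs <;> rcases hσ with hσ | hσ <;> rw [hs, hσ] <;> decide
    have hconf : HasLineConfig m s σ (Equiv.Perm.sign (π * s * π⁻¹))
        (Equiv.Perm.sign (π * σ * π⁻¹)) := by
      by_cases h : π * s * π⁻¹ ≠ 1 ∨ π * σ * π⁻¹ ≠ 1
      · exact HasLineConfig.of_conj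
          (hasLineConfig_antisymmetric (mass_conj hms) (mass_conj hmσ) h hs hσ)
      · push Not at h
        rw [h.1, h.2, Equiv.Perm.sign_one]
        exact HasLineConfig.of_conj (π := π) (hasLineConfig_symmetric (fun i => hm _) hs hσ)
    rcases signs_of_no_collision a a' b b' (Equiv.Perm.sign (π * s * π⁻¹))
      (Equiv.Perm.sign (π * σ * π⁻¹)) hab
      (fun h => key D hσ b (hscalar B b hBu (by rw [← h]; exact hB')))
      (fun h => by
        have := key D' hsσ (a * b) (hscalar _ _ hABu (by rw [← h]; exact hAB'))
        rw [this, conj_mul_conj, Equiv.Perm.sign_mul]) with ⟨h1, h2⟩ | ⟨h1, h2⟩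
    · exact hno (by rw [h1, h2]; exact hconf)
    · exact hno' (by rw [h1, h2]; exact hconf)
  · obtain ⟨π', hs', hσ'⟩ := exists_conj_cycle hs hσ
    -- a reversal that exchanges two bodies does not act trivially on space
    have key : ∀ {M : O 3} {t : ℝ} {τ ϖ : Equiv.Perm (Fin 3)}, IsDihedralGroup G p A s t M τ →
        ϖ * τ * ϖ⁻¹ = swap12 → ∀ c c' : ℤˣ, act M.1 u = ((c : ℤ) : ℝ) • u →
        (∀ x, inner ℝ u x = 0 → act M.1 x = ((c' : ℤ) : ℝ) • x) → ¬ (c = 1 ∧ c' = 1) := by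
      rintro M t τ ϖ DM hτ c c' h1 h2 ⟨rfl, rfl⟩
      have := DM.sigma_eq_one_of_rho_eq_one hcoll fun x => by simpa using hscalar M 1 h1 h2 x
      rw [this] at hτ
      exact absurd hτ (by simp only [mul_one, mul_inv_cancel]; decide)
    have k1 := key D hσ b b' hBu hB'
    have k2 := key D' hσ' (a * b) (a' * b') hABu hAB'
    have eig : ∀ (M : O 3) (c c' : ℤˣ), act M.1 u = ((c : ℤ) : ℝ) • u →
        (∀ x, inner ℝ u x = 0 → act M.1 x = ((c' : ℤ) : ℝ) • x) →
        ∀ i, act M.1 (f i) = (((![c', c', c] : Fin 3 → ℤˣ) i : ℤ) : ℝ) • f i := by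
      intro M c c' h1 h2 i
      fin_cases i
      · exact h2 _ (hf0 0 (by decide))
      · exact h2 _ (hf0 1 (by decide))
      · simpa [hf] using h1
    have eig' : ∀ (M : O 3) (c c' : ℤˣ), act M.1 u = ((c : ℤ) : ℝ) • u →
        (∀ x, inner ℝ u x = 0 → act M.1 x = ((c' : ℤ) : ℝ) • x) →
        ∀ i, act M.1 (f.reindex (Equiv.swap 0 2) i) =
          (((![c, c', c'] : Fin 3 → ℤˣ) i : ℤ) : ℝ) • f.reindex (Equiv.swap 0 2) i := by
      intro M c c' h1 h2 i
      rw [OrthonormalBasis.reindex_apply]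
      fin_cases i
      · simpa [hf] using h1
      · exact h2 _ (hf0 1 (by decide))
      · exact h2 _ (hf0 0 (by decide))
    have h3 : 0 < 3 := by norm_num
    have h6 : 0 < 6 := by norm_num
    -- each choice of signs is excluded or standard, for one of the two classes of reversals; in the
    -- basis of `D₁₂` the vector `u` is the horizontal axis fixed by the shift
    rcases units_cases a with rfl | rfl <;> rcases units_cases a' with rfl | rfl <;>
      rcases units_cases b with rfl | rfl <;> rcases units_cases b' with rfl | rfl <;>
      first
      | exact absurd ⟨rfl, rfl⟩ k1
      | exact absurd ⟨by decide, by decide⟩ k2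
      | exact absurd (hab rfl) (by decide)
      | exact ⟨.D6_pm, D.equivalent_of_eigen (a := ![1, 1, 1]) (c := ![-1, -1, -1]) h3 f
          (eig A _ _ hAu hA') (eig B _ _ hBu hB') hs hσ (by decide) (by decide)⟩
      | exact ⟨.D6_mp, D.equivalent_of_eigen (a := ![1, 1, -1]) (c := ![-1, -1, 1]) h6 f
          (eig A _ _ hAu hA') (eig B _ _ hBu hB') hs hσ (by decide) (by decide)⟩
      | exact ⟨.D6_mp, D'.equivalent_of_eigen (a := ![1, 1, -1]) (c := ![-1, -1, 1]) h6 f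
          (eig A _ _ hAu hA') (eig (A * B) _ _ hABu hAB') hs' hσ' (by decide) (by decide)⟩
      | exact ⟨.D12_mp, D.equivalent_of_eigen (a := ![1, -1, -1]) (c := ![-1, 1, 1]) h6
          (f.reindex (Equiv.swap 0 2))
          (eig' A _ _ hAu hA') (eig' B _ _ hBu hB') hs hσ (by decide) (by decide)⟩
      | exact ⟨.D12_mp, D'.equivalent_of_eigen (a := ![1, -1, -1]) (c := ![-1, 1, 1]) h6
          (f.reindex (Equiv.swap 0 2))
          (eig' A _ _ hAu hA') (eig' (A * B) _ _ hABu hAB') hs' hσ' (by decide) (by decide)⟩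

end

theorem exists_equivalent_of_core_eq_bot (hm : ∀ i, 0 < m i) {α : ℝ} (hα : 0 < α)
    {G : Subgroup Sym} (hmass : ∀ g ∈ G, ∀ i, m (sigma g i) = m i)
    (hcoll : ¬ BoundToCollisions m G) (hunc : ¬ FullyUncoercive m α G)
    (hhom : ¬ Homographic m G) (hcore : core G = ⊥) :
    ∃ H : SpaceExtension, Equivalent G H.group := by
  rcases isCyclicGroup_or_isDihedralGroup hhom hcore with ⟨p, A, s, C⟩ | ⟨p, A, s, q, B, σ, D⟩
  · exact C.exists_equivalent hm hα hmass hcoll hunc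
  · by_cases h : ∀ w, IsRotationVector G w → w = 0
    · exact D.exists_equivalent_of_no_axis hα hmass hcoll hm hunc h
    · push Not at h
      obtain ⟨w, hw, hw0⟩ := h
      obtain ⟨h1, h2⟩ := D.isRotationVector_iff.1 hw
      exact D.exists_equivalent_of_axis hm hα hmass hcoll hunc (norm_inv_smul hw0)
        (by rw [act_smul, h1, smul_comm]) (by rw [act_smul, h2, smul_comm])

end ThreeBody

theorem theoremA (m : Fin 3 → ℝ) (hm : ∀ i, 0 < m i) (α : ℝ) (hα : 0 < α)
    (G : Subgroup ThreeBody.Sym)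
    (hmass : ∀ g ∈ G, ∀ i, m (ThreeBody.sigma g i) = m i)
    (hspace : ∀ g ∈ G, ThreeBody.tau g = 1 → ThreeBody.sigma g = 1 →
      ¬ ThreeBody.IsPlaneReflection (ThreeBody.rho g))
    (hcoll : ¬ ThreeBody.BoundToCollisions m G)
    (hunc : ¬ ThreeBody.FullyUncoercive m α G)
    (hhom : ¬ ThreeBody.Homographic m G) :
    (ThreeBody.core G = ⊥ →
      ∃ H : ThreeBody.SpaceExtension, ThreeBody.Equivalent G H.group) ∧
    (ThreeBody.core G ≠ ⊥ → ThreeBody.VerticalIsosceles G) :=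
  ⟨ThreeBody.exists_equivalent_of_core_eq_bot hm hα hmass hcoll hunc hhom,
    ThreeBody.verticalIsosceles_of_core_ne_bot hm hα hmass hspace hcoll hunc hhom⟩
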